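/- Setting. Let $P$ be a finite set of points in the plane, no three collinear, with convex hull vertices $c_1,\dots,c_k$ ($k\ge 3$) in counterclockwise order (indices mod $k$), and let $P'$ be the set of the other points of $P$. Write $CH(X)$ for the convex hull of $X$. An inward triangle is an empty triangle $c_{i-1}ac_i$ with $a\in P'$ (no point of $P$ in its interior), or, as a degenerate case, a segment $c_ia$ with $a\in P'$. Here $a$ is its inward vertex and $c_ia$ its right edge. The triangle $c_{i-1}ac_i$ is forbidden if there are two hull vertices $p_r,p_t$ such that $c_{i-1}c_i$ lies on the clockwise hull chain from $p_r$ to $p_t$ and $a$ becomes a hull vertex when the hull vertices strictly between $p_r$ and $p_t$ on the counterclockwise chain from $p_r$ to $p_t$ are deleted from $P$. The segment $c_ia$ is forbidden if $a$ is a vertex of $CH(P')$ and $c_ia$ meets the interior of $CH(P')$. For a finite multiset $\mathcal S$ of inward triangles in which only degenerate ones may be repeated, let $L(\mathcal S)$ be the cyclic list of its triangles without repetitions, taken for $i=1,\dots,k$ in clockwise order around $c_i$ starting from $c_{i-1}$ (a triangle on a hull edge is listed once). A point of $P'$ is free if it is not the inward vertex of any triangle of $\mathcal S$. Below, a segment $pq$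 intersects a triangle if the segment without its endpoints meets the closed triangle. $\mathcal S$ is good if: 1. $|\mathcal S|=|P'|$. 2. No triangle of $\mathcal S$ is forbidden. 3. Distinct triangles of $\mathcal S$ have disjoint (relative) interiors. 4. Every vertex of $CH(P')$ is the inward vertex of some triangle of $\mathcal S$. 5. Every edge $c_{i-1}c_i$ has a nondegenerate inward triangle in $\mathcal S$. 6. No segment joining two free points intersects a triangle of $\mathcal S$. 7. If $t$ has right edge $c_ia_i$ and the next triangle in $L(\mathcal S)$ has the same inward vertex $a_i$, then for every free point $x$: $x$ is to the right of $\overrightarrow{c_ia_i}$; and if a triangle of $\mathcal S$ with right edge $c_ja_j$ intersects $c_ix$, then $c_j$ is to the right of $\overrightarrow{c_ix}$, $a_j$ is to its left, and $a_j=a_i$ or $a_j$ is to the right of $\overrightarrow{c_ia_i}$. 8. If $t$ has right edge $c_ia_i$ and the next triangle in $L(\mathcal S)$ has inward vertex $a_{i+1}\ne a_i$, then for every free point $x$: $a_{i+1}x$ does not intersect $t$; and if a triangle of $\mathcal S$ with right edge $c_ja_j$ intersects $a_{i+1}x$, then $c_j$ is to the right of $\overrightarrow{a_{i+1}x}$,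 $a_j$ is to its left, and $a_{i+1}a_j$ does not intersect $t$. Moreover, no point of $P'$ lies in the interior of the triangle $a_ic_ia_{i+1}$. Statement. Suppose that $\mathcal S$ is a good set for $P$ in which all inward triangles (degenerate ones and repetitions counted) have distinct inward vertices. Let $C$ be its inner cycle, the closed polygon joining the inward vertices of consecutive triangles of $L(\mathcal S)$. Then there are $T$ and $D$ such that $(T,C,D)$ is a consistent triple, that is: * $C$ is a simple polygon whose vertex set is $P'$, and $T$ is a triangulation, with vertices in $P$, of the closed annular region between $CH(P)$ and $C$. * No edge of $T$ is a chord of $CH(P)$ (a segment joining two nonconsecutive hull vertices). * No two inward triangles of $T$ (triangles with two vertices on $CH(P)$ and one, the inward vertex, in $P'$) have the same inward vertex. * $D$ is a set of pairwise non-crossing diagonals of $C$ such that $T\cup C\cup D$ has no complex triangle (three pairwise adjacent points whose triangle has a point of $P$ in its interior and a point of $P$ in its exterior), and $D$ is maximal under inclusion among such sets. * For every region $R_i$ into which $D$ divides the interior of $C$ and which has at least four vertices, the vertices of $R_i$ can be labelled $a_0,a_1,\dots,a_l$ in clockwise or counterclockwise order so that, for some hull vertex $c_j$: (i) $a_1,\dots,a_l$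 are consecutive on $C$; (ii) $a_1,\dots,a_l$ are all adjacent to $c_j$ in $T$; (iii) $a_1a_l$ is a diagonal of $R_i$; (iv) $a_m$ lies in the interior of the triangle $a_1a_lc_j$ for all $1<m<l$; (v) no $a_0a_m$ is a diagonal of $R_i$. -/

import Mathlib

/-- The Euclidean plane. -/
abbrev Plane : Type := EuclideanSpace ℝ (Fin 2)

namespace FourConn

/-! ### Elementary plane geometry -/

/-- Twice the signed area of the triangle `pqr`; positive iff `p, q, r` is a left turn. -/
def orient (p q r : Plane) : ℝ :=
  (q 0 - p 0) * (r 1 - p 1) - (q 1 - p 1) * (r 0 - p 0)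

/-- `r` lies to the left of the ray from `p` through `q`. -/
def LeftOf (p q r : Plane) : Prop := 0 < orient p q r

/-- `r` lies to the right of the ray from `p` through `q`. -/
def RightOf (p q r : Plane) : Prop := orient p q r < 0

/-- The (relative) interior of the triangle `pqr`, i.e. the convex combinations with positive
coefficients. If `p = r ≠ q` this is the open segment `pq`. -/
def openTriangle (p q r : Plane) : Set Plane :=
  {x | ∃ α β γ : ℝ, 0 < α ∧ 0 < β ∧ 0 < γ ∧ α + β + γ = 1 ∧ x = α • p + β • q + γ • r}

/-- No three points of `P` are collinear. -/
def GeneralPosition (P : Finset Plane) : Prop :=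
  ∀ p ∈ P, ∀ q ∈ P, ∀ r ∈ P, p ≠ q → p ≠ r → q ≠ r → ¬ Collinear ℝ ({p, q, r} : Set Plane)

/-- `c 0, c 1, …, c (k-1)` are the vertices of the convex hull of `P` in counterclockwise order
(indices are taken modulo `k`). -/
structure IsHullCycle {k : ℕ} (P : Finset Plane) (c : ZMod k → Plane) : Prop where
  three_le : 3 ≤ k
  injective : Function.Injective c
  range_eq : Set.range c = Set.extremePoints ℝ (convexHull ℝ (P : Set Plane))
  ccw : ∀ i, ∀ p ∈ P, p ≠ c i → p ≠ c (i + 1) → LeftOf (c i) (c (i + 1)) p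

open Classical in
/-- `P'`: the points of `P` that are not vertices of the convex hull of `P`. -/
noncomputable def innerPoints {k : ℕ} (P : Finset Plane) (c : ZMod k → Plane) : Finset Plane :=
  P.filter (fun p => p ∉ Set.range c)

/-- The vertices of `CH(P')`. -/
def innerHullVertices {k : ℕ} (P : Finset Plane) (c : ZMod k → Plane) : Set Plane :=
  Set.extremePoints ℝ (convexHull ℝ (innerPoints P c : Set Plane))

/-- The ordered pairs of cyclically consecutive entries of a list. -/
def cyclicPairs {α : Type*} (l : List α) : List (α × α) := l.zip (l.rotate 1)

/-! ### Inward triangles and good sets -/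

/-- A (possibly degenerate) inward triangle, given by the index `i` of its right hull vertex `c i`,
its inward vertex `apex`, and a flag. It is the triangle `c (i-1), apex, c i` if
`degenerate = false`, and the segment `c i, apex` if `degenerate = true`. -/
structure InwardTriangle (k : ℕ) where
  i : ZMod k
  apex : Plane
  degenerate : Bool

namespace InwardTriangle

variable {k : ℕ}

/-- The left hull vertex. -/
def left (c : ZMod k → Plane) (t : InwardTriangle k) : Plane :=
  if t.degenerate = true then c t.i else c (t.i - 1)

/-- The right hull vertex; the right edge joins it to the inward vertex. -/
def right (c : ZMod k → Plane) (t : InwardTriangle k) : Plane := c t.i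

/-- The closed triangle (or segment). -/
def closedRegion (c : ZMod k → Plane) (t : InwardTriangle k) : Set Plane :=
  convexHull ℝ {t.left c, t.apex, t.right c}

/-- The open triangle (or open segment). -/
def openRegion (c : ZMod k → Plane) (t : InwardTriangle k) : Set Plane :=
  openTriangle (t.left c) t.apex (t.right c)

/-- The inward vertex is a point of `P'`, and a nondegenerate inward triangle is empty. -/
def IsValid (P : Finset Plane) (c : ZMod k → Plane) (t : InwardTriangle k) : Prop :=
  t.apex ∈ innerPoints P c ∧
    (t.degenerate = false → ∀ p ∈ P, p ∉ t.openRegion c)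

/-- Forbidden triangles.
* A nondegenerate triangle on the hull edge `bc` with inward vertex `a` is forbidden if `a` becomes
  a hull vertex after deleting from `P` all hull vertices strictly between two hull vertices
  `p_r` and `p_t` on the counterclockwise chain from `p_r` to `p_t` (here `t = r + n`), where `bc`
  is an edge of the other chain.
* A degenerate triangle `c_i u` is forbidden if `u` is a vertex of `CH(P')` and `c_i u` meets the
  interior of `CH(P')`. -/
def IsForbidden (P : Finset Plane) (c : ZMod k → Plane) (t : InwardTriangle k) : Prop :=
  (t.degenerate = false ∧ ∃ (r : ZMod k) (n : ℕ), 0 < n ∧ n < k ∧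
    (∀ j : ℕ, 0 < j → j < n → c (r + j) ≠ t.left c ∧ c (r + j) ≠ t.right c) ∧
    t.apex ∈ Set.extremePoints ℝ (convexHull ℝ
      ((P : Set Plane) \ {q | ∃ j : ℕ, 0 < j ∧ j < n ∧ q = c (r + j)}))) ∨
  (t.degenerate = true ∧ t.apex ∈ innerHullVertices P c ∧
    (segment ℝ (t.right c) t.apex ∩
      interior (convexHull ℝ (innerPoints P c : Set Plane))).Nonempty)

/-- The order of the list `L(S)`: first by the index of the right hull vertex `c_i`; then, around
`c_i`, clockwise starting from `c_{i-1}`, so that the triangle on the edge `c_{i-1}c_i` comes first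
and the degenerate triangles at `c_i` follow in clockwise order. (The triangle on the edge
`c_i c_{i+1}`, which is the last one around `c_i`, is listed once, as the first one around
`c_{i+1}`.) -/
def Before (c : ZMod k → Plane) (t t' : InwardTriangle k) : Prop :=
  t.i.val < t'.i.val ∨
  (t.i = t'.i ∧
    ((t.degenerate = false ∧ t'.degenerate = true) ∨
     (t.degenerate = true ∧ t'.degenerate = true ∧ RightOf (c t.i) t.apex t'.apex)))

/-- The segment `pq` (without its endpoints) intersects the triangle `t`. -/
def Meets (c : ZMod k → Plane) (p q : Plane) (t : InwardTriangle k) : Prop :=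
  (openSegment ℝ p q ∩ t.closedRegion c).Nonempty

end InwardTriangle

/-- `L` is the list `L(S)`: the triangles of `S` without repetition in their order around the hull.
It is read cyclically. -/
structure IsTriangleList {k : ℕ} (c : ZMod k → Plane) (S : Multiset (InwardTriangle k))
    (L : List (InwardTriangle k)) : Prop where
  nodup : L.Nodup
  mem_iff : ∀ t, t ∈ L ↔ t ∈ S
  sorted : L.Pairwise (InwardTriangle.Before c)

/-- `x` is a free point: a point of `P'` that is not the inward vertex of a triangle of `S`. -/
def IsFree {k : ℕ} (P : Finset Plane) (c : ZMod k → Plane) (S : Multiset (InwardTriangle k))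
    (x : Plane) : Prop :=
  x ∈ innerPoints P c ∧ ∀ t ∈ S, t.apex ≠ x

/-- Condition on two cyclically consecutive triangles `t, t'` of `L(S)` with the same inward
vertex. -/
def SameVertexCondition {k : ℕ} (P : Finset Plane) (c : ZMod k → Plane)
    (S : Multiset (InwardTriangle k)) (t : InwardTriangle k) : Prop :=
  ∀ x, IsFree P c S x →
    RightOf (t.right c) t.apex x ∧
    ∀ s ∈ S, s.Meets c (t.right c) x →
      RightOf (t.right c) x (s.right c) ∧ LeftOf (t.right c) x s.apex ∧
      (s.apex = t.apex ∨ RightOf (t.right c) t.apex s.apex)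

/-- Condition on two cyclically consecutive triangles `t, t'` of `L(S)` with different inward
vertices. -/
def DistinctVertexCondition {k : ℕ} (P : Finset Plane) (c : ZMod k → Plane)
    (S : Multiset (InwardTriangle k)) (t t' : InwardTriangle k) : Prop :=
  (∀ x, IsFree P c S x →
    ¬ t.Meets c t'.apex x ∧
    ∀ s ∈ S, s.Meets c t'.apex x →
      RightOf t'.apex x (s.right c) ∧ LeftOf t'.apex x s.apex ∧ ¬ t.Meets c t'.apex s.apex) ∧
  ∀ p ∈ innerPoints P c, p ∉ openTriangle t.apex (t.right c) t'.apex

/-- Good (multi)sets of inward triangles. -/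
structure IsGoodSet {k : ℕ} (P : Finset Plane) (c : ZMod k → Plane)
    (S : Multiset (InwardTriangle k)) : Prop where
  valid : ∀ t ∈ S, t.IsValid P c
  /-- only degenerate inward triangles may be repeated -/
  nodup_nondegenerate : (S.filter (fun t => t.degenerate = false)).Nodup
  card_eq : Multiset.card S = (innerPoints P c).card
  not_forbidden : ∀ t ∈ S, ¬ t.IsForbidden P c
  pairwise_disjoint : ∀ t ∈ S, ∀ t' ∈ S, t ≠ t' → Disjoint (t.openRegion c) (t'.openRegion c)
  hull_vertex : ∀ u ∈ innerHullVertices P c, ∃ t ∈ S, t.apex = u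
  hull_edge : ∀ i : ZMod k, ∃ t ∈ S, t.degenerate = false ∧ t.i = i
  free_free : ∀ x y, IsFree P c S x → IsFree P c S y → x ≠ y → ∀ t ∈ S, ¬ t.Meets c x y
  consecutive : ∃ L, IsTriangleList c S L ∧ ∀ t t', (t, t') ∈ cyclicPairs L →
    (t.apex = t'.apex → SameVertexCondition P c S t) ∧
    (t.apex ≠ t'.apex → DistinctVertexCondition P c S t t')

/-- All triangles of `S` (degenerate ones and repetitions included) have distinct inward
vertices. -/
def HasDistinctInwardVertices {k : ℕ} (S : Multiset (InwardTriangle k)) : Prop :=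
  (S.map InwardTriangle.apex).Nodup

/-- `C` is the inner cycle of `S`: the closed polygon that joins the inward vertices of cyclically
consecutive triangles of `L(S)`. -/
def IsInnerCycle {k : ℕ} (c : ZMod k → Plane) (S : Multiset (InwardTriangle k))
    (C : List Plane) : Prop :=
  ∃ L, IsTriangleList c S L ∧ C = L.map InwardTriangle.apex

/-! ### Polygons -/

/-- `pq` is an edge of the closed polygon `C`. -/
def PolygonEdge (C : List Plane) (p q : Plane) : Prop :=
  (p, q) ∈ cyclicPairs C ∨ (q, p) ∈ cyclicPairs C

/-- The union of the edges of the closed polygon `C`. -/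
def polygonCurve (C : List Plane) : Set Plane :=
  {x | ∃ e ∈ cyclicPairs C, x ∈ segment ℝ e.1 e.2}

/-- `C` is a simple (non self-intersecting) polygon: distinct edges meet only in common
endpoints. -/
structure IsSimplePolygon (C : List Plane) : Prop where
  three_le : 3 ≤ C.length
  nodup : C.Nodup
  simple : ∀ e ∈ cyclicPairs C, ∀ f ∈ cyclicPairs C, e ≠ f →
    segment ℝ e.1 e.2 ∩ segment ℝ f.1 f.2 ⊆ ({e.1, e.2} : Set Plane) ∩ {f.1, f.2}

/-- The interior of the simple polygon `C`: the bounded component of the complement of the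
curve. -/
def polygonInterior (C : List Plane) : Set Plane :=
  {x | x ∉ polygonCurve C ∧ Bornology.IsBounded (connectedComponentIn (polygonCurve C)ᶜ x)}

/-- The vertices of `C` on the boundary of the polygonal region `U`. -/
def regionVertices (C : List Plane) (U : Set Plane) : Set Plane :=
  {p | p ∈ C ∧ p ∈ closure U}

/-- `pq` is a diagonal of the open polygonal region `U`: two vertices on its boundary such that
the open segment between them lies in `U`. -/
def IsDiagonal (C : List Plane) (U : Set Plane) (p q : Plane) : Prop :=
  p ≠ q ∧ p ∈ regionVertices C U ∧ q ∈ regionVertices C U ∧ openSegment ℝ p q ⊆ U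

/-- `U` is one of the regions into which the set `D` of diagonals divides the interior of `C`. -/
def IsRegion (C : List Plane) (D : Set (Sym2 Plane)) (U : Set Plane) : Prop :=
  ∃ x ∈ polygonInterior C \ {y | ∃ p q, s(p, q) ∈ D ∧ y ∈ segment ℝ p q},
    U = connectedComponentIn
      (polygonInterior C \ {y | ∃ p q, s(p, q) ∈ D ∧ y ∈ segment ℝ p q}) x

/-! ### Triangulations and consistent triples -/

/-- The closed annular region enclosed by `CH(P)` and `C`. -/
def annularRegion (P : Finset Plane) (C : List Plane) : Set Plane :=
  convexHull ℝ (P : Set Plane) \ polygonInterior C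

/-- `T`, given by its triangles, is a triangulation with vertices in `P` of the region `R`. -/
structure IsTriangulationOf (P : Finset Plane) (R : Set Plane) (T : Finset (Finset Plane)) :
    Prop where
  subset : ∀ t ∈ T, t ⊆ P
  card_eq : ∀ t ∈ T, t.card = 3
  empty : ∀ t ∈ T, ∀ p ∈ P, p ∈ convexHull ℝ (t : Set Plane) → p ∈ t
  disjoint : ∀ t ∈ T, ∀ t' ∈ T, t ≠ t' →
    Disjoint (interior (convexHull ℝ (t : Set Plane))) (interior (convexHull ℝ (t' : Set Plane)))
  cover : {x | ∃ t ∈ T, x ∈ convexHull ℝ (t : Set Plane)} = R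

/-- `pq` is an edge of the triangulation `T`. -/
def TriangulationEdge (T : Finset (Finset Plane)) (p q : Plane) : Prop :=
  p ≠ q ∧ ∃ t ∈ T, p ∈ t ∧ q ∈ t

/-- `pq` is an edge of `T ∪ C ∪ D`. -/
def UnionEdge (T : Finset (Finset Plane)) (C : List Plane) (D : Set (Sym2 Plane))
    (p q : Plane) : Prop :=
  TriangulationEdge T p q ∨ PolygonEdge C p q ∨ s(p, q) ∈ D

/-- The graph with adjacency relation `E` on the point set `P` has a complex triangle: three
pairwise adjacent points whose triangle has a point of `P` in its interior and another one in its
exterior. -/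
def HasComplexTriangle (P : Finset Plane) (E : Plane → Plane → Prop) : Prop :=
  ∃ p q r, p ≠ q ∧ p ≠ r ∧ q ≠ r ∧ E p q ∧ E p r ∧ E q r ∧
    (∃ x ∈ P, x ∈ openTriangle p q r) ∧
    (∃ y ∈ P, y ∉ convexHull ℝ ({p, q, r} : Set Plane))

/-- `D` is a set of pairwise non-intersecting diagonals of `C` such that `T ∪ C ∪ D` has no complex
triangle. -/
structure IsAdmissible (P : Finset Plane) (T : Finset (Finset Plane)) (C : List Plane)
    (D : Set (Sym2 Plane)) : Prop where
  diagonal : ∀ p q, s(p, q) ∈ D → IsDiagonal C (polygonInterior C) p q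
  noncrossing : ∀ p q p' q', s(p, q) ∈ D → s(p', q') ∈ D → s(p, q) ≠ s(p', q') →
    Disjoint (openSegment ℝ p q) (openSegment ℝ p' q')
  no_complex : ¬ HasComplexTriangle P (UnionEdge T C D)

/-- The structure of a region `U` with at least four vertices. Its vertices are
`a₀, a₁, …, a_l`, where `mid` is the list `a₂, …, a_{l-1}`. The vertices of a region occur on its
boundary in the cyclic order of `C`, so this is a labelling in clockwise or counterclockwise order,
because `a₁, …, a_l` are consecutive on `C` (read in one of the two directions) and `a₀` is the only
other vertex. -/
def HasFanStructure {k : ℕ} (c : ZMod k → Plane) (T : Finset (Finset Plane)) (C : List Plane)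
    (U : Set Plane) : Prop :=
  ∃ (a₀ a₁ : Plane) (mid : List Plane) (a_l : Plane) (j : ZMod k),
    (a₀ :: a₁ :: (mid ++ [a_l])).Nodup ∧
    (∀ p, p ∈ regionVertices C U ↔ p ∈ a₀ :: a₁ :: (mid ++ [a_l])) ∧
    (∃ C' : List Plane, (C'.IsRotated C ∨ C'.IsRotated C.reverse) ∧
      (a₁ :: (mid ++ [a_l])) <+: C') ∧
    (∀ p ∈ a₁ :: (mid ++ [a_l]), TriangulationEdge T p (c j)) ∧
    IsDiagonal C U a₁ a_l ∧
    (∀ p ∈ mid, p ∈ openTriangle a₁ a_l (c j)) ∧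
    (∀ p ∈ a₁ :: (mid ++ [a_l]), ¬ IsDiagonal C U a₀ p)

/-- Consistent triples. -/
structure IsConsistentTriple {k : ℕ} (P : Finset Plane) (c : ZMod k → Plane)
    (T : Finset (Finset Plane)) (C : List Plane) (D : Set (Sym2 Plane)) : Prop where
  simple : IsSimplePolygon C
  vertices : ∀ p, p ∈ C ↔ p ∈ innerPoints P c
  triangulation : IsTriangulationOf P (annularRegion P C) T
  /-- no edge of `T` is a chord of `CH(P)` -/
  no_chord : ∀ i j, TriangulationEdge T (c i) (c j) → j = i + 1 ∨ i = j + 1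
  /-- no two inward triangles of `T` have the same inward vertex -/
  distinct : ∀ t ∈ T, ∀ t' ∈ T, ∀ a ∈ innerPoints P c, a ∈ t → a ∈ t' →
    (∃ i j, i ≠ j ∧ c i ∈ t ∧ c j ∈ t) → (∃ i j, i ≠ j ∧ c i ∈ t' ∧ c j ∈ t') → t = t'
  /-- `D` is a maximal set of pairwise non-intersecting diagonals of `C` such that `T ∪ C ∪ D` has
  no complex triangle -/
  maximal : Maximal (IsAdmissible P T C) D
  fan : ∀ U, IsRegion C D U → 4 ≤ (regionVertices C U).ncard → HasFanStructure c T C U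

end FourConn

namespace FourConn

/-! ### Orientation with a sign -/

/-- The orientation scaled by `ε`; only `ε = ±1` matters, up to positive factors. -/
def ori (ε : ℝ) (p q r : Plane) : ℝ := ε * orient p q r

theorem ori_one (p q r : Plane) : ori 1 p q r = orient p q r := by simp [ori]

theorem ori_neg (ε : ℝ) (p q r : Plane) : ori (-ε) p q r = - ori ε p q r := by simp [ori]

theorem ori_rot (ε : ℝ) (p q r : Plane) : ori ε q r p = ori ε p q r := by
  simp only [ori, orient]; ring

theorem ori_swap (ε : ℝ) (p q r : Plane) : ori ε q p r = - ori ε p q r := by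
  simp only [ori, orient]; ring

theorem ori_swap' (ε : ℝ) (p q r : Plane) : ori ε p r q = - ori ε p q r := by
  simp only [ori, orient]; ring

theorem ori_rot' (ε : ℝ) (p q r : Plane) : ori ε r p q = ori ε p q r := by
  simp only [ori, orient]; ring

theorem ori_rev (ε : ℝ) (p q r : Plane) : ori ε r q p = - ori ε p q r := by
  simp only [ori, orient]; ring

@[simp] theorem ori_left (ε : ℝ) (p q : Plane) : ori ε p q p = 0 := by
  simp only [ori, orient]; ring

@[simp] theorem ori_right (ε : ℝ) (p q : Plane) : ori ε p q q = 0 := by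
  simp only [ori, orient]; ring

@[simp] theorem ori_self (ε : ℝ) (p q : Plane) : ori ε p p q = 0 := by
  simp only [ori, orient]; ring

theorem ori_sum (ε : ℝ) (p q r x : Plane) :
    ori ε p q x + ori ε q r x + ori ε r p x = ori ε p q r := by
  simp only [ori, orient]; ring

theorem ori_plucker (ε : ℝ) (p x y z w : Plane) :
    ori ε p x y * ori ε p z w - ori ε p x z * ori ε p y w + ori ε p x w * ori ε p y z = 0 := by
  simp only [ori, orient]; ring

theorem ori_comb (ε : ℝ) (p q u v w : Plane) {α β γ : ℝ} (h : α + β + γ = 1) :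
    ori ε p q (α • u + β • v + γ • w) = α * ori ε p q u + β * ori ε p q v + γ * ori ε p q w := by
  have : γ = 1 - α - β := by linarith
  subst this
  simp only [ori, orient, PiLp.add_apply, PiLp.smul_apply, smul_eq_mul]; ring

theorem ori_comb_two (ε : ℝ) (p q u v : Plane) {α β : ℝ} (h : α + β = 1) :
    ori ε p q (α • u + β • v) = α * ori ε p q u + β * ori ε p q v := by
  have : β = 1 - α := by linarith
  subst this
  simp only [ori, orient, PiLp.add_apply, PiLp.smul_apply, smul_eq_mul]; ring

theorem ori_continuous (ε : ℝ) (p q : Plane) : Continuous (ori ε p q) := by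
  unfold ori orient
  fun_prop

theorem ori_smul_eq (ε : ℝ) (p q r x : Plane) :
    ori ε p q r • x = ori ε q r x • p + ori ε r p x • q + ori ε p q x • r := by
  ext i
  fin_cases i <;>
    simp [ori, orient, PiLp.add_apply, PiLp.smul_apply, smul_eq_mul] <;> ring

theorem eq_comb_of_ori_ne {ε : ℝ} {p q r : Plane} (h : ori ε p q r ≠ 0) (x : Plane) :
    x = (ori ε q r x / ori ε p q r) • p + (ori ε r p x / ori ε p q r) • q +
      (ori ε p q x / ori ε p q r) • r := by
  rw [← smul_right_injective Plane h |>.eq_iff]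
  simp only [smul_add, smul_smul, mul_div_cancel₀ _ h]
  exact ori_smul_eq ε p q r x

theorem ori_div_sum {ε : ℝ} {p q r : Plane} (h : ori ε p q r ≠ 0) (x : Plane) :
    ori ε q r x / ori ε p q r + ori ε r p x / ori ε p q r + ori ε p q x / ori ε p q r = 1 := by
  rw [← add_div, ← add_div, div_eq_one_iff_eq h, ← ori_sum ε p q r x]; ring

/-! ### Triangles -/

theorem mem_openTriangle_iff {ε : ℝ} {p q r : Plane} (h : 0 < ori ε p q r) {x : Plane} :
    x ∈ openTriangle p q r ↔ 0 < ori ε p q x ∧ 0 < ori ε q r x ∧ 0 < ori ε r p x := by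
  constructor
  · rintro ⟨α, β, γ, hα, hβ, hγ, hs, rfl⟩
    rw [ori_comb _ _ _ _ _ _ hs, ori_comb _ _ _ _ _ _ hs, ori_comb _ _ _ _ _ _ hs]
    simp only [ori_left, ori_right, mul_zero, zero_add, add_zero]
    rw [ori_rot ε p q r, ← ori_rot ε r p q]
    exact ⟨mul_pos hγ h, mul_pos hα h, mul_pos hβ h⟩
  · rintro ⟨h1, h2, h3⟩
    exact ⟨_, _, _, div_pos h2 h, div_pos h3 h, div_pos h1 h, ori_div_sum h.ne' x,
      eq_comb_of_ori_ne h.ne' x⟩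

theorem convexHull_triple (p q r : Plane) : convexHull ℝ {p, q, r} =
    {x | ∃ α β γ : ℝ, 0 ≤ α ∧ 0 ≤ β ∧ 0 ≤ γ ∧ α + β + γ = 1 ∧ x = α • p + β • q + γ • r} := by
  rw [convexHull_insert (by simp), convexHull_pair]
  ext x
  simp only [convexJoin, Set.mem_iUnion, Set.mem_singleton_iff, exists_prop, exists_eq_left,
    Set.mem_ofPred_eq]
  constructor
  · rintro ⟨y, ⟨a, b, ha, hb, hab, rfl⟩, ⟨u, v, hu, hv, huv, rfl⟩⟩
    refine ⟨u, v * a, v * b, hu, mul_nonneg hv ha, mul_nonneg hv hb, ?_, ?_⟩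
    · rw [add_assoc, ← mul_add, hab, mul_one, huv]
    · rw [smul_add, smul_smul, smul_smul, add_assoc]
  · rintro ⟨α, β, γ, hα, hβ, hγ, hs, rfl⟩
    by_cases h0 : β + γ = 0
    · have hb : β = 0 := by linarith
      have hg : γ = 0 := by linarith
      subst hb hg
      exact ⟨q, left_mem_segment _ _ _, 1, 0, by simp, le_rfl, by simp, by
        have : α = 1 := by linarith
        simp [this]⟩
    · have hpos : 0 < β + γ := lt_of_le_of_ne (by positivity) (Ne.symm h0)
      refine ⟨(β / (β + γ)) • q + (γ / (β + γ)) • r,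
        ⟨_, _, by positivity, by positivity, by field_simp, rfl⟩, α, β + γ, hα, hpos.le,
        by linarith, ?_⟩
      rw [smul_add, smul_smul, smul_smul, mul_div_cancel₀ _ h0, mul_div_cancel₀ _ h0, add_assoc]

theorem mem_convexHull_iff {ε : ℝ} {p q r : Plane} (h : 0 < ori ε p q r) {x : Plane} :
    x ∈ convexHull ℝ {p, q, r} ↔ 0 ≤ ori ε p q x ∧ 0 ≤ ori ε q r x ∧ 0 ≤ ori ε r p x := by
  rw [convexHull_triple]
  constructor
  · rintro ⟨α, β, γ, hα, hβ, hγ, hs, rfl⟩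
    rw [ori_comb _ _ _ _ _ _ hs, ori_comb _ _ _ _ _ _ hs, ori_comb _ _ _ _ _ _ hs]
    simp only [ori_left, ori_right, mul_zero, zero_add, add_zero]
    rw [ori_rot ε p q r, ← ori_rot ε r p q]
    exact ⟨mul_nonneg hγ h.le, mul_nonneg hα h.le, mul_nonneg hβ h.le⟩
  · rintro ⟨h1, h2, h3⟩
    exact ⟨_, _, _, div_nonneg h2 h.le, div_nonneg h3 h.le, div_nonneg h1 h.le, ori_div_sum h.ne' x,
      eq_comb_of_ori_ne h.ne' x⟩

theorem openTriangle_rot (p q r : Plane) : openTriangle q r p = openTriangle p q r := by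
  ext x
  constructor
  · rintro ⟨α, β, γ, hα, hβ, hγ, hs, rfl⟩
    exact ⟨γ, α, β, hγ, hα, hβ, by linarith, by abel⟩
  · rintro ⟨α, β, γ, hα, hβ, hγ, hs, rfl⟩
    exact ⟨β, γ, α, hβ, hγ, hα, by linarith, by abel⟩

theorem openTriangle_swap (p q r : Plane) : openTriangle q p r = openTriangle p q r := by
  ext x
  constructor
  · rintro ⟨α, β, γ, hα, hβ, hγ, hs, rfl⟩
    exact ⟨β, α, γ, hβ, hα, hγ, by linarith, by abel⟩
  · rintro ⟨α, β, γ, hα, hβ, hγ, hs, rfl⟩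
    exact ⟨β, α, γ, hβ, hα, hγ, by linarith, by abel⟩

theorem openTriangle_swap' (p q r : Plane) : openTriangle p r q = openTriangle p q r := by
  rw [← openTriangle_rot p r q, openTriangle_swap, openTriangle_rot, openTriangle_rot] 

theorem openTriangle_subset_convexHull (p q r : Plane) :
    openTriangle p q r ⊆ convexHull ℝ {p, q, r} := by
  rw [convexHull_triple]
  rintro x ⟨α, β, γ, hα, hβ, hγ, hs, rfl⟩
  exact ⟨α, β, γ, hα.le, hβ.le, hγ.le, hs, rfl⟩

theorem openTriangle_self_right (p q : Plane) : openTriangle p q p = openSegment ℝ q p := by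
  ext x
  constructor
  · rintro ⟨α, β, γ, hα, hβ, hγ, hs, rfl⟩
    exact ⟨β, α + γ, hβ, by linarith, by linarith, by rw [add_smul]; abel⟩
  · rintro ⟨α, β, hα, hβ, hs, rfl⟩
    refine ⟨β / 2, α, β / 2, by linarith, hα, by linarith, by linarith, ?_⟩
    rw [add_right_comm, ← add_smul, add_halves, add_comm]

theorem sq_ori {p q r : Plane} (h : orient p q r ≠ 0) : 0 < ori (orient p q r) p q r := by
  exact mul_self_pos.2 h

theorem isOpen_openTriangle {p q r : Plane} (h : orient p q r ≠ 0) :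
    IsOpen (openTriangle p q r) := by
  have : openTriangle p q r = {x | 0 < ori (orient p q r) p q x ∧
      0 < ori (orient p q r) q r x ∧ 0 < ori (orient p q r) r p x} := by
    ext x; exact mem_openTriangle_iff (sq_ori h)
  rw [this]
  exact (isOpen_lt continuous_const (ori_continuous _ _ _)).inter
    ((isOpen_lt continuous_const (ori_continuous _ _ _)).inter
      (isOpen_lt continuous_const (ori_continuous _ _ _)))

theorem convex_openTriangle {p q r : Plane} : Convex ℝ (openTriangle p q r) := by
  rintro _ ⟨α, β, γ, hα, hβ, hγ, hs, rfl⟩ _ ⟨α', β', γ', hα', hβ', hγ', hs', rfl⟩ s t h1 h2 hst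
  refine ⟨s * α + t * α', s * β + t * β', s * γ + t * γ', ?_, ?_, ?_, ?_, ?_⟩
  · rcases h1.eq_or_lt with rfl | h1
    · have : t = 1 := by linarith
      subst this; simpa
    · positivity
  · rcases h1.eq_or_lt with rfl | h1
    · have : t = 1 := by linarith
      subst this; simpa
    · positivity
  · rcases h1.eq_or_lt with rfl | h1
    · have : t = 1 := by linarith
      subst this; simpa
    · positivity
  · calc _ = s * (α + β + γ) + t * (α' + β' + γ') := by ring
      _ = 1 := by rw [hs, hs', mul_one, mul_one, hst]
  · simp only [smul_add, add_smul, smul_smul]; abel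

theorem isClosed_convexHull_triple (p q r : Plane) : IsClosed (convexHull ℝ {p, q, r}) :=
  ((Set.toFinite {p, q, r}).isCompact_convexHull ℝ).isClosed

/-- A half-open segment from an interior point of a triangle stays in the interior. -/
theorem comb_mem_openTriangle {p q r x y : Plane} (hx : x ∈ openTriangle p q r)
    (hy : y ∈ convexHull ℝ {p, q, r}) {s t : ℝ} (hs : 0 < s) (ht : 0 ≤ t) (hst : s + t = 1) :
    s • x + t • y ∈ openTriangle p q r := by
  rw [convexHull_triple] at hy
  obtain ⟨α, β, γ, hα, hβ, hγ, hs1, rfl⟩ := hx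
  obtain ⟨α', β', γ', hα', hβ', hγ', hs1', rfl⟩ := hy
  refine ⟨s * α + t * α', s * β + t * β', s * γ + t * γ', by positivity, by positivity,
    by positivity, ?_, ?_⟩
  · calc _ = s * (α + β + γ) + t * (α' + β' + γ') := by ring
      _ = 1 := by rw [hs1, hs1', mul_one, mul_one, hst]
  · simp only [smul_add, add_smul, smul_smul]; abel

theorem centroid_mem_openTriangle (p q r : Plane) :
    (1 / 3 : ℝ) • p + (1 / 3 : ℝ) • q + (1 / 3 : ℝ) • r ∈ openTriangle p q r :=
  ⟨_, _, _, by norm_num, by norm_num, by norm_num, by norm_num, rfl⟩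

theorem convexHull_subset_closure (p q r : Plane) :
    convexHull ℝ {p, q, r} ⊆ closure (openTriangle p q r) := by
  intro x hx
  set g := (1 / 3 : ℝ) • p + (1 / 3 : ℝ) • q + (1 / 3 : ℝ) • r
  have hg : g ∈ openTriangle p q r := centroid_mem_openTriangle p q r
  have hlim : Filter.Tendsto (fun t : ℝ => t • g + (1 - t) • x) (nhdsWithin 0 (Set.Ioo 0 1))
      (nhds x) := by
    have : Continuous (fun t : ℝ => t • g + (1 - t) • x) := by fun_prop
    have h2 := this.tendsto 0
    simp only [zero_smul, sub_zero, one_smul, zero_add] at h2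
    exact h2.mono_left nhdsWithin_le_nhds
  have hne : (nhdsWithin (0 : ℝ) (Set.Ioo 0 1)).NeBot := by
    rw [← mem_closure_iff_nhdsWithin_neBot, closure_Ioo (by norm_num)]
    simp
  refine mem_closure_of_tendsto hlim ?_
  filter_upwards [self_mem_nhdsWithin] with t ht
  exact comb_mem_openTriangle hg hx ht.1 (by linarith [ht.2]) (by ring)

theorem closure_openTriangle (p q r : Plane) :
    closure (openTriangle p q r) = convexHull ℝ {p, q, r} :=
  (closure_minimal (openTriangle_subset_convexHull p q r)
    (isClosed_convexHull_triple p q r)).antisymm (convexHull_subset_closure p q r)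

theorem interior_convexHull_triple {p q r : Plane} (h : orient p q r ≠ 0) :
    interior (convexHull ℝ {p, q, r}) = openTriangle p q r := by
  apply Set.Subset.antisymm
  · rw [← closure_openTriangle, convex_openTriangle.interior_closure_eq_interior_of_nonempty_interior]
    · exact interior_subset
    · rw [(isOpen_openTriangle h).interior_eq]
      exact ⟨_, centroid_mem_openTriangle p q r⟩
  · exact interior_maximal (openTriangle_subset_convexHull p q r) (isOpen_openTriangle h)

theorem mem_segment_of_ori_eq_zero {ε : ℝ} {p q r x : Plane} (h : 0 < ori ε p q r)
    (h1 : ori ε p q x = 0) (h2 : 0 ≤ ori ε q r x) (h3 : 0 ≤ ori ε r p x) : x ∈ segment ℝ p q := by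
  have hs := ori_div_sum h.ne' x
  have he := eq_comb_of_ori_ne h.ne' x
  rw [h1, zero_div, add_zero] at hs
  rw [h1, zero_div, zero_smul, add_zero] at he
  exact ⟨_, _, div_nonneg h2 h.le, div_nonneg h3 h.le, hs, he.symm⟩

/-- The boundary of a triangle consists of its three edges. -/
theorem mem_edges_of_mem_convexHull {p q r x : Plane} (h : orient p q r ≠ 0)
    (hx : x ∈ convexHull ℝ {p, q, r}) (hx' : x ∉ openTriangle p q r) :
    x ∈ segment ℝ p q ∨ x ∈ segment ℝ q r ∨ x ∈ segment ℝ r p := by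
  have h0 := sq_ori h
  rw [mem_convexHull_iff h0] at hx
  rw [mem_openTriangle_iff h0] at hx'
  obtain ⟨h1, h2, h3⟩ := hx
  rcases h1.eq_or_lt with h1' | h1'
  · exact Or.inl (mem_segment_of_ori_eq_zero h0 h1'.symm h2 h3)
  rcases h2.eq_or_lt with h2' | h2'
  · exact Or.inr (Or.inl (mem_segment_of_ori_eq_zero (by rwa [ori_rot]) h2'.symm h3 h1))
  rcases h3.eq_or_lt with h3' | h3'
  · exact Or.inr (Or.inr (mem_segment_of_ori_eq_zero (by rwa [← ori_rot, ]) h3'.symm h1 h2))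
  exact absurd ⟨h1', h2', h3'⟩ hx'

/-- A preconnected set that meets an open triangle and is not contained in it meets an edge. -/
theorem exists_mem_edge {p q r : Plane} (h : orient p q r ≠ 0) {s : Set Plane}
    (hs : IsPreconnected s) {x y : Plane} (hx : x ∈ s) (hxo : x ∈ openTriangle p q r) (hy : y ∈ s)
    (hyo : y ∉ openTriangle p q r) :
    ∃ w ∈ s, w ∉ openTriangle p q r ∧
      (w ∈ segment ℝ p q ∨ w ∈ segment ℝ q r ∨ w ∈ segment ℝ r p) := by
  by_contra hn
  refine hyo (hs.subset_of_closure_inter_subset (isOpen_openTriangle h) ⟨x, hx, hxo⟩ ?_ hy)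
  rintro w ⟨hwc, hw⟩
  by_contra hwo
  rw [closure_openTriangle] at hwc
  exact hn ⟨w, hw, hwo, mem_edges_of_mem_convexHull h hwc hwo⟩

theorem mem_segment_cases {p q x : Plane} (h : x ∈ segment ℝ p q) :
    x = p ∨ x = q ∨ x ∈ openSegment ℝ p q := by
  rw [← insert_endpoints_openSegment] at h
  simpa using h

theorem isPreconnected_segment (p q : Plane) : IsPreconnected (segment ℝ p q) :=
  (convex_segment p q).isPreconnected

theorem ori_eq_zero_of_mem_segment {ε : ℝ} {p q x : Plane} (h : x ∈ segment ℝ p q) :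
    ori ε p q x = 0 := by
  obtain ⟨α, β, -, -, hs, rfl⟩ := h
  rw [ori_comb_two _ _ _ _ _ hs]; simp

theorem ori_eq_zero_of_mem_openSegment {ε : ℝ} {p q x : Plane} (h : x ∈ openSegment ℝ p q) :
    ori ε p q x = 0 := ori_eq_zero_of_mem_segment (openSegment_subset_segment ℝ p q h)

/-! ### Points in general position -/

theorem collinear_of_orient_eq_zero {p q r : Plane} (h : orient p q r = 0) :
    Collinear ℝ ({p, q, r} : Set Plane) := by
  by_cases hpq : p = q
  · subst hpq
    simpa using collinear_pair ℝ p r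
  rw [collinear_iff_of_mem (p₀ := p) (by simp)]
  refine ⟨q - p, ?_⟩
  rintro x (rfl | rfl | rfl)
  · exact ⟨0, by simp⟩
  · exact ⟨1, by simp⟩
  by_cases h0 : q 0 - p 0 = 0
  · have h1 : q 1 - p 1 ≠ 0 := by
      intro h1
      apply hpq
      ext i
      fin_cases i
      · simpa using (sub_eq_zero.mp h0).symm
      · simpa using (sub_eq_zero.mp h1).symm
    refine ⟨(x 1 - p 1) / (q 1 - p 1), ?_⟩
    simp only [orient, h0, zero_mul, zero_sub, neg_eq_zero, mul_eq_zero, h1, false_or] at h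
    ext i
    fin_cases i
    · simp [h0]; linarith
    · simp; field_simp; ring
  · refine ⟨(x 0 - p 0) / (q 0 - p 0), ?_⟩
    unfold orient at h
    ext i
    fin_cases i
    · simp; field_simp; ring
    · simp; field_simp; linarith

theorem GeneralPosition.orient_ne {P : Finset Plane} (hP : GeneralPosition P) {p q r : Plane}
    (hp : p ∈ P) (hq : q ∈ P) (hr : r ∈ P) (h1 : p ≠ q) (h2 : p ≠ r) (h3 : q ≠ r) :
    orient p q r ≠ 0 :=
  fun h => hP p hp q hq r hr h1 h2 h3 (collinear_of_orient_eq_zero h)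

theorem GeneralPosition.ori_ne {P : Finset Plane} (hP : GeneralPosition P) {ε : ℝ} (hε : ε ≠ 0)
    {p q r : Plane}
    (hp : p ∈ P) (hq : q ∈ P) (hr : r ∈ P) (h1 : p ≠ q) (h2 : p ≠ r) (h3 : q ≠ r) :
    ori ε p q r ≠ 0 :=
  mul_ne_zero hε (hP.orient_ne hp hq hr h1 h2 h3)

theorem GeneralPosition.notMem_openSegment {P : Finset Plane} (hP : GeneralPosition P)
    {p q x : Plane} (hp : p ∈ P) (hq : q ∈ P) (hx : x ∈ P) (hpq : p ≠ q) :
    x ∉ openSegment ℝ p q := by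
  intro h
  have h1 : p ≠ x := by
    rintro rfl
    exact hpq (left_mem_openSegment_iff.1 h)
  have h2 : q ≠ x := by
    rintro rfl
    exact hpq (right_mem_openSegment_iff.1 h)
  have := ori_eq_zero_of_mem_openSegment (ε := 1) h
  rw [ori_one] at this
  exact hP.orient_ne hp hq hx hpq h1 h2 this

theorem GeneralPosition.eq_or_eq_of_mem_segment {P : Finset Plane} (hP : GeneralPosition P)
    {p q x : Plane} (hp : p ∈ P) (hq : q ∈ P) (hx : x ∈ P) (h : x ∈ segment ℝ p q) :
    x = p ∨ x = q := by
  by_cases hpq : p = q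
  · subst hpq
    simp at h
    exact Or.inl h
  rcases mem_segment_cases h with h | h | h
  · exact Or.inl h
  · exact Or.inr h
  · exact absurd h (hP.notMem_openSegment hp hq hx hpq)

theorem GeneralPosition.mem_openTriangle {P : Finset Plane} (hP : GeneralPosition P)
    {p q r x : Plane} (hp : p ∈ P) (hq : q ∈ P) (hr : r ∈ P) (h1 : p ≠ q) (h2 : p ≠ r) (h3 : q ≠ r)
    (hx : x ∈ P) (h : x ∈ convexHull ℝ {p, q, r}) (hxp : x ≠ p) (hxq : x ≠ q) (hxr : x ≠ r) :
    x ∈ openTriangle p q r := by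
  by_contra hn
  rcases mem_edges_of_mem_convexHull (hP.orient_ne hp hq hr h1 h2 h3) h hn with h | h | h
  · exact (hP.eq_or_eq_of_mem_segment hp hq hx h).elim hxp hxq
  · exact (hP.eq_or_eq_of_mem_segment hq hr hx h).elim hxq hxr
  · exact (hP.eq_or_eq_of_mem_segment hr hp hx h).elim hxr hxp

/-- A segment between two points in general position that meets an open triangle ends at a vertex
of the triangle or crosses an edge, unless its endpoint is in the open triangle. -/
theorem GeneralPosition.exit {P : Finset Plane} (hP : GeneralPosition P)
    {p q r g h x : Plane} (hp : p ∈ P) (hq : q ∈ P) (hr : r ∈ P) (h1 : p ≠ q) (h2 : p ≠ r)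
    (h3 : q ≠ r) (hg : g ∈ P) (hh : h ∈ P) (hgh : g ≠ h) (hx : x ∈ openTriangle p q r)
    (hx' : x ∈ segment ℝ g h) (hxh : x ≠ h) (hho : h ∉ openTriangle p q r) :
    (h = p ∨ h = q ∨ h = r) ∨ ∃ w ∈ openSegment ℝ g h, w ∈ segment ℝ x h ∧ w ≠ x ∧
      (w ∈ openSegment ℝ p q ∨ w ∈ openSegment ℝ q r ∨ w ∈ openSegment ℝ r p) := by
  obtain ⟨w, hw, hwo, hwe⟩ := exists_mem_edge (hP.orient_ne hp hq hr h1 h2 h3)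
    (isPreconnected_segment x h) (left_mem_segment ℝ x h) hx (right_mem_segment ℝ x h) hho
  have hwx : w ≠ x := by rintro rfl; exact hwo hx
  by_cases hwh : w = h
  · subst hwh
    left
    rcases hwe with hwe | hwe | hwe
    · exact (hP.eq_or_eq_of_mem_segment hp hq hh hwe).elim Or.inl (fun h => Or.inr (Or.inl h))
    · exact (hP.eq_or_eq_of_mem_segment hq hr hh hwe).elim (fun h => Or.inr (Or.inl h))
        (fun h => Or.inr (Or.inr h))
    · exact (hP.eq_or_eq_of_mem_segment hr hp hh hwe).elim (fun h => Or.inr (Or.inr h)) Or.inl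
  right
  have hwgh : w ∈ openSegment ℝ g h := by
    rcases mem_segment_cases hw with hw | hw | hw
    · exact absurd hw hwx
    · exact absurd hw hwh
    obtain ⟨a, b, ha, hb, hab, rfl⟩ := hx'
    obtain ⟨s, t, hs, ht, hst, rfl⟩ := hw
    have ha0 : 0 < a := by
      rcases ha.eq_or_lt with rfl | ha
      · exact absurd (by rw [zero_add] at hab; simp [hab]) hxh
      · exact ha
    refine ⟨s * a, s * b + t, by positivity, by positivity, ?_, ?_⟩
    · calc s * a + (s * b + t) = s * (a + b) + t := by ring
        _ = 1 := by rw [hab, mul_one, hst]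
    · simp only [smul_add, add_smul, smul_smul]; abel
  refine ⟨w, hwgh, hw, hwx, ?_⟩
  have key : ∀ v ∈ P, w ≠ v := by
    rintro v hv rfl
    exact hP.notMem_openSegment hg hh hv hgh hwgh
  rcases hwe with hwe | hwe | hwe
  · exact Or.inl (((mem_segment_cases hwe).resolve_left (key _ hp)).resolve_left (key _ hq))
  · exact Or.inr (Or.inl (((mem_segment_cases hwe).resolve_left (key _ hq)).resolve_left (key _ hr)))
  · exact Or.inr (Or.inr (((mem_segment_cases hwe).resolve_left (key _ hr)).resolve_left (key _ hp)))

theorem GeneralPosition.orient_ne_or {P : Finset Plane} (hP : GeneralPosition P)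
    {p q g h : Plane} (hp : p ∈ P) (hq : q ∈ P) (hg : g ∈ P) (hh : h ∈ P) (hpq : p ≠ q)
    (hgh : g ≠ h) (hne : s(p, q) ≠ s(g, h)) : orient p q g ≠ 0 ∨ orient p q h ≠ 0 := by
  by_cases h1 : p = g
  · subst h1
    have : q ≠ h := by rintro rfl; exact hne rfl
    exact Or.inr (hP.orient_ne hp hq hh hpq hgh this)
  by_cases h2 : q = g
  · subst h2
    have : p ≠ h := by rintro rfl; exact hne Sym2.eq_swap
    exact Or.inr (hP.orient_ne hp hq hh hpq this hgh)
  exact Or.inl (hP.orient_ne hp hq hg hpq h1 h2)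

/-! ### Crossing segments -/

/-- If a segment crosses an open edge of a triangle, it meets the open triangle. -/
theorem crossing_meets_openTriangle {p q r g h x : Plane} (ht : orient p q r ≠ 0)
    (hne : orient p q g ≠ 0 ∨ orient p q h ≠ 0) (hx : x ∈ openSegment ℝ p q)
    (hx' : x ∈ openSegment ℝ g h) : ∃ w ∈ openSegment ℝ g h, w ∈ openTriangle p q r := by
  have h0 := sq_ori ht
  set ε := orient p q r
  have hx1 : ori ε p q x = 0 := ori_eq_zero_of_mem_openSegment hx
  have hx23 : 0 < ori ε q r x ∧ 0 < ori ε r p x := by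
    obtain ⟨α, β, hα, hβ, hs, rfl⟩ := hx
    rw [ori_comb_two _ _ _ _ _ hs, ori_comb_two _ _ _ _ _ hs]
    simp only [ori_left, ori_right, mul_zero, add_zero, zero_add]
    rw [ori_rot ε p q r, ← ori_rot ε r p q]
    exact ⟨by positivity, by positivity⟩
  -- it suffices to find an endpoint on the side of `r`
  have key : ∀ u, 0 < ori ε p q u → openSegment ℝ x u ⊆ openSegment ℝ g h →
      ∃ w ∈ openSegment ℝ g h, w ∈ openTriangle p q r := by
    intro u hu hsub
    have hcont : Continuous (fun t : ℝ => (1 - t) • x + t • u) := by fun_prop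
    have e1 : ∀ᶠ t in nhdsWithin (0 : ℝ) (Set.Ioo 0 1), 0 < ori ε q r ((1 - t) • x + t • u) := by
      refine (((ori_continuous ε q r).comp hcont).tendsto 0).mono_left nhdsWithin_le_nhds
        |>.eventually (lt_mem_nhds ?_)
      simpa using hx23.1
    have e2 : ∀ᶠ t in nhdsWithin (0 : ℝ) (Set.Ioo 0 1), 0 < ori ε r p ((1 - t) • x + t • u) := by
      refine (((ori_continuous ε r p).comp hcont).tendsto 0).mono_left nhdsWithin_le_nhds
        |>.eventually (lt_mem_nhds ?_)
      simpa using hx23.2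
    have hnb : (nhdsWithin (0 : ℝ) (Set.Ioo 0 1)).NeBot := by
      rw [← mem_closure_iff_nhdsWithin_neBot, closure_Ioo (by norm_num)]
      simp
    obtain ⟨t, ht1, ht2, ht3⟩ := (e1.and (e2.and self_mem_nhdsWithin)).exists
    refine ⟨(1 - t) • x + t • u, hsub ⟨1 - t, t, by linarith [ht3.2], ht3.1, by ring, rfl⟩, ?_⟩
    rw [mem_openTriangle_iff h0]
    refine ⟨?_, ht1, ht2⟩
    rw [ori_comb_two _ _ _ _ _ (by ring), hx1, mul_zero, zero_add]
    exact mul_pos ht3.1 hu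
  obtain ⟨α, β, hα, hβ, hs, rfl⟩ := hx'
  rw [ori_comb_two _ _ _ _ _ hs] at hx1
  have hne' : ori ε p q g ≠ 0 ∨ ori ε p q h ≠ 0 :=
    hne.imp (mul_ne_zero ht) (mul_ne_zero ht)
  by_cases hg : 0 < ori ε p q g
  · refine key g hg ?_
    rintro _ ⟨s, t, hs', ht', hst, rfl⟩
    refine ⟨s * α + t, s * β, by positivity, by positivity, ?_, ?_⟩
    · calc s * α + t + s * β = s * (α + β) + t := by ring
        _ = 1 := by rw [hs, mul_one, hst]
    · simp only [smul_add, add_smul, smul_smul]; abel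
  · have hh : 0 < ori ε p q h := by
      by_contra hh
      push Not at hg hh
      have h1 : α * ori ε p q g ≤ 0 := mul_nonpos_of_nonneg_of_nonpos hα.le hg
      have h2 : β * ori ε p q h ≤ 0 := mul_nonpos_of_nonneg_of_nonpos hβ.le hh
      have h3 : α * ori ε p q g = 0 := by linarith
      have h4 : β * ori ε p q h = 0 := by linarith
      rcases hne' with h | h
      · exact h ((mul_eq_zero.1 h3).resolve_left hα.ne')
      · exact h ((mul_eq_zero.1 h4).resolve_left hβ.ne')
    refine key h hh ?_
    rintro _ ⟨s, t, hs', ht', hst, rfl⟩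
    refine ⟨s * α, s * β + t, by positivity, by positivity, ?_, ?_⟩
    · calc s * α + (s * β + t) = s * (α + β) + t := by ring
        _ = 1 := by rw [hs, mul_one, hst]
    · simp only [smul_add, add_smul, smul_smul]; abel

/-- Two segments whose endpoints lie on different sides of each other cross. -/
theorem openSegment_inter_nonempty {ε : ℝ} {p q g h : Plane} (h1 : ori ε p q g < 0)
    (h2 : 0 < ori ε p q h) (h3 : 0 < ori ε g h p) (h4 : ori ε g h q < 0) :
    ∃ x ∈ openSegment ℝ p q, x ∈ openSegment ℝ g h := by
  set A := ori ε p q g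
  set B := ori ε p q h
  set C := ori ε g h p
  set D := ori ε g h q
  have hAB : B - A = C - D := by
    simp only [A, B, C, D, ori, orient]; ring
  have hd : 0 < B - A := by linarith
  refine ⟨(-D / (B - A)) • p + (C / (B - A)) • q,
    ⟨_, _, div_pos (by linarith) hd, div_pos h3 hd, by rw [← add_div, div_eq_one_iff_eq hd.ne']; linarith, rfl⟩,
    ⟨B / (B - A), -A / (B - A), div_pos h2 hd, div_pos (by linarith) hd, by rw [← add_div, div_eq_one_iff_eq hd.ne']; ring, ?_⟩⟩
  have key : B • g + (-A) • h = (-D) • p + C • q := by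
    ext i
    fin_cases i <;>
      simp [A, B, C, D, ori, orient, PiLp.add_apply, PiLp.smul_apply, smul_eq_mul] <;> ring
  simp only [div_eq_inv_mul, ← smul_smul, ← smul_add, key]

/-- A segment that leaves a corner of a triangle strictly between the two sides meets the open
triangle. -/
theorem corner_meets_openTriangle {ε : ℝ} {v p q x : Plane} (h1 : 0 < ori ε v p x)
    (h2 : 0 < ori ε v x q) (h3 : 0 < ori ε v p q) :
    ∃ w ∈ openSegment ℝ v x, w ∈ openTriangle v p q := by
  have hcont : Continuous (fun t : ℝ => (1 - t) • v + t • x) := by fun_prop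
  have e1 : ∀ᶠ t in nhdsWithin (0 : ℝ) (Set.Ioo 0 1), 0 < ori ε p q ((1 - t) • v + t • x) := by
    refine (((ori_continuous ε p q).comp hcont).tendsto 0).mono_left nhdsWithin_le_nhds
      |>.eventually (lt_mem_nhds ?_)
    simp only [Function.comp, sub_zero, one_smul, zero_smul, add_zero]
    rwa [ori_rot ε v p q]
  have hnb : (nhdsWithin (0 : ℝ) (Set.Ioo 0 1)).NeBot := by
    rw [← mem_closure_iff_nhdsWithin_neBot, closure_Ioo (by norm_num)]
    simp
  obtain ⟨t, ht1, ht3⟩ := (e1.and self_mem_nhdsWithin).exists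
  refine ⟨(1 - t) • v + t • x, ⟨1 - t, t, by linarith [ht3.2], ht3.1, by ring, rfl⟩, ?_⟩
  rw [mem_openTriangle_iff h3]
  refine ⟨?_, ht1, ?_⟩
  · rw [ori_comb_two _ _ _ _ _ (by ring), ori_left, mul_zero, zero_add]
    exact mul_pos ht3.1 h1
  · rw [ori_comb_two _ _ _ _ _ (by ring), ori_right, mul_zero, zero_add, ← ori_rot, ← ori_rot]
    exact mul_pos ht3.1 (by rwa [ori_rot])

theorem orient_rot (p q r : Plane) : orient q r p = orient p q r := by
  simp only [orient]; ring

theorem orient_swap (p q r : Plane) : orient q p r = - orient p q r := by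
  simp only [orient]; ring

end FourConn

namespace FourConn

/-! ### Frames: the combinatorial data of an annular triangulation -/

/-- The hull vertices `c i` and the inner points `a m`, in periodic enumerations, together with the
indices `f i` of the inward vertices of the hull edges. The hull vertex `c i` sees the inner points
`a (f i), …, a (f (i + 1))`. The sign `ε` allows to reverse all orders. -/
structure Frame (P : Finset Plane) (ε : ℝ) (k n : ℤ) (c a : ℤ → Plane) (f : ℤ → ℤ) : Prop where
  gp : GeneralPosition P
  eps : ε ≠ 0
  three_le : 3 ≤ k
  c_iff : ∀ i j, c i = c j ↔ k ∣ i - j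
  a_iff : ∀ l m, a l = a m ↔ n ∣ l - m
  f_lt : ∀ i, f i < f (i + 1)
  f_per : ∀ i, f (i + k) = f i + n
  c_mem : ∀ i, c i ∈ P
  a_mem : ∀ m, a m ∈ P
  c_ne_a : ∀ i m, c i ≠ a m
  cover : ∀ x ∈ P, (∃ i, x = c i) ∨ ∃ m, x = a m
  hull : ∀ i, ∀ x ∈ P, x ≠ c i → x ≠ c (i + 1) → 0 < ori ε (c i) (c (i + 1)) x
  fan : ∀ i m, f i ≤ m → m < f (i + 1) → 0 < ori ε (a m) (c i) (a (m + 1))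

/-- The hull vertex `c i` sees the inner point `x`. -/
def Nb (a : ℤ → Plane) (f : ℤ → ℤ) (x : Plane) (i : ℤ) : Prop :=
  ∃ m, f i ≤ m ∧ m ≤ f (i + 1) ∧ x = a m

open Classical in
/-- The triangles of an annular triangulation. -/
def IsTile (c a : ℤ → Plane) (f : ℤ → ℤ) (t : Finset Plane) : Prop :=
  (∃ i, t = {c (i - 1), c i, a (f i)}) ∨
    ∃ i m, f i ≤ m ∧ m < f (i + 1) ∧ t = {a m, c i, a (m + 1)}

namespace Frame

variable {P : Finset Plane} {ε : ℝ} {k n : ℤ} {c a : ℤ → Plane} {f : ℤ → ℤ}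

theorem f_mono (F : Frame P ε k n c a f) : StrictMono f := strictMono_int_of_lt_succ F.f_lt

theorem f_mul (F : Frame P ε k n c a f) (i q : ℤ) : f (i + k * q) = f i + n * q := by
  induction q using Int.induction_on with
  | zero => simp
  | succ q ih =>
    have := F.f_per (i + k * q)
    rw [ih] at this
    rw [mul_add, mul_one, ← add_assoc, this]; ring
  | pred q ih =>
    have := F.f_per (i + k * (-q - 1))
    rw [show i + k * (-(q : ℤ) - 1) + k = i + k * (-q) by ring, ih] at this
    linarith

theorem f_add_le (F : Frame P ε k n c a f) (i : ℤ) (q : ℕ) : f i + q ≤ f (i + q) := by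
  induction q with
  | zero => simp
  | succ q ih =>
    have := F.f_lt (i + q)
    push_cast
    rw [← add_assoc, ← add_assoc]
    omega

theorem width (F : Frame P ε k n c a f) (i : ℤ) : f (i + 1) + 2 ≤ f i + n := by
  have h3 := F.three_le
  have := F.f_add_le (i + 1) (k - 1).toNat
  rw [Int.toNat_of_nonneg (by omega), show i + 1 + (k - 1) = i + k by ring, F.f_per] at this
  omega

theorem three_le_n (F : Frame P ε k n c a f) : 3 ≤ n := by
  have := F.width 0
  have := F.f_lt 0
  omega

theorem exists_block (F : Frame P ε k n c a f) (m : ℤ) : ∃ i, f i ≤ m ∧ m < f (i + 1) := by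
  obtain ⟨i, hi, hmax⟩ := Int.exists_greatest_of_bdd (P := fun i => f i ≤ m)
    ⟨m - f 0 + 1 + |m - f 0|, by
      intro z hz
      by_contra h
      push Not at h
      have h0 : 0 ≤ z := by have := abs_nonneg (m - f 0); have := neg_abs_le (m - f 0); omega
      have := F.f_add_le 0 z.toNat
      rw [Int.toNat_of_nonneg h0, zero_add] at this
      have := abs_nonneg (m - f 0)
      omega⟩
    ⟨-(f 0 - m).toNat, by
      have := F.f_add_le (-(f 0 - m).toNat) (f 0 - m).toNat
      rw [neg_add_cancel] at this
      omega⟩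
  refine ⟨i, hi, ?_⟩
  by_contra h
  push Not at h
  have := hmax _ h
  omega

theorem c_ne_succ (F : Frame P ε k n c a f) (i : ℤ) : c i ≠ c (i + 1) := by
  intro h
  rw [F.c_iff] at h
  have := Int.le_of_dvd (by norm_num) ((dvd_neg.2 h : k ∣ -(i - (i + 1))).trans (by simp : _ ∣ (1 : ℤ)))
  have := F.three_le
  omega

theorem c_ne_pred (F : Frame P ε k n c a f) (i : ℤ) : c (i - 1) ≠ c i := by
  simpa using F.c_ne_succ (i - 1)

theorem a_ne (F : Frame P ε k n c a f) {l m : ℤ} (h : l < m) (h' : m < l + n) : a l ≠ a m := by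
  intro he
  rw [eq_comm, F.a_iff] at he
  have := Int.le_of_dvd (by omega) he
  omega

theorem a_ne_succ (F : Frame P ε k n c a f) (m : ℤ) : a m ≠ a (m + 1) :=
  F.a_ne (by omega) (by have := F.three_le_n; omega)

theorem nb_mul (F : Frame P ε k n c a f) {x : Plane} {i : ℤ} (q : ℤ) (h : Nb a f x i) :
    Nb a f x (i + k * q) := by
  obtain ⟨m, h1, h2, rfl⟩ := h
  refine ⟨m + n * q, ?_, ?_, ?_⟩
  · rw [F.f_mul]; omega
  · rw [add_right_comm, F.f_mul]; omega
  · rw [F.a_iff]; exact ⟨-q, by ring⟩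

theorem nb_congr (F : Frame P ε k n c a f) {x : Plane} {i j : ℤ} (hc : c i = c j)
    (h : Nb a f x i) : Nb a f x j := by
  obtain ⟨q, hq⟩ := (F.c_iff _ _).1 hc.symm
  have := F.nb_mul q h
  rwa [← hq, add_sub_cancel] at this

/-- If two enumerations of an index window give the same point, the windows are equivalent. -/
theorem nb_index (F : Frame P ε k n c a f) {m j : ℤ} (h : Nb a f (a m) j) :
    ∃ j', c j' = c j ∧ f j' ≤ m ∧ m ≤ f (j' + 1) := by
  obtain ⟨m', h1, h2, h3⟩ := h
  obtain ⟨q, hq⟩ := (F.a_iff _ _).1 h3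
  refine ⟨j + k * q, (F.c_iff _ _).2 ⟨q, by ring⟩, ?_, ?_⟩
  · rw [F.f_mul]; omega
  · rw [add_right_comm, F.f_mul]; omega

theorem nb_cases (F : Frame P ε k n c a f) {i m j : ℤ} (h1 : f i ≤ m) (h2 : m ≤ f (i + 1))
    (h : Nb a f (a m) j) :
    c j = c i ∨ (m = f (i + 1) ∧ c j = c (i + 1)) ∨ (m = f i ∧ c j = c (i - 1)) := by
  obtain ⟨j', hj, h3, h4⟩ := F.nb_index h
  rcases lt_trichotomy i j' with hlt | rfl | hlt
  · have h5 : f (i + 1) ≤ f j' := F.f_mono.monotone (by omega)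
    have h6 : f j' = f (i + 1) := by omega
    have := F.f_mono.injective h6
    subst this
    exact Or.inr (Or.inl ⟨by omega, hj.symm⟩)
  · exact Or.inl hj.symm
  · have h5 : f (j' + 1) ≤ f i := F.f_mono.monotone (by omega)
    have h6 : f (j' + 1) = f i := by omega
    have := F.f_mono.injective h6
    subst this
    exact Or.inr (Or.inr ⟨by omega, by simpa using hj.symm⟩)

theorem not_dvd_two (F : Frame P ε k n c a f) : ¬ k ∣ 2 := by
  intro h
  have := Int.le_of_dvd (by norm_num) h
  have := F.three_le
  omega

/-- Two different inner points cannot be seen by the same two hull vertices. -/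
theorem nb_unique (F : Frame P ε k n c a f) {x y : Plane} {i j : ℤ} (hx : Nb a f x i)
    (hy : Nb a f y i) (hx' : Nb a f x j) (hy' : Nb a f y j) (hij : c i ≠ c j) : x = y := by
  obtain ⟨m, h1, h2, rfl⟩ := hx
  obtain ⟨l, h3, h4, rfl⟩ := hy
  rcases F.nb_cases h1 h2 hx' with h | ⟨h, h'⟩ | ⟨h, h'⟩
  · exact absurd h.symm hij
  · rcases F.nb_cases h3 h4 hy' with g | ⟨g, g'⟩ | ⟨g, g'⟩
    · exact absurd g.symm hij
    · rw [h, g]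
    · rw [h', F.c_iff] at g'
      exact absurd (by simpa using g' : k ∣ i + 1 - (i - 1)) (by
        rw [show i + 1 - (i - 1) = 2 by ring]; exact F.not_dvd_two)
  · rcases F.nb_cases h3 h4 hy' with g | ⟨g, g'⟩ | ⟨g, g'⟩
    · exact absurd g.symm hij
    · rw [g', F.c_iff] at h'
      exact absurd h' (by
        rw [show i + 1 - (i - 1) = 2 by ring]; exact F.not_dvd_two)
    · rw [h, g]

theorem exists_nb (F : Frame P ε k n c a f) (m : ℤ) : ∃ i, Nb a f (a m) i := by
  obtain ⟨i, h1, h2⟩ := F.exists_block m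
  exact ⟨i, m, h1, h2.le, rfl⟩

theorem hull_a (F : Frame P ε k n c a f) (i m : ℤ) : 0 < ori ε (c i) (c (i + 1)) (a m) :=
  F.hull i _ (F.a_mem m) (F.c_ne_a _ _).symm (F.c_ne_a _ _).symm

theorem hull_a' (F : Frame P ε k n c a f) (i m : ℤ) : 0 < ori ε (c (i - 1)) (c i) (a m) := by
  simpa using F.hull_a (i - 1) m

/-- The inner points seen by a hull vertex are in angular order. -/
theorem angular (F : Frame P ε k n c a f) {i l m : ℤ} (h1 : f i ≤ l) (h2 : l < m)
    (h3 : m ≤ f (i + 1)) : 0 < ori ε (a l) (c i) (a m) := by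
  obtain ⟨q, rfl⟩ : ∃ q : ℕ, m = l + 1 + q := ⟨(m - l - 1).toNat, by omega⟩
  clear h2
  induction q with
  | zero =>
    have := F.fan i l h1 (by push_cast at h3; omega)
    simpa using this
  | succ q ih =>
    have h4 := ih (by push_cast at h3; omega)
    have h5 := F.fan i (l + 1 + q) (by omega) (by push_cast at h3; omega)
    have hx := F.hull_a i l
    have hy := F.hull_a i (l + 1 + q)
    have hz := F.hull_a i (l + 1 + q + 1)
    push_cast
    rw [← add_assoc]
    have key := ori_plucker ε (c i) (c (i + 1)) (a l) (a (l + 1 + q)) (a (l + 1 + q + 1))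
    rw [ori_swap ε (c i) (a l), ori_swap ε (c i) (a (l + 1 + q))] at *
    nlinarith [mul_pos hx (neg_pos.2 (neg_pos.1 h5)), mul_pos hz (neg_pos.2 (neg_pos.1 h4))]

theorem c_notMem_openTriangle (F : Frame P ε k n c a f) (i : ℤ) {p q r : Plane} (hp : p ∈ P)
    (hq : q ∈ P) (hr : r ∈ P) (h1 : p ≠ q) (h2 : p ≠ r) (h3 : q ≠ r) :
    c i ∉ openTriangle p q r := by
  rintro ⟨α, β, γ, hα, hβ, hγ, hs, he⟩
  have key : ∀ x ∈ P, 0 ≤ ori ε (c i) (c (i + 1)) x ∧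
      (ori ε (c i) (c (i + 1)) x = 0 → x = c i ∨ x = c (i + 1)) := by
    intro x hx
    by_cases h : x = c i
    · subst h; simp
    by_cases h' : x = c (i + 1)
    · subst h'; simp
    have := F.hull i x hx h h'
    exact ⟨this.le, fun h => absurd h this.ne'⟩
  have h0 := ori_comb ε (c i) (c (i + 1)) p q r hs
  rw [← he, ori_left] at h0
  have p1 := mul_nonneg hα.le (key p hp).1
  have p2 := mul_nonneg hβ.le (key q hq).1
  have p3 := mul_nonneg hγ.le (key r hr).1
  have z1 := (key p hp).2 ((mul_eq_zero.1 (by linarith : α * ori ε (c i) (c (i + 1)) p = 0)).resolve_left hα.ne')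
  have z2 := (key q hq).2 ((mul_eq_zero.1 (by linarith : β * ori ε (c i) (c (i + 1)) q = 0)).resolve_left hβ.ne')
  have z3 := (key r hr).2 ((mul_eq_zero.1 (by linarith : γ * ori ε (c i) (c (i + 1)) r = 0)).resolve_left hγ.ne')
  rcases z1 with z1 | z1 <;> rcases z2 with z2 | z2 <;> rcases z3 with z3 | z3 <;>
    first
      | exact h1 (z1.trans z2.symm)
      | exact h2 (z1.trans z3.symm)
      | exact h3 (z2.trans z3.symm)

/-- Reversing all orders. -/
theorem reverse (F : Frame P ε k n c a f) :
    Frame P (-ε) k n (fun i => c (-i)) (fun m => a (-m)) (fun i => -f (1 - i)) where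
  gp := F.gp
  eps := neg_ne_zero.2 F.eps
  three_le := F.three_le
  c_iff i j := by rw [F.c_iff, ← dvd_neg]; ring_nf
  a_iff i j := by rw [F.a_iff, ← dvd_neg]; ring_nf
  f_lt i := by
    have := F.f_lt (-i)
    rw [show 1 - (i + 1) = -i by ring, show 1 - i = -i + 1 by ring]; omega
  f_per i := by
    have := F.f_per (1 - (i + k))
    rw [show 1 - (i + k) + k = 1 - i by ring] at this; omega
  c_mem i := F.c_mem _
  a_mem i := F.a_mem _
  c_ne_a i m := F.c_ne_a _ _
  cover x hx := (F.cover x hx).imp (fun ⟨i, h⟩ => ⟨-i, by simpa using h⟩)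
    (fun ⟨i, h⟩ => ⟨-i, by simpa using h⟩)
  hull i x hx h1 h2 := by
    have := F.hull (-(i + 1)) x hx h2 (by simpa using h1)
    rw [ori_neg, ← ori_swap]
    simpa using this
  fan i m h1 h2 := by
    have := F.fan (-i) (-(m + 1)) (by rw [show 1 - (i + 1) = -i by ring] at h2; omega)
      (by rw [show 1 - i = -i + 1 by ring] at h1; omega)
    rw [ori_neg, ← ori_swap, ori_rot]
    simpa using this

theorem nb_reverse {x : Plane} {i : ℤ} :
    Nb (fun m => a (-m)) (fun i => -f (1 - i)) x i ↔ Nb a f x (-i) := by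
  constructor
  · rintro ⟨m, h1, h2, rfl⟩
    refine ⟨-m, ?_, ?_, rfl⟩ <;> beta_reduce at *
    · rw [show 1 - (i + 1) = -i by ring] at h2; omega
    · rw [show 1 - i = -i + 1 by ring] at h1; omega
  · rintro ⟨m, h1, h2, rfl⟩
    refine ⟨-m, ?_, ?_, by simp⟩ <;> beta_reduce at *
    · rw [show 1 - i = -i + 1 by ring]; omega
    · rw [show 1 - (i + 1) = -i by ring]; omega

theorem isTile_reverse {t : Finset Plane} :
    IsTile (fun i => c (-i)) (fun m => a (-m)) (fun i => -f (1 - i)) t ↔ IsTile c a f t := by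
  classical
  constructor
  · rintro (⟨i, rfl⟩ | ⟨i, m, h1, h2, rfl⟩)
    · left
      refine ⟨1 - i, ?_⟩
      beta_reduce
      rw [show 1 - i - 1 = -i by ring, show -(i - 1) = 1 - i by ring, neg_neg]
      ext x; simp only [Finset.mem_insert, Finset.mem_singleton]; tauto
    · right
      refine ⟨-i, -(m + 1), ?_, ?_, ?_⟩ <;> beta_reduce at *
      · rw [show 1 - (i + 1) = -i by ring] at h2; omega
      · rw [show 1 - i = -i + 1 by ring] at h1; omega
      · rw [show -(m + 1) + 1 = -m by ring]
        ext x; simp only [Finset.mem_insert, Finset.mem_singleton]; tauto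
  · rintro (⟨i, rfl⟩ | ⟨i, m, h1, h2, rfl⟩)
    · left
      refine ⟨1 - i, ?_⟩
      beta_reduce
      rw [show 1 - (1 - i) = i by ring, show -(1 - i - 1) = i by ring,
        show -(1 - i) = i - 1 by ring, neg_neg]
      ext x; simp only [Finset.mem_insert, Finset.mem_singleton]; tauto
    · right
      refine ⟨-i, -(m + 1), ?_, ?_, ?_⟩ <;> beta_reduce at *
      · rw [show 1 - -i = i + 1 by ring]; omega
      · rw [show 1 - (-i + 1) = i by ring]; omega
      · rw [show -(-(m + 1) + 1) = m by ring, neg_neg, neg_neg]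
        ext x; simp only [Finset.mem_insert, Finset.mem_singleton]; tauto

end Frame

/-! ### The interior of a polygon -/

theorem isClosed_polygonCurve (C : List Plane) : IsClosed (polygonCurve C) := by
  have : polygonCurve C = ⋃ e ∈ {e | e ∈ cyclicPairs C}, segment ℝ e.1 e.2 := by
    ext x; simp [polygonCurve]
  rw [this]
  refine Set.Finite.isClosed_biUnion (List.finite_toSet _) fun e _ => ?_
  rw [← convexHull_pair]
  exact ((Set.toFinite _).isCompact_convexHull ℝ).isClosed

theorem polygonInterior_disjoint_curve {C : List Plane} {x : Plane} (h : x ∈ polygonInterior C) :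
    x ∉ polygonCurve C := h.1

theorem subset_polygonInterior {C : List Plane} {s : Set Plane} (hs : IsPreconnected s)
    (hd : ∀ x ∈ s, x ∉ polygonCurve C) {x : Plane} (hx : x ∈ s) (hxU : x ∈ polygonInterior C) :
    s ⊆ polygonInterior C := by
  intro y hy
  refine ⟨hd y hy, ?_⟩
  have : s ⊆ connectedComponentIn (polygonCurve C)ᶜ x :=
    hs.subset_connectedComponentIn hx hd
  rw [← connectedComponentIn_eq (this hy)]
  exact hxU.2

theorem isOpen_polygonInterior (C : List Plane) : IsOpen (polygonInterior C) := by
  rw [Metric.isOpen_iff]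
  intro x hx
  obtain ⟨δ, hδ, hb⟩ := Metric.isOpen_iff.1 (isClosed_polygonCurve C).isOpen_compl x hx.1
  exact ⟨δ, hδ, subset_polygonInterior (convex_ball x δ).isPreconnected hb
    (Metric.mem_ball_self hδ) hx⟩

/-- An unbounded connected set that avoids the curve avoids the interior. -/
theorem notMem_polygonInterior {C : List Plane} {s : Set Plane} (hs : IsPreconnected s)
    (hd : ∀ x ∈ s, x ∉ polygonCurve C) (hb : ¬ Bornology.IsBounded s) {x : Plane} (hx : x ∈ s) :
    x ∉ polygonInterior C :=
  fun h => hb (h.2.subset (hs.subset_connectedComponentIn hx hd))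

theorem not_isBounded_of_ray {s : Set Plane} {x v : Plane} (hv : v ≠ 0)
    (h : ∀ t : ℝ, 0 < t → x + t • v ∈ s) : ¬ Bornology.IsBounded s := by
  intro hb
  obtain ⟨R, hR⟩ := hb.exists_norm_le
  have hv' : 0 < ‖v‖ := norm_pos_iff.2 hv
  set t := (|R| + ‖x‖ + 1) / ‖v‖
  have ht : 0 < t := by positivity
  have h1 := hR _ (h t ht)
  have h2 : ‖t • v‖ = |R| + ‖x‖ + 1 := by
    rw [norm_smul, Real.norm_of_nonneg ht.le, div_mul_cancel₀ _ hv'.ne']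
  have h3 : ‖t • v‖ ≤ ‖x + t • v‖ + ‖x‖ := by
    calc ‖t • v‖ = ‖(x + t • v) - x‖ := by rw [add_sub_cancel_left]
      _ ≤ _ := norm_sub_le _ _
  have := le_abs_self R
  linarith

/-- Every side of a line that meets the interior of a polygon contains a vertex. -/
theorem exists_vertex_side {C : List Plane} {ε : ℝ} {p q x : Plane}
    (hx : x ∈ polygonInterior C) (h : 0 < ori ε p q x) : ∃ v ∈ C, 0 < ori ε p q v := by
  by_contra hn
  push Not at hn
  refine notMem_polygonInterior (s := {y | 0 < ori ε p q y}) ?_ ?_ ?_ h hx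
  · apply Convex.isPreconnected
    rintro y hy z hz s t hs ht hst
    simp only [Set.mem_ofPred_eq] at *
    rw [ori_comb_two _ _ _ _ _ hst]
    rcases hs.eq_or_lt with rfl | hs
    · have : t = 1 := by linarith
      subst this; simpa
    · have := mul_pos hs hy
      have := mul_nonneg ht hz.le
      linarith
  · rintro y hy ⟨e, he, hye⟩
    obtain ⟨s, t, hs, ht, hst, rfl⟩ := hye
    simp only [Set.mem_ofPred_eq] at hy
    rw [ori_comb_two _ _ _ _ _ hst] at hy
    have hm := List.of_mem_zip he
    have h1 := mul_nonpos_of_nonneg_of_nonpos hs (hn e.1 hm.1)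
    have h2 := mul_nonpos_of_nonneg_of_nonpos ht (hn e.2 (List.mem_rotate.1 hm.2))
    linarith
  · refine not_isBounded_of_ray (x := x) (v := x - p) ?_ ?_
    · intro h0
      rw [sub_eq_zero] at h0
      subst h0
      simp at h
    · intro t ht
      have : x + t • (x - p) = (1 + t) • x + (-t) • p := by
        rw [smul_sub, add_smul, one_smul, neg_smul]; abel
      simp only [Set.mem_ofPred_eq]
      rw [this, ori_comb_two _ _ _ _ _ (by ring), ori_left, mul_zero, add_zero]
      positivity

end FourConn

namespace FourConn

/-! ### Triangulations -/

theorem notMem_openTriangle_of_edge {p q r x : Plane} (h : orient p q r ≠ 0)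
    (hx : x ∈ segment ℝ p q) : x ∉ openTriangle p q r := by
  rw [mem_openTriangle_iff (sq_ori h), ori_eq_zero_of_mem_segment hx]
  simp

theorem coe_triple [DecidableEq Plane] (p q r : Plane) :
    (({p, q, r} : Finset Plane) : Set Plane) = {p, q, r} := by simp

theorem exists_third [DecidableEq Plane] {t : Finset Plane} (ht : t.card = 3) {p q : Plane}
    (hp : p ∈ t) (hq : q ∈ t) (hpq : p ≠ q) : ∃ r, r ≠ p ∧ r ≠ q ∧ t = {p, q, r} := by
  obtain ⟨r, hr, hrpq⟩ : ∃ r ∈ t, r ∉ ({p, q} : Finset Plane) := by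
    by_contra h
    push Not at h
    have := Finset.card_le_card (fun r hr => h r hr : t ⊆ {p, q})
    have h2 := Finset.card_le_two (a := p) (b := q)
    omega
  simp only [Finset.mem_insert, Finset.mem_singleton, not_or] at hrpq
  refine ⟨r, hrpq.1, hrpq.2, (Finset.eq_of_subset_of_card_le ?_ ?_).symm⟩
  · intro x hx
    simp only [Finset.mem_insert, Finset.mem_singleton] at hx
    rcases hx with rfl | rfl | rfl <;> assumption
  · rw [ht, Finset.card_eq_three.2 ⟨p, q, r, hpq, Ne.symm hrpq.1, Ne.symm hrpq.2, rfl⟩]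

/-- Two different edges of triangles with disjoint interiors do not cross. -/
theorem disjoint_edges {P : Finset Plane} (hP : GeneralPosition P) {T : Finset (Finset Plane)}
    (hsub : ∀ t ∈ T, t ⊆ P) (hcard : ∀ t ∈ T, t.card = 3)
    (hdisj : ∀ t ∈ T, ∀ t' ∈ T, t ≠ t' →
      Disjoint (interior (convexHull ℝ (t : Set Plane))) (interior (convexHull ℝ (t' : Set Plane))))
    {p q g h : Plane} (hpq : TriangulationEdge T p q) (hgh : TriangulationEdge T g h)
    (hne : s(p, q) ≠ s(g, h)) {x : Plane} (hx : x ∈ openSegment ℝ p q)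
    (hx' : x ∈ openSegment ℝ g h) : False := by
  classical
  obtain ⟨hpq, t, ht, hp, hq⟩ := hpq
  obtain ⟨hgh, t', ht', hg, hh⟩ := hgh
  obtain ⟨r, hrp, hrq, htr⟩ := exists_third (hcard t ht) hp hq hpq
  obtain ⟨w, hwg, hwh, htw⟩ := exists_third (hcard t' ht') hg hh hgh
  have hr : r ∈ t := by rw [htr]; simp
  have hw : w ∈ t' := by rw [htw]; simp
  have o1 := hP.orient_ne (hsub t ht hp) (hsub t ht hq) (hsub t ht hr) hpq hrp.symm hrq.symm
  have o2 := hP.orient_ne (hsub t' ht' hg) (hsub t' ht' hh) (hsub t' ht' hw) hgh hwg.symm hwh.symm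
  obtain ⟨y, hy, hyo⟩ := crossing_meets_openTriangle o1
    (hP.orient_ne_or (hsub t ht hp) (hsub t ht hq) (hsub t' ht' hg) (hsub t' ht' hh) hpq hgh hne)
    hx hx'
  have hyg : y ∈ segment ℝ g h := openSegment_subset_segment _ _ _ hy
  by_cases htt : t = t'
  · subst htt
    have : openTriangle p q r = openTriangle g h w := by
      rw [← interior_convexHull_triple o1, ← interior_convexHull_triple o2, ← coe_triple,
        ← coe_triple, ← htr, ← htw]
    rw [this] at hyo
    exact notMem_openTriangle_of_edge o2 hyg hyo
  · have hd := hdisj t ht t' ht' htt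
    rw [htr, htw, coe_triple, coe_triple, interior_convexHull_triple o1,
      interior_convexHull_triple o2] at hd
    have hyc : y ∈ closure (openTriangle g h w) := by
      rw [closure_openTriangle]
      exact (convex_convexHull ℝ _).segment_subset (subset_convexHull ℝ _ (by simp))
        (subset_convexHull ℝ _ (by simp)) hyg
    obtain ⟨z, hz1, hz2⟩ := mem_closure_iff.1 hyc _ (isOpen_openTriangle o1) hyo
    exact Set.disjoint_left.1 hd hz1 hz2

/-! ### Annular triangulations -/

/-- The triangles of a frame triangulate the annular region between the hull and the polygon `C`
through the inner points. -/
structure Annulus (P : Finset Plane) (C : List Plane) (T : Finset (Finset Plane)) (ε : ℝ)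
    (k n : ℤ) (c a : ℤ → Plane) (f : ℤ → ℤ) : Prop extends Frame P ε k n c a f where
  simple : IsSimplePolygon C
  mem_T : ∀ t, t ∈ T ↔ IsTile c a f t
  tri : IsTriangulationOf P (annularRegion P C) T
  edge_iff : ∀ p q, PolygonEdge C p q ↔
    ∃ m, (p = a m ∧ q = a (m + 1)) ∨ (p = a (m + 1) ∧ q = a m)
  vert : ∀ p, p ∈ C ↔ ∃ m, p = a m
  rot : ∀ s, ∃ C' : List Plane, (C'.IsRotated C ∨ C'.IsRotated C.reverse) ∧
    C' = (List.range n.toNat).map (fun r : ℕ => a (s + r))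

/-- No edge of `D` joins two points seen by the same hull vertex. -/
def NbFree (a : ℤ → Plane) (f : ℤ → ℤ) (D : Set (Sym2 Plane)) : Prop :=
  ∀ g h, s(g, h) ∈ D → ∀ i, Nb a f g i → ¬ Nb a f h i

theorem UnionEdge.symm {T : Finset (Finset Plane)} {C : List Plane} {D : Set (Sym2 Plane)}
    {p q : Plane} (h : UnionEdge T C D p q) : UnionEdge T C D q p := by
  rcases h with ⟨hne, t, ht, hp, hq⟩ | h | h
  · exact Or.inl ⟨hne.symm, t, ht, hq, hp⟩
  · exact Or.inr (Or.inl h.symm)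
  · exact Or.inr (Or.inr (by rwa [Sym2.eq_swap]))

namespace Annulus

variable {P : Finset Plane} {C : List Plane} {T : Finset (Finset Plane)} {ε : ℝ} {k n : ℤ}
  {c a : ℤ → Plane} {f : ℤ → ℤ}

theorem reverse (A : Annulus P C T ε k n c a f) :
    Annulus P C T (-ε) k n (fun i => c (-i)) (fun m => a (-m)) (fun i => -f (1 - i)) where
  toFrame := A.toFrame.reverse
  simple := A.simple
  mem_T t := by rw [A.mem_T, Frame.isTile_reverse]
  tri := A.tri
  edge_iff p q := by
    rw [A.edge_iff]
    constructor
    · rintro ⟨m, h⟩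
      refine ⟨-(m + 1), ?_⟩
      rw [show -(-(m + 1) + 1) = m by ring, neg_neg]
      exact h.symm
    · rintro ⟨m, h⟩
      refine ⟨-(m + 1), ?_⟩
      rw [show -(m + 1) + 1 = -m by ring]
      exact h.symm
  vert p := by
    rw [A.vert]
    exact ⟨fun ⟨m, h⟩ => ⟨-m, by simpa using h⟩, fun ⟨m, h⟩ => ⟨-m, h⟩⟩
  rot s := by
    obtain ⟨C', h, rfl⟩ := A.rot (-s - n + 1)
    refine ⟨((List.range n.toNat).map (fun r : ℕ => a (-s - n + 1 + r))).reverse, ?_, ?_⟩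
    · rcases h with h | h
      · exact Or.inr h.reverse
      · have := h.reverse
        rw [List.reverse_reverse] at this
        exact Or.inl this
    · apply List.ext_getElem
      · simp
      · intro i h1 h2
        simp only [List.length_reverse, List.length_map, List.length_range] at h1
        simp only [List.getElem_reverse, List.getElem_map, List.getElem_range, List.length_map,
          List.length_range]
        congr 1
        omega

theorem hull_tile (A : Annulus P C T ε k n c a f) [DecidableEq Plane] (i : ℤ) :
    {c i, c (i + 1), a (f (i + 1))} ∈ T := by
  rw [A.mem_T]
  refine Or.inl ⟨i + 1, ?_⟩
  rw [add_sub_cancel_right]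
  congr!

theorem fan_tile (A : Annulus P C T ε k n c a f) [DecidableEq Plane] {i m : ℤ} (h1 : f i ≤ m)
    (h2 : m < f (i + 1)) : {a m, c i, a (m + 1)} ∈ T := by
  rw [A.mem_T]
  refine Or.inr ⟨i, m, h1, h2, ?_⟩
  congr!

theorem triangulationEdge_of_nb (A : Annulus P C T ε k n c a f) {x : Plane} {i : ℤ}
    (h : Nb a f x i) : TriangulationEdge T x (c i) := by
  classical
  obtain ⟨m, h1, h2, rfl⟩ := h
  refine ⟨(A.c_ne_a _ _).symm, ?_⟩
  rcases h2.lt_or_eq with h2 | rfl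
  · exact ⟨_, A.fan_tile h1 h2, by simp, by simp⟩
  · exact ⟨_, A.hull_tile i, by simp, by simp⟩

theorem nb_of_triangulationEdge (A : Annulus P C T ε k n c a f) {m i : ℤ}
    (h : TriangulationEdge T (a m) (c i)) : Nb a f (a m) i := by
  obtain ⟨-, t, ht, hm, hi⟩ := h
  rcases (A.mem_T t).1 ht with ⟨j, rfl⟩ | ⟨j, l, h1, h2, rfl⟩
  · simp only [Finset.mem_insert, Finset.mem_singleton] at hm hi
    have hm' : a m = a (f j) := by
      rcases hm with h | h | h
      · exact absurd h.symm (A.c_ne_a _ _)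
      · exact absurd h.symm (A.c_ne_a _ _)
      · exact h
    rw [hm']
    rcases hi with h | h | h
    · refine A.nb_congr h.symm ⟨f j, ?_, ?_, rfl⟩
      · exact A.f_mono.monotone (by omega)
      · rw [sub_add_cancel]
    · exact A.nb_congr h.symm ⟨f j, le_rfl, (A.f_lt j).le, rfl⟩
    · exact absurd h (A.c_ne_a _ _)
  · simp only [Finset.mem_insert, Finset.mem_singleton] at hm hi
    have hi' : c i = c j := by
      rcases hi with h | h | h
      · exact absurd h (A.c_ne_a _ _)
      · exact h
      · exact absurd h (A.c_ne_a _ _)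
    refine A.nb_congr hi'.symm ?_
    rcases hm with h | h | h
    · exact ⟨l, h1, h2.le, h⟩
    · exact absurd h.symm (A.c_ne_a _ _)
    · exact ⟨l + 1, by omega, by omega, h⟩

theorem triangulationEdge_succ (A : Annulus P C T ε k n c a f) (m : ℤ) :
    TriangulationEdge T (a m) (a (m + 1)) := by
  classical
  obtain ⟨i, h1, h2⟩ := A.exists_block m
  exact ⟨A.a_ne_succ m, _, A.fan_tile h1 h2, by simp, by simp⟩

theorem edges_disjoint (A : Annulus P C T ε k n c a f) {p q g h : Plane}
    (hpq : TriangulationEdge T p q) (hgh : TriangulationEdge T g h)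
    (hne : s(p, q) ≠ s(g, h)) {x : Plane} (hx : x ∈ openSegment ℝ p q)
    (hx' : x ∈ openSegment ℝ g h) : False :=
  disjoint_edges A.gp A.tri.subset A.tri.card_eq A.tri.disjoint hpq hgh hne hx hx'

theorem notMem_polygonInterior_of_mem_edge (A : Annulus P C T ε k n c a f) {p q x : Plane}
    (hpq : TriangulationEdge T p q) (hx : x ∈ segment ℝ p q) : x ∉ polygonInterior C := by
  obtain ⟨-, t, ht, hp, hq⟩ := hpq
  have h1 : x ∈ annularRegion P C := by
    rw [← A.tri.cover]
    exact ⟨t, ht, (convex_convexHull ℝ _).segment_subset (subset_convexHull ℝ _ (by simpa))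
        (subset_convexHull ℝ _ (by simpa)) hx⟩
  exact h1.2

theorem nb_notMem (A : Annulus P C T ε k n c a f) {x y : Plane} {i : ℤ} (h : Nb a f x i)
    (hy : y ∈ openSegment ℝ x (c i)) : y ∉ polygonInterior C :=
  A.notMem_polygonInterior_of_mem_edge (A.triangulationEdge_of_nb h)
    (openSegment_subset_segment _ _ _ hy)

theorem curve_iff (A : Annulus P C T ε k n c a f) {x : Plane} :
    x ∈ polygonCurve C ↔ ∃ m, x ∈ segment ℝ (a m) (a (m + 1)) := by
  constructor
  · rintro ⟨e, he, hx⟩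
    obtain ⟨m, ⟨h1, h2⟩ | ⟨h1, h2⟩⟩ := (A.edge_iff e.1 e.2).1 (Or.inl he)
    · exact ⟨m, by rwa [← h1, ← h2]⟩
    · exact ⟨m, by rwa [← h1, ← h2, segment_symm]⟩
  · rintro ⟨m, hx⟩
    rcases (A.edge_iff (a m) (a (m + 1))).2 ⟨m, Or.inl ⟨rfl, rfl⟩⟩ with h | h
    · exact ⟨_, h, hx⟩
    · exact ⟨_, h, by rwa [segment_symm]⟩

theorem no_point_in_tile (A : Annulus P C T ε k n c a f) [DecidableEq Plane] {p q r x : Plane}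
    (ht : ({p, q, r} : Finset Plane) ∈ T) (h1 : p ≠ q) (h2 : p ≠ r) (h3 : q ≠ r)
    (hx : x ∈ P) (hxt : x ∈ openTriangle p q r) : False := by
  have hs := A.tri.subset _ ht
  have o := A.gp.orient_ne (hs (by simp : p ∈ _)) (hs (by simp : q ∈ _)) (hs (by simp : r ∈ _))
    h1 h2 h3
  have := A.tri.empty _ ht x hx (by
    rw [coe_triple]; exact openTriangle_subset_convexHull _ _ _ hxt)
  simp only [Finset.mem_insert, Finset.mem_singleton] at this
  rcases this with rfl | rfl | rfl
  · exact notMem_openTriangle_of_edge o (left_mem_segment _ _ _) hxt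
  · exact notMem_openTriangle_of_edge o (right_mem_segment _ _ _) hxt
  · rw [← openTriangle_rot] at hxt
    exact notMem_openTriangle_of_edge (by rwa [orient_rot]) (right_mem_segment _ _ _) hxt

theorem nb_mem (A : Annulus P C T ε k n c a f) {x : Plane} {i : ℤ} (h : Nb a f x i) : x ∈ P := by
  obtain ⟨m, -, -, rfl⟩ := h
  exact A.a_mem m

theorem nb_ne (A : Annulus P C T ε k n c a f) {x : Plane} {i : ℤ} (j : ℤ) (h : Nb a f x i) :
    x ≠ c j := by
  obtain ⟨m, -, -, rfl⟩ := h
  exact (A.c_ne_a _ _).symm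

theorem succ_notSubset (A : Annulus P C T ε k n c a f) (m : ℤ) :
    ¬ openSegment ℝ (a m) (a (m + 1)) ⊆ polygonInterior C := by
  intro h
  obtain ⟨x, hx⟩ : (openSegment ℝ (a m) (a (m + 1))).Nonempty :=
    ⟨midpoint ℝ _ _, midpoint_mem_openSegment _ _⟩
  exact A.notMem_polygonInterior_of_mem_edge (A.triangulationEdge_succ m)
    (openSegment_subset_segment _ _ _ hx) (h hx)

/-- A hull edge at an inner point of a triangle cannot leave the triangle through an edge that is a
spoke, an edge of `C`, or inside `C`. -/
theorem spoke_exit (A : Annulus P C T ε k n c a f) {p q r x : Plane} (hp : p ∈ P) (hq : q ∈ P)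
    (hr : r ∈ P) (h1 : p ≠ q) (h2 : p ≠ r) (h3 : q ≠ r) {j : ℤ} (hx : Nb a f x j)
    (hxt : x ∈ openTriangle p q r) (hjp : c j ≠ p) (hjq : c j ≠ q) (hjr : c j ≠ r)
    (hpq : TriangulationEdge T p q ∨ openSegment ℝ p q ⊆ polygonInterior C)
    (hqr : TriangulationEdge T q r ∨ openSegment ℝ q r ⊆ polygonInterior C)
    (hrp : TriangulationEdge T r p ∨ openSegment ℝ r p ⊆ polygonInterior C) : False := by
  have key : ∀ u v w, (TriangulationEdge T u v ∨ openSegment ℝ u v ⊆ polygonInterior C) →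
      c j ≠ u → c j ≠ v → w ∈ openSegment ℝ x (c j) → w ∈ openSegment ℝ u v → False := by
    intro u v w h hu hv hw hw'
    rcases h with h | h
    · refine A.edges_disjoint (A.triangulationEdge_of_nb hx) h ?_ hw hw'
      intro he
      rcases Sym2.eq_iff.1 he with ⟨-, he⟩ | ⟨-, he⟩
      · exact hv he
      · exact hu he
    · exact A.nb_notMem hx hw (h hw')
  rcases A.gp.exit hp hq hr h1 h2 h3 (A.nb_mem hx) (A.c_mem j) (A.nb_ne j hx) hxt
    (left_mem_segment _ _ _) (A.nb_ne j hx) (A.c_notMem_openTriangle j hp hq hr h1 h2 h3) with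
    (h | h | h) | ⟨w, hw, -, -, h | h | h⟩
  · exact hjp h
  · exact hjq h
  · exact hjr h
  · exact key _ _ _ hpq hjp hjq hw h
  · exact key _ _ _ hqr hjq hjr hw h
  · exact key _ _ _ hrp hjr hjp hw h

/-- An inner point in the triangle of a bad diagonal is seen by one hull vertex only. -/
theorem nb_of_mem_triangle (A : Annulus P C T ε k n c a f) {p q x : Plane} {i j : ℤ}
    (hp : Nb a f p i) (hq : Nb a f q i) (hpq : p ≠ q)
    (hU : openSegment ℝ p q ⊆ polygonInterior C) (hx : x ∈ openTriangle p q (c i))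
    (hj : Nb a f x j) : c j = c i := by
  by_contra hne
  exact A.spoke_exit (A.nb_mem hp) (A.nb_mem hq) (A.c_mem i) hpq (A.nb_ne i hp) (A.nb_ne i hq) hj hx
    (A.nb_ne j hp).symm (A.nb_ne j hq).symm hne (Or.inr hU) (Or.inl (A.triangulationEdge_of_nb hq))
    (Or.inl (by
      obtain ⟨h, t, ht, h1, h2⟩ := A.triangulationEdge_of_nb hp
      exact ⟨h.symm, t, ht, h2, h1⟩))

theorem mem_triangle_of_between (A : Annulus P C T ε k n c a f) {i s t u : ℤ} (h1 : f i ≤ s)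
    (h2 : s < u) (h3 : u < t) (h4 : t ≤ f (i + 1))
    (hU : openSegment ℝ (a s) (a t) ⊆ polygonInterior C) :
    a u ∈ openTriangle (a s) (a t) (c i) := by
  have o1 := A.angular h1 (h2.trans h3) h4
  have o2 := A.angular h1 h2 (by omega)
  have o3 := A.angular (by omega) h3 h4
  rw [← openTriangle_swap', mem_openTriangle_iff o1]
  refine ⟨o2, by rwa [ori_rot], ?_⟩
  have hw := A.width i
  rcases (A.gp.ori_ne A.eps (A.a_mem t) (A.a_mem s) (A.a_mem u) (A.a_ne (by omega) (by omega)).symm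
    (A.a_ne (by omega) (by omega)).symm (A.a_ne h2 (by omega))).lt_or_gt with h | h
  · exfalso
    obtain ⟨x, hx, hx'⟩ := openSegment_inter_nonempty (ε := ε) (p := c i) (q := a u) (g := a t)
      (h := a s) (by rw [ori_swap', ori_rot]; linarith) (by rwa [ori_rot])
      (by rwa [ori_rot']) h
    rw [openSegment_symm] at hx hx'
    exact A.nb_notMem ⟨u, by omega, by omega, rfl⟩ hx (hU hx')
  · exact h

theorem between_of_mem_triangle (A : Annulus P C T ε k n c a f) {i s t m : ℤ} (h1 : f i ≤ s)
    (h2 : s < t) (h4 : t ≤ f (i + 1))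
    (hU : openSegment ℝ (a s) (a t) ⊆ polygonInterior C)
    (hm : a m ∈ openTriangle (a s) (a t) (c i)) : ∃ u, s < u ∧ u < t ∧ a m = a u := by
  obtain ⟨j, hj⟩ := A.exists_nb m
  have hw := A.width i
  have hc := A.nb_of_mem_triangle ⟨s, h1, by omega, rfl⟩ ⟨t, by omega, h4, rfl⟩
    (A.a_ne h2 (by omega)) hU hm hj
  obtain ⟨u, h5, h6, h7⟩ := A.nb_congr hc hj
  rw [h7] at hm
  rw [← openTriangle_swap', mem_openTriangle_iff (A.angular h1 h2 h4)] at hm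
  obtain ⟨o1, o2, -⟩ := hm
  refine ⟨u, ?_, ?_, h7⟩
  · by_contra hu
    rcases (not_lt.1 hu).lt_or_eq with hu | rfl
    · have e := A.angular h5 hu (by omega)
      rw [ori_rev] at e
      linarith
    · simp at o1
  · by_contra hu
    rcases (not_lt.1 hu).lt_or_eq with hu | rfl
    · have e := A.angular (by omega) hu h6
      rw [ori_swap] at o2
      linarith
    · simp at o2

theorem exists_hull_notMem (A : Annulus P C T ε k n c a f) {p q : Plane} {i : ℤ}
    (hp : Nb a f p i) (hq : Nb a f q i) (hpq : p ≠ q) :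
    ∃ y ∈ P, y ∉ convexHull ℝ ({p, q, c i} : Set Plane) := by
  refine ⟨c (i + 1), A.c_mem _, fun h => ?_⟩
  exact A.c_notMem_openTriangle (i + 1) (A.nb_mem hp) (A.nb_mem hq) (A.c_mem i) hpq
    (A.nb_ne _ hp) (A.nb_ne _ hq) (A.gp.mem_openTriangle (A.nb_mem hp) (A.nb_mem hq) (A.c_mem i) hpq
    (A.nb_ne _ hp) (A.nb_ne _ hq) (A.c_mem _) h (A.nb_ne _ hp).symm (A.nb_ne _ hq).symm
    (A.c_ne_succ i).symm)

theorem exists_between (A : Annulus P C T ε k n c a f) {p q : Plane} {i : ℤ}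
    (hp : Nb a f p i) (hq : Nb a f q i) (hpq : p ≠ q)
    (hU : openSegment ℝ p q ⊆ polygonInterior C) :
    ∃ s t, f i ≤ s ∧ s + 1 < t ∧ t ≤ f (i + 1) ∧ s(p, q) = s(a s, a t) := by
  obtain ⟨s, h1, h2, rfl⟩ := hp
  obtain ⟨t, h3, h4, rfl⟩ := hq
  rcases lt_trichotomy s t with h | rfl | h
  · refine ⟨s, t, h1, ?_, h4, rfl⟩
    by_contra h'
    have : t = s + 1 := by omega
    subst this
    exact A.succ_notSubset s hU
  · exact absurd rfl hpq
  · refine ⟨t, s, h3, ?_, h2, Sym2.eq_swap⟩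
    by_contra h'
    have : s = t + 1 := by omega
    subst this
    rw [openSegment_symm] at hU
    exact A.succ_notSubset t hU

/-- A diagonal whose endpoints are seen by the same hull vertex gives a complex triangle. -/
theorem hasComplexTriangle_of_nb (A : Annulus P C T ε k n c a f) {D : Set (Sym2 Plane)}
    {p q : Plane} {i : ℤ} (hp : Nb a f p i) (hq : Nb a f q i) (hpq : p ≠ q)
    (hU : openSegment ℝ p q ⊆ polygonInterior C) (hD : s(p, q) ∈ D) :
    HasComplexTriangle P (UnionEdge T C D) := by
  obtain ⟨s, t, h1, h2, h3, he⟩ := A.exists_between hp hq hpq hU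
  refine ⟨p, q, c i, hpq, A.nb_ne i hp, A.nb_ne i hq, Or.inr (Or.inr hD),
    Or.inl (A.triangulationEdge_of_nb hp), Or.inl (A.triangulationEdge_of_nb hq),
    ⟨a (s + 1), A.a_mem _, ?_⟩, A.exists_hull_notMem hp hq hpq⟩
  rcases Sym2.eq_iff.1 he with ⟨rfl, rfl⟩ | ⟨rfl, rfl⟩
  · exact A.mem_triangle_of_between h1 (by omega) h2 h3 hU
  · rw [openSegment_symm] at hU
    rw [openTriangle_swap]
    exact A.mem_triangle_of_between h1 (by omega) h2 h3 hU

theorem hull_adj (A : Annulus P C T ε k n c a f) {i j : ℤ} (h : TriangulationEdge T (c i) (c j)) :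
    c j = c (i + 1) ∨ c i = c (j + 1) := by
  obtain ⟨hne, t, ht, hi, hj⟩ := h
  have succ : ∀ {i j : ℤ}, c i = c j → c (i + 1) = c (j + 1) := by
    intro i j h
    rw [A.c_iff] at h ⊢
    simpa using h
  rcases (A.mem_T t).1 ht with ⟨l, rfl⟩ | ⟨l, m, h1, h2, rfl⟩
  · simp only [Finset.mem_insert, Finset.mem_singleton, A.c_ne_a, or_false] at hi hj
    rcases hi with hi | hi <;> rcases hj with hj | hj
    · exact absurd (hi.trans hj.symm) hne
    · have := succ hi
      rw [sub_add_cancel] at this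
      exact Or.inl (hj.trans this.symm)
    · have := succ hj
      rw [sub_add_cancel] at this
      exact Or.inr (hi.trans this.symm)
    · exact absurd (hi.trans hj.symm) hne
  · simp only [Finset.mem_insert, Finset.mem_singleton, A.c_ne_a, or_false, false_or] at hi hj
    exact absurd (hi.trans hj.symm) hne

end Annulus

end FourConn

namespace FourConn

namespace Annulus

variable {P : Finset Plane} {C : List Plane} {T : Finset (Finset Plane)} {ε : ℝ} {k n : ℤ}
  {c a : ℤ → Plane} {f : ℤ → ℤ}

theorem nb_of_unionEdge (A : Annulus P C T ε k n c a f) {D : Set (Sym2 Plane)}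
    (hD : ∀ p q, s(p, q) ∈ D → IsDiagonal C (polygonInterior C) p q) {i m : ℤ}
    (h : UnionEdge T C D (c i) (a m)) : Nb a f (a m) i := by
  rcases h with ⟨hne, t, ht, h1, h2⟩ | h | h
  · exact A.nb_of_triangulationEdge ⟨hne.symm, t, ht, h2, h1⟩
  · obtain ⟨l, ⟨h, -⟩ | ⟨h, -⟩⟩ := (A.edge_iff _ _).1 h
    · exact absurd h (A.c_ne_a _ _)
    · exact absurd h (A.c_ne_a _ _)
  · obtain ⟨l, h⟩ := (A.vert _).1 (hD _ _ h).2.1.1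
    exact absurd h (A.c_ne_a _ _)

theorem hull_adj_of_unionEdge (A : Annulus P C T ε k n c a f) {D : Set (Sym2 Plane)}
    (hD : ∀ p q, s(p, q) ∈ D → IsDiagonal C (polygonInterior C) p q) {i j : ℤ}
    (h : UnionEdge T C D (c i) (c j)) : c j = c (i + 1) ∨ c i = c (j + 1) := by
  rcases h with h | h | h
  · exact A.hull_adj h
  · obtain ⟨l, ⟨h, -⟩ | ⟨h, -⟩⟩ := (A.edge_iff _ _).1 h
    · exact absurd h (A.c_ne_a _ _)
    · exact absurd h (A.c_ne_a _ _)
  · obtain ⟨l, h⟩ := (A.vert _).1 (hD _ _ h).2.1.1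
    exact absurd h (A.c_ne_a _ _)

theorem succ_or_mem_of_triangulationEdge (A : Annulus P C T ε k n c a f) {l m : ℤ}
    (h : TriangulationEdge T (a l) (a m)) : ∃ u, s(a l, a m) = s(a u, a (u + 1)) := by
  obtain ⟨hne, t, ht, hl, hm⟩ := h
  have hca := fun i m => (A.c_ne_a i m).symm
  rcases (A.mem_T t).1 ht with ⟨j, rfl⟩ | ⟨j, u, h1, h2, rfl⟩
  · simp only [Finset.mem_insert, Finset.mem_singleton, hca, false_or] at hl hm
    exact absurd (hl.trans hm.symm) hne
  · simp only [Finset.mem_insert, Finset.mem_singleton, hca, false_or] at hl hm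
    refine ⟨u, ?_⟩
    rcases hl with hl | hl <;> rcases hm with hm | hm
    · exact absurd (hl.trans hm.symm) hne
    · rw [hl, hm]
    · rw [hl, hm, Sym2.eq_swap]
    · exact absurd (hl.trans hm.symm) hne

theorem succ_or_mem_of_unionEdge (A : Annulus P C T ε k n c a f) {D : Set (Sym2 Plane)} {l m : ℤ}
    (h : UnionEdge T C D (a l) (a m)) :
    (∃ u, s(a l, a m) = s(a u, a (u + 1))) ∨ s(a l, a m) ∈ D := by
  rcases h with h | h | h
  · exact Or.inl (A.succ_or_mem_of_triangulationEdge h)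
  · obtain ⟨u, ⟨h1, h2⟩ | ⟨h1, h2⟩⟩ := (A.edge_iff _ _).1 h
    · exact Or.inl ⟨u, by rw [h1, h2]⟩
    · exact Or.inl ⟨u, by rw [h1, h2, Sym2.eq_swap]⟩
  · exact Or.inr h

/-- Two consecutive inner points seen by the same hull vertex are consecutive in its window. -/
theorem window_succ (A : Annulus P C T ε k n c a f) {i s t u : ℤ} (h1 : f i ≤ s) (h2 : s < t)
    (h3 : t ≤ f (i + 1)) (h : s(a s, a t) = s(a u, a (u + 1))) : t = s + 1 := by
  have hw := A.width i
  have key : ∀ v w : ℤ, n ∣ v → |v| < n → v = 0 := fun v w h h' =>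
    Int.eq_zero_of_abs_lt_dvd h h'
  rcases Sym2.eq_iff.1 h with ⟨e1, e2⟩ | ⟨e1, e2⟩
  · rw [A.a_iff] at e1 e2
    have := dvd_sub e2 e1
    have := key _ 0 this (by rw [abs_lt]; constructor <;> omega)
    omega
  · rw [A.a_iff] at e1 e2
    have := dvd_sub e1 e2
    have := key _ 0 this (by rw [abs_lt]; constructor <;> omega)
    omega

theorem no_point_hull_edge (A : Annulus P C T ε k n c a f) {i m : ℤ} {x : Plane}
    (h1 : Nb a f (a m) i) (h2 : Nb a f (a m) (i + 1)) (hx : x ∈ P) :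
    x ∉ openTriangle (c i) (c (i + 1)) (a m) := by
  classical
  intro h
  have e : a m = a (f (i + 1)) := A.nb_unique h1
    ⟨f (i + 1), (A.f_lt i).le, le_rfl, rfl⟩ h2 ⟨f (i + 1), le_rfl, (A.f_lt _).le, rfl⟩
    (A.c_ne_succ i)
  rw [e] at h
  exact A.no_point_in_tile (A.hull_tile i) (A.c_ne_succ i) (A.c_ne_a _ _) (A.c_ne_a _ _) hx h

theorem no_point_cca (A : Annulus P C T ε k n c a f) {D : Set (Sym2 Plane)}
    (hD : ∀ p q, s(p, q) ∈ D → IsDiagonal C (polygonInterior C) p q) {i j m : ℤ} {x : Plane}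
    (h1 : UnionEdge T C D (c i) (c j)) (h2 : UnionEdge T C D (c i) (a m))
    (h3 : UnionEdge T C D (c j) (a m)) (hx : x ∈ P) : x ∉ openTriangle (c i) (c j) (a m) := by
  have n1 := A.nb_of_unionEdge hD h2
  have n2 := A.nb_of_unionEdge hD h3
  rcases A.hull_adj_of_unionEdge hD h1 with h | h
  · rw [h]
    exact A.no_point_hull_edge n1 (A.nb_congr h n2) hx
  · rw [h, openTriangle_swap]
    exact A.no_point_hull_edge n2 (A.nb_congr h n1) hx

theorem no_point_caa (A : Annulus P C T ε k n c a f) {D : Set (Sym2 Plane)}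
    (hD : ∀ p q, s(p, q) ∈ D → IsDiagonal C (polygonInterior C) p q) (hfree : NbFree a f D)
    {i l m : ℤ} {x : Plane} (hlm : a l ≠ a m)
    (h1 : UnionEdge T C D (c i) (a l)) (h2 : UnionEdge T C D (c i) (a m))
    (h3 : UnionEdge T C D (a l) (a m)) (hx : x ∈ P) : x ∉ openTriangle (c i) (a l) (a m) := by
  classical
  have n1 := A.nb_of_unionEdge hD h1
  have n2 := A.nb_of_unionEdge hD h2
  rcases A.succ_or_mem_of_unionEdge h3 with ⟨u, hu⟩ | h
  swap
  · exact absurd n2 (hfree _ _ h i n1)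
  obtain ⟨s, g1, g2, e1⟩ := n1
  obtain ⟨t, g3, g4, e2⟩ := n2
  rw [e1, e2] at hu hlm ⊢
  rcases lt_trichotomy s t with h | rfl | h
  · have := A.window_succ g1 h g4 hu
    subst this
    rw [← openTriangle_swap]
    exact A.no_point_in_tile (A.fan_tile g1 (by omega)) (A.c_ne_a _ _).symm hlm (A.c_ne_a _ _) hx
  · exact absurd rfl hlm
  · have := A.window_succ g3 h g2 (by rw [Sym2.eq_swap, hu])
    subst this
    rw [← openTriangle_swap', ← openTriangle_swap]
    exact A.no_point_in_tile (A.fan_tile g3 (by omega)) (A.c_ne_a _ _).symm hlm.symm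
      (A.c_ne_a _ _) hx

theorem no_point_aaa (A : Annulus P C T ε k n c a f) {D : Set (Sym2 Plane)}
    (hD : ∀ p q, s(p, q) ∈ D → IsDiagonal C (polygonInterior C) p q)
    {u l m : ℤ} {x : Plane} (hul : a u ≠ a l) (hum : a u ≠ a m) (hlm : a l ≠ a m)
    (h1 : UnionEdge T C D (a u) (a l)) (h2 : UnionEdge T C D (a u) (a m))
    (h3 : UnionEdge T C D (a l) (a m)) (hx : x ∈ P) : x ∉ openTriangle (a u) (a l) (a m) := by
  intro hxt
  rcases A.cover x hx with ⟨i, rfl⟩ | ⟨v, rfl⟩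
  · exact A.c_notMem_openTriangle i (A.a_mem _) (A.a_mem _) (A.a_mem _) hul hum hlm hxt
  obtain ⟨j, hj⟩ := A.exists_nb v
  have key : ∀ v w, UnionEdge T C D (a v) (a w) →
      TriangulationEdge T (a v) (a w) ∨ openSegment ℝ (a v) (a w) ⊆ polygonInterior C := by
    intro v w h
    rcases A.succ_or_mem_of_unionEdge h with ⟨y, hy⟩ | h
    · left
      obtain ⟨g0, t, ht, g1, g2⟩ := A.triangulationEdge_succ y
      rcases Sym2.eq_iff.1 hy with ⟨e1, e2⟩ | ⟨e1, e2⟩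
      · rw [e1, e2]; exact ⟨g0, t, ht, g1, g2⟩
      · rw [e1, e2]; exact ⟨g0.symm, t, ht, g2, g1⟩
    · exact Or.inr (hD _ _ h).2.2.2
  exact A.spoke_exit (A.a_mem _) (A.a_mem _) (A.a_mem _) hul hum hlm hj hxt (A.c_ne_a _ _)
    (A.c_ne_a _ _) (A.c_ne_a _ _) (key _ _ h1) (key _ _ h3) (key _ _ h2.symm)

theorem mem_triangle_ccc (A : Annulus P C T ε k n c a f) {p q r : ℤ} (hpq : c p ≠ c q)
    (hpr : c p ≠ c r) (hqr : c q ≠ c r) (h1 : c q = c (p + 1) ∨ c p = c (q + 1))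
    (h2 : c r = c (p + 1) ∨ c p = c (r + 1)) (h3 : c r = c (q + 1) ∨ c q = c (r + 1))
    {y : Plane} (hy : y ∈ P) : y ∈ convexHull ℝ ({c p, c q, c r} : Set Plane) := by
  by_cases y1 : y = c p
  · exact subset_convexHull ℝ _ (by simp [y1])
  by_cases y2 : y = c q
  · exact subset_convexHull ℝ _ (by simp [y2])
  by_cases y3 : y = c r
  · exact subset_convexHull ℝ _ (by simp [y3])
  apply openTriangle_subset_convexHull
  have hull : ∀ i j x, c j = c (i + 1) → x ∈ P → x ≠ c i → x ≠ c j → 0 < ori ε (c i) (c j) x := by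
    intro i j x h hx h1 h2
    rw [h] at h2 ⊢
    exact A.hull i x hx h1 h2
  rcases h1 with h1 | h1
  · have h3' : c r = c (q + 1) := by
      rcases h3 with h3 | h3
      · exact h3
      · rcases h2 with h2 | h2
        · exact absurd (h1.trans h2.symm) hqr
        · exact absurd (h2.trans h3.symm) hpq
    have h2' : c p = c (r + 1) := by
      rcases h2 with h2 | h2
      · exact absurd (h1.trans h2.symm) hqr
      · exact h2
    rw [mem_openTriangle_iff (hull p q _ h1 (A.c_mem r) hpr.symm hqr.symm)]
    exact ⟨hull p q y h1 hy y1 y2, hull q r y h3' hy y2 y3, hull r p y h2' hy y3 y1⟩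
  · have h3' : c q = c (r + 1) := by
      rcases h3 with h3 | h3
      · exact absurd (h1.trans h3.symm) hpr
      · exact h3
    have h2' : c r = c (p + 1) := by
      rcases h2 with h2 | h2
      · exact h2
      · exact absurd (h2.trans h3'.symm) hpq
    rw [← openTriangle_swap, mem_openTriangle_iff (hull q p _ h1 (A.c_mem r) hqr.symm hpr.symm)]
    exact ⟨hull q p y h1 hy y2 y1, hull p r y h2' hy y1 y3, hull r q y h3' hy y3 y2⟩

theorem not_hasComplexTriangle (A : Annulus P C T ε k n c a f) {D : Set (Sym2 Plane)}
    (hD : ∀ p q, s(p, q) ∈ D → IsDiagonal C (polygonInterior C) p q) (hfree : NbFree a f D) :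
    ¬ HasComplexTriangle P (UnionEdge T C D) := by
  have mem : ∀ p q, UnionEdge T C D p q → p ∈ P := by
    rintro p q (⟨-, t, ht, hp, -⟩ | h | h)
    · exact A.tri.subset t ht hp
    · obtain ⟨m, ⟨h, -⟩ | ⟨h, -⟩⟩ := (A.edge_iff _ _).1 h
      · rw [h]; exact A.a_mem _
      · rw [h]; exact A.a_mem _
    · obtain ⟨m, h⟩ := (A.vert _).1 (hD _ _ h).2.1.1
      rw [h]; exact A.a_mem _
  rintro ⟨p, q, r, hpq, hpr, hqr, h1, h2, h3, ⟨x, hx, hxt⟩, y, hy, hyn⟩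
  rcases A.cover p (mem _ _ h1) with ⟨p, rfl⟩ | ⟨p, rfl⟩ <;>
  rcases A.cover q (mem _ _ h1.symm) with ⟨q, rfl⟩ | ⟨q, rfl⟩ <;>
  rcases A.cover r (mem _ _ h2.symm) with ⟨r, rfl⟩ | ⟨r, rfl⟩
  · exact hyn (A.mem_triangle_ccc hpq hpr hqr (A.hull_adj_of_unionEdge hD h1)
      (A.hull_adj_of_unionEdge hD h2) (A.hull_adj_of_unionEdge hD h3) hy)
  · exact A.no_point_cca hD h1 h2 h3 hx hxt
  · rw [← openTriangle_swap'] at hxt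
    exact A.no_point_cca hD h2 h1 h3.symm hx hxt
  · exact A.no_point_caa hD hfree hqr h1 h2 h3 hx hxt
  · rw [← openTriangle_rot] at hxt
    exact A.no_point_cca hD h3 h1.symm h2.symm hx hxt
  · rw [← openTriangle_swap] at hxt
    exact A.no_point_caa hD hfree hpr h1.symm h3 h2 hx hxt
  · rw [← openTriangle_rot, ← openTriangle_rot] at hxt
    exact A.no_point_caa hD hfree hpq h2.symm h3.symm h1 hx hxt
  · exact A.no_point_aaa hD hpq hpr hqr h1 h2 h3 hx hxt

theorem isAdmissible_iff (A : Annulus P C T ε k n c a f) {D : Set (Sym2 Plane)} :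
    IsAdmissible P T C D ↔ (∀ p q, s(p, q) ∈ D → IsDiagonal C (polygonInterior C) p q) ∧
      (∀ p q p' q', s(p, q) ∈ D → s(p', q') ∈ D → s(p, q) ≠ s(p', q') →
        Disjoint (openSegment ℝ p q) (openSegment ℝ p' q')) ∧ NbFree a f D := by
  constructor
  · rintro ⟨h1, h2, h3⟩
    refine ⟨h1, h2, fun g h hgh i hg hh => h3 ?_⟩
    exact A.hasComplexTriangle_of_nb hg hh (h1 _ _ hgh).1 (h1 _ _ hgh).2.2.2 hgh
  · rintro ⟨h1, h2, h3⟩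
    exact ⟨h1, h2, A.not_hasComplexTriangle h1 h3⟩

end Annulus

end FourConn

namespace FourConn

/-! ### Empty triangles over an edge of a plane graph -/

/-- In a half-plane at `q` there is an extreme direction among finitely many points. -/
theorem exists_extreme_direction {ε : ℝ} {p q : Plane} {Q : Set Plane} (hQ : Q.Finite)
    (hne : Q.Nonempty) (hpos : ∀ v ∈ Q, 0 < ori ε p q v) :
    ∃ v ∈ Q, ∀ v' ∈ Q, ori ε q v v' ≤ 0 := by
  obtain ⟨v₀, h₀⟩ := hne
  obtain ⟨v, hv, hmax⟩ := Set.exists_max_image Q (fun v => ori ε q v₀ v / ori ε p q v) hQ ⟨v₀, h₀⟩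
  refine ⟨v, hv, fun v' hv' => ?_⟩
  have h1 := hmax v' hv'
  have p0 := hpos _ h₀
  have p1 := hpos _ hv
  have p2 := hpos _ hv'
  rw [div_le_div_iff₀ p2 p1] at h1
  have e0 : ori ε q v₀ p = ori ε p q v₀ := ori_rot ..
  have e1 : ori ε q p v = - ori ε p q v := ori_swap ..
  have e2 : ori ε q p v' = - ori ε p q v' := ori_swap ..
  have key2 := ori_plucker ε q v₀ p v v'
  rw [e0, e1, e2] at key2
  by_contra hc
  push Not at hc
  have := mul_pos p0 hc
  nlinarith

/-- Transitivity of the angular order in a half-plane. -/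
theorem ori_trans {ε : ℝ} {p q u v w : Plane} (hu : 0 < ori ε p q u) (hv : 0 < ori ε p q v)
    (hw : 0 < ori ε p q w) (h1 : 0 ≤ ori ε q u v) (h2 : 0 < ori ε q v w) : 0 < ori ε q u w := by
  have key := ori_plucker ε q p u v w
  have e1 : ori ε q p u = - ori ε p q u := ori_swap ..
  have e2 : ori ε q p v = - ori ε p q v := ori_swap ..
  have e3 : ori ε q p w = - ori ε p q w := ori_swap ..
  rw [e1, e2, e3] at key
  by_contra hc
  push Not at hc
  have := mul_pos hu h2
  have := mul_nonneg hw.le h1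
  nlinarith

/-- A plane graph with vertices in general position. -/
structure IsPlaneGraph (V : Finset Plane) (E : Set (Sym2 Plane)) : Prop where
  gp : GeneralPosition V
  finite : E.Finite
  mem : ∀ g h, s(g, h) ∈ E → g ∈ V
  ne : ∀ g h, s(g, h) ∈ E → g ≠ h
  noncrossing : ∀ p q g h, s(p, q) ∈ E → s(g, h) ∈ E → s(p, q) ≠ s(g, h) →
    ∀ x ∈ openSegment ℝ p q, x ∉ openSegment ℝ g h

/-- `pq` crosses no edge of `E` (except itself). -/
def Uncrossed (E : Set (Sym2 Plane)) (p q : Plane) : Prop :=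
  ∀ g h, s(g, h) ∈ E → s(p, q) ≠ s(g, h) → ∀ x ∈ openSegment ℝ p q, x ∉ openSegment ℝ g h

/-- The points covered by the edges. -/
def edgeSet (E : Set (Sym2 Plane)) : Set Plane := {x | ∃ p q, s(p, q) ∈ E ∧ x ∈ segment ℝ p q}

namespace IsPlaneGraph

variable {V : Finset Plane} {E : Set (Sym2 Plane)} {ε : ℝ}

theorem mem' (G : IsPlaneGraph V E) {g h : Plane} (hE : s(g, h) ∈ E) : h ∈ V :=
  G.mem h g (by rwa [Sym2.eq_swap])

theorem uncrossed (G : IsPlaneGraph V E) {p q : Plane} (h : s(p, q) ∈ E) : Uncrossed E p q :=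
  fun g h' hg hne => G.noncrossing p q g h' h hg hne

theorem ori_neg_of_exit {v p x e w : Plane} (hx : 0 < ori ε v p x) (hw : w ∈ openSegment ℝ v p)
    (hwe : w ∈ segment ℝ x e) : ori ε v p e ≤ 0 := by
  have h0 := ori_eq_zero_of_mem_openSegment (ε := ε) hw
  obtain ⟨s, t, hs, ht, hst, rfl⟩ := hwe
  rw [ori_comb_two _ _ _ _ _ hst] at h0
  by_contra hc
  push Not at hc
  rcases hs.eq_or_lt with rfl | hs
  · have : t = 1 := by linarith
    subst this
    linarith
  · have := mul_pos hs hx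
    have := mul_nonneg ht hc.le
    linarith

/-- A criterion for the emptiness of a triangle over `pq`. -/
theorem triangle_free (G : IsPlaneGraph V E) {p q u : Plane} (hp : p ∈ V) (hq : q ∈ V)
    (hpq : Uncrossed E p q) (hu : u ∈ V) (hup : 0 < ori ε p q u)
    (h1 : ∀ x ∈ V, x ∉ openTriangle p q u) (h2 : Uncrossed E q u)
    (h3 : ∀ h, s(q, h) ∈ E → 0 < ori ε p q h → ori ε q u h ≤ 0) :
    ∀ x ∈ openTriangle p q u, x ∉ edgeSet E := by
  rintro x hx ⟨g, h, hE, hxs⟩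
  have npq : p ≠ q := by rintro rfl; simp at hup
  have npu : p ≠ u := by rintro rfl; simp at hup
  have nqu : q ≠ u := by rintro rfl; simp at hup
  have o : orient p q u ≠ 0 := G.gp.orient_ne hp hq hu npq npu nqu
  have hg := G.mem _ _ hE
  have hh := G.mem' hE
  have hx' := (mem_openTriangle_iff hup).1 hx
  have hxg : x ≠ g := by rintro rfl; exact h1 _ hg hx
  have hxh : x ≠ h := by rintro rfl; exact h1 _ hh hx
  -- every endpoint different from `q` lies beyond the line `up`
  have key : ∀ e e', s(e', e) ∈ E → x ∈ segment ℝ e' e → x ≠ e → e = q ∨ ori ε u p e ≤ 0 := by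
    intro e e' hE hxs hxe
    have he := G.mem' hE
    have hopen : ∀ y z, Uncrossed E y z → (∀ x ∈ segment ℝ y z, x ∉ openTriangle p q u) →
        ∀ w ∈ openSegment ℝ e' e, w ∉ openSegment ℝ y z := by
      intro y z hyz hno w hw hw'
      by_cases heq : s(y, z) = s(e', e)
      · rcases Sym2.eq_iff.1 heq with ⟨rfl, rfl⟩ | ⟨rfl, rfl⟩
        · exact hno x hxs hx
        · exact hno x (by rwa [segment_symm]) hx
      · exact hyz _ _ hE heq w hw' hw
    rcases G.gp.exit hp hq hu npq npu nqu (G.mem _ _ hE) he (G.ne _ _ hE) hx hxs hxe (h1 e he) with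
      (h | h | h) | ⟨w, hw, hwe, -, h | h | h⟩
    · subst h; simp
    · exact Or.inl h
    · subst h; simp
    · exact absurd h (hopen p q hpq (fun x hx => notMem_openTriangle_of_edge o hx) w hw)
    · refine absurd h (hopen q u h2 (fun x hx => ?_) w hw)
      rw [← openTriangle_rot]
      exact notMem_openTriangle_of_edge (by rwa [orient_rot]) hx
    · exact Or.inr (ori_neg_of_exit hx'.2.2 h hwe)
  -- an edge at `q` cannot enter the triangle
  have hq' : ∀ e, s(q, e) ∈ E → x ∈ segment ℝ q e → False := by
    rintro e hE ⟨s, t, hs, ht, hst, rfl⟩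
    obtain ⟨x1, x2, x3⟩ := hx'
    rw [ori_comb_two _ _ _ _ _ hst] at x1 x2
    simp only [ori_left, ori_right, mul_zero, zero_add] at x1 x2
    have ht' : 0 < t := by
      rcases ht.eq_or_lt with rfl | ht
      · simp at x1
      · exact ht
    have y1 := (pos_iff_pos_of_mul_pos x1).1 ht'
    have y2 := (pos_iff_pos_of_mul_pos x2).1 ht'
    have := h3 e hE y1
    linarith
  rcases key h g hE hxs hxh with rfl | c1
  · exact hq' g (by rwa [Sym2.eq_swap]) (by rwa [segment_symm])
  rcases key g h (by rwa [Sym2.eq_swap]) (by rwa [segment_symm]) hxg with rfl | c2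
  · exact hq' h hE hxs
  obtain ⟨s, t, hs, ht, hst, rfl⟩ := hxs
  have := hx'.2.2
  rw [ori_comb_two _ _ _ _ _ hst] at this
  have := mul_nonpos_of_nonneg_of_nonpos hs c2
  have := mul_nonpos_of_nonneg_of_nonpos ht c1
  linarith

theorem crossing_param (G : IsPlaneGraph V E) {q v g h : Plane} (hq : q ∈ V) (hv : v ∈ V)
    (hqv : q ≠ v) (hE : s(g, h) ∈ E) (hne : s(g, h) ≠ s(q, v)) {t : ℝ}
    (hw : (1 - t) • q + t • v ∈ openSegment ℝ g h) :
    t = orient g h q / (orient g h q - orient g h v) := by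
  have h0 := ori_eq_zero_of_mem_openSegment (ε := 1) hw
  rw [ori_comb_two _ _ _ _ _ (by ring), ori_one, ori_one] at h0
  have hd : orient g h q - orient g h v ≠ 0 := by
    intro hd
    have h1 : orient g h q = 0 := by linear_combination h0 + t * hd
    have h2 : orient g h v = 0 := by linear_combination h1 - hd
    rcases G.gp.orient_ne_or (G.mem _ _ hE) (G.mem' hE) hq hv (G.ne _ _ hE) hqv hne with h | h
    · exact h h1
    · exact h h2
  rw [eq_div_iff hd]
  linear_combination -h0

/-- The first crossing on a segment. -/
theorem exists_first_crossing (G : IsPlaneGraph V E) {q v : Plane} (hq : q ∈ V) (hv : v ∈ V)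
    (hqv : q ≠ v) (hc : ¬ Uncrossed E q v) :
    ∃ g h, s(g, h) ∈ E ∧ s(g, h) ≠ s(q, v) ∧ ∃ w ∈ openSegment ℝ q v, w ∈ openSegment ℝ g h ∧
      ∀ g' h', s(g', h') ∈ E → s(g', h') ≠ s(q, v) → ∀ z ∈ openSegment ℝ q w,
        z ∉ openSegment ℝ g' h' := by
  set S : Set ℝ := {t | 0 < t ∧ t < 1 ∧ ∃ g h, s(g, h) ∈ E ∧ s(g, h) ≠ s(q, v) ∧
    (1 - t) • q + t • v ∈ openSegment ℝ g h} with hS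
  have hfin : S.Finite := by
    refine (G.finite.image (fun e => orient e.out.1 e.out.2 q /
      (orient e.out.1 e.out.2 q - orient e.out.1 e.out.2 v))).subset ?_
    rintro t ⟨-, -, g, h, hE, hne, hw⟩
    refine ⟨s(g, h), hE, ?_⟩
    have hout : s((s(g, h)).out.1, (s(g, h)).out.2) = s(g, h) := Quot.out_eq _
    symm
    apply G.crossing_param hq hv hqv
    · rwa [hout]
    · rwa [hout]
    · rcases Sym2.eq_iff.1 hout with ⟨e1, e2⟩ | ⟨e1, e2⟩
      · rwa [e1, e2]
      · rwa [e1, e2, openSegment_symm]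
  have hne : S.Nonempty := by
    unfold Uncrossed at hc
    push Not at hc
    obtain ⟨g, h, hE, hne, x, ⟨a, b, ha, hb, hab, rfl⟩, hx⟩ := hc
    refine ⟨b, hb, by linarith, g, h, hE, hne.symm, ?_⟩
    rwa [show 1 - b = a by linarith]
  obtain ⟨t, ⟨ht0, ht1, g, h, hE, hgh, hw⟩, hmin⟩ := Set.exists_min_image S id hfin hne
  refine ⟨g, h, hE, hgh, _, ⟨1 - t, t, by linarith, ht0, by ring, rfl⟩, hw, ?_⟩
  rintro g' h' hE' hne' _ ⟨a, b, ha, hb, hab, rfl⟩ hz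
  have hbt : b * t < t := by nlinarith
  have := hmin (b * t) ⟨by positivity, by linarith, g', h', hE', hne', by
    have : a • q + b • ((1 - t) • q + t • v) = (1 - b * t) • q + (b * t) • v := by
      have : a = 1 - b := by linarith
      subst this
      simp only [smul_add, smul_smul, ← add_assoc, ← add_smul]
      congr 2; ring
    rwa [← this]⟩
  simp only [id] at this
  linarith

theorem first_zero {α₀ α₁ β₀ β₁ : ℝ} (h0 : 0 < α₀) (h0' : 0 < β₀) (h : α₁ < 0 ∨ β₁ < 0) :
    ∃ t : ℝ, 0 < t ∧ t < 1 ∧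
      (((1 - t) * α₀ + t * α₁ = 0 ∧ 0 ≤ (1 - t) * β₀ + t * β₁) ∨
        (0 ≤ (1 - t) * α₀ + t * α₁ ∧ (1 - t) * β₀ + t * β₁ = 0)) := by
  have hcont : Continuous (fun t : ℝ => min ((1 - t) * α₀ + t * α₁) ((1 - t) * β₀ + t * β₁)) := by
    fun_prop
  have hm1 : min α₁ β₁ < 0 := min_lt_iff.2 h
  have hm0 : 0 < min α₀ β₀ := lt_min h0 h0'
  obtain ⟨t, ht, he⟩ := intermediate_value_Icc' (zero_le_one' ℝ) hcont.continuousOn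
    ⟨by simpa using h.imp le_of_lt le_of_lt, by simpa using ⟨h0.le, h0'.le⟩⟩
  have ht0 : t ≠ 0 := by
    rintro rfl
    simp only [sub_zero, one_mul, zero_mul, add_zero] at he
    linarith
  have ht1 : t ≠ 1 := by
    rintro rfl
    simp only [sub_self, one_mul, zero_mul, zero_add] at he
    linarith
  refine ⟨t, lt_of_le_of_ne ht.1 ht0.symm, lt_of_le_of_ne ht.2 ht1, ?_⟩
  rcases min_eq_iff.1 he with ⟨h1, h2⟩ | ⟨h1, h2⟩
  · exact Or.inl ⟨h1, by linarith⟩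
  · exact Or.inr ⟨by linarith, h1⟩

/-- Every uncrossed segment `pq` with a vertex on its left carries a triangle with a vertex as apex
that no edge enters. -/
theorem exists_free_triangle (G : IsPlaneGraph V E) (hε : ε ≠ 0) {p q v₀ : Plane} (hp : p ∈ V)
    (hq : q ∈ V) (hpq : Uncrossed E p q) (hv₀ : v₀ ∈ V) (hup₀ : 0 < ori ε p q v₀) :
    ∃ u ∈ V, 0 < ori ε p q u ∧ ∀ x ∈ openTriangle p q u, x ∉ edgeSet E := by
  obtain ⟨v, ⟨hv, hvp⟩, hvmin⟩ := exists_extreme_direction (ε := ε) (p := p) (q := q)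
    (Q := {v | v ∈ V ∧ 0 < ori ε p q v}) (V.finite_toSet.subset fun v hv => hv.1) ⟨v₀, hv₀, hup₀⟩
    fun v hv => hv.2
  have npq : p ≠ q := by rintro rfl; simp at hvp
  have nqv : q ≠ v := by rintro rfl; simp at hvp
  by_cases hc : Uncrossed E q v
  · refine ⟨v, hv, hvp, G.triangle_free hp hq hpq hv hvp ?_ hc ?_⟩
    · intro x hx hxt
      have := (mem_openTriangle_iff hvp).1 hxt
      have := hvmin x ⟨hx, this.1⟩
      linarith
    · intro h hE hh
      exact hvmin h ⟨G.mem' hE, hh⟩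
  obtain ⟨g₀, h₀, hE₀, hne₀, w, hwv, hw₀, hfirst⟩ := G.exists_first_crossing hq hv nqv hc
  -- name the endpoints so that `g` lies on the side of `p`
  obtain ⟨g, g', hE, hne, hw, hgpos, hgneg⟩ : ∃ g g', s(g, g') ∈ E ∧ s(g, g') ≠ s(q, v) ∧
      w ∈ openSegment ℝ g g' ∧ 0 < ori ε q v g ∧ ori ε q v g' < 0 := by
    have h0 : ori ε q v w = 0 := ori_eq_zero_of_mem_openSegment hwv
    obtain ⟨s, t, hs, ht, hst, hw⟩ := id hw₀
    rw [← hw, ori_comb_two _ _ _ _ _ hst] at h0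
    have hne' : ori ε q v g₀ ≠ 0 ∨ ori ε q v h₀ ≠ 0 :=
      (G.gp.orient_ne_or hq hv (G.mem _ _ hE₀) (G.mem' hE₀) nqv (G.ne _ _ hE₀) hne₀.symm).imp
        (mul_ne_zero hε) (mul_ne_zero hε)
    rcases lt_trichotomy (ori ε q v g₀) 0 with h1 | h1 | h1
    · refine ⟨h₀, g₀, by rwa [Sym2.eq_swap], by rwa [Sym2.eq_swap], by rwa [openSegment_symm],
        ?_, h1⟩
      by_contra hc
      push Not at hc
      have := mul_neg_of_pos_of_neg hs h1
      have := mul_nonpos_of_nonneg_of_nonpos ht.le hc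
      linarith
    · rw [h1, mul_zero, zero_add] at h0
      have := (mul_eq_zero.1 h0).resolve_left ht.ne'
      exact absurd (hne'.resolve_left (by simpa using h1)) (by simpa using this)
    · refine ⟨g₀, h₀, hE₀, hne₀, hw₀, h1, ?_⟩
      by_contra hc
      push Not at hc
      have := mul_pos hs h1
      have := mul_nonneg ht.le hc
      linarith
  clear hw₀ hne₀ hE₀
  have hg := G.mem _ _ hE
  have hg' := G.mem' hE
  have hgup : ori ε p q g ≤ 0 := by
    by_contra hcon
    push Not at hcon
    have := hvmin g ⟨hg, hcon⟩
    linarith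
  obtain ⟨τ, hτ0, hτ1, hwτ⟩ : ∃ τ : ℝ, 0 < τ ∧ τ < 1 ∧ w = (1 - τ) • q + τ • v := by
    obtain ⟨s, t, hs, ht, hst, rfl⟩ := hwv
    exact ⟨t, ht, by linarith, by rw [← hst, add_sub_cancel_right]⟩
  have hqw : ∀ x, ori ε q x w = τ * ori ε q x v := by
    intro x
    rw [hwτ, ori_comb_two _ _ _ _ _ (by ring), ori_left]; ring
  have hwup : 0 < ori ε p q w := by
    rw [hwτ, ori_comb_two _ _ _ _ _ (by ring), ori_right]
    have := mul_pos hτ0 hvp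
    linarith
  have hg'up : 0 < ori ε p q g' := by
    obtain ⟨s, t, hs, ht, hst, hww⟩ := hw
    rw [← hww, ori_comb_two _ _ _ _ _ hst] at hwup
    by_contra hcon
    push Not at hcon
    have := mul_nonpos_of_nonneg_of_nonpos hs.le hgup
    have := mul_nonpos_of_nonneg_of_nonpos ht.le hcon
    linarith
  -- `q` lies to the left of `g'w`
  have hq_side : 0 < ori ε g' w q := by
    have h1 : ori ε g' w q = ori ε q g' w := by rw [ori_rot]
    rw [h1, hqw]
    have h2 : ori ε q g' v = - ori ε q v g' := ori_swap' ..
    rw [h2]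
    exact mul_pos hτ0 (by linarith)
  obtain ⟨σ, hσ, hline⟩ : ∃ σ : ℝ, 0 < σ ∧ ∀ x, ori ε g' w x = σ * ori ε g' g x := by
    obtain ⟨s, t, hs, ht, hst, rfl⟩ := hw
    refine ⟨s, hs, fun x => ?_⟩
    have : ∀ y z : Plane, ori ε g' y x = - ori ε g' x y := fun y z => ori_swap' ..
    rw [this _ g', ori_comb_two _ _ _ _ _ hst, ori_left, this g g']
    ring
  have hp_side : 0 ≤ ori ε g' w p := by
    by_contra hcon
    push Not at hcon
    rw [hline] at hcon hq_side
    have c1 : ori ε g' g p < 0 := by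
      by_contra h; push Not at h
      have := mul_nonneg hσ.le h
      linarith
    have c2 : 0 < ori ε g' g q := (pos_iff_pos_of_mul_pos hq_side).1 hσ
    rcases hgup.lt_or_eq with hlt | heq
    · obtain ⟨x, hx, hx'⟩ := openSegment_inter_nonempty (ε := ε) (p := p) (q := q) (g := g)
        (h := g') hlt hg'up (by rw [ori_swap]; linarith) (by rw [ori_swap]; linarith)
      refine hpq g g' hE ?_ x hx hx'
      intro he
      rcases Sym2.eq_iff.1 he with ⟨-, rfl⟩ | ⟨rfl, -⟩ <;> simp at hg'up
    · by_cases e1 : g = p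
      · subst e1; simp at c1
      by_cases e2 : g = q
      · subst e2; simp at hgpos
      exact G.gp.ori_ne hε hp hq hg npq (Ne.symm e1) (Ne.symm e2) heq
  -- the candidates above `w`
  set Q : Set Plane := {u | u ∈ V ∧ 0 < ori ε p q u ∧ 0 ≤ ori ε q g' u ∧ 0 ≤ ori ε g' w u ∧
    0 ≤ ori ε q u w} with hQ
  obtain ⟨u, ⟨hu, hup, hu1, hu2, hu3⟩, humin⟩ := exists_extreme_direction (ε := ε) (p := p)
    (q := q) (Q := Q) (V.finite_toSet.subset fun v hv => hv.1)
    ⟨g', hg', hg'up, by simp, by simp, by rw [← ori_rot]; exact hq_side.le⟩ fun v hv => hv.2.1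
  have nqu : q ≠ u := by rintro rfl; simp at hup
  have hv_side : ori ε g' w v < 0 := by
    have h0 : ori ε g' w w = 0 := ori_right ..
    nth_rewrite 2 [hwτ] at h0
    rw [ori_comb_two _ _ _ _ _ (by ring)] at h0
    by_contra hcon
    push Not at hcon
    have := mul_nonneg hτ0.le hcon
    have := mul_pos (by linarith : 0 < 1 - τ) hq_side
    linarith
  have hu3' : 0 < ori ε q u w := by
    refine lt_of_le_of_ne hu3 fun h0 => ?_
    rw [hqw] at h0
    have h0' := (mul_eq_zero.1 h0.symm).resolve_left hτ0.ne'
    have huv : u ≠ v := by rintro rfl; linarith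
    exact G.gp.ori_ne hε hq hu hv nqu nqv huv h0'
  have hcone : ∀ z, 0 < ori ε q u z → 0 ≤ ori ε q z w → 0 < ori ε p q z := by
    intro z h1 h2
    have key := ori_plucker ε q u w z p
    have e1 : ∀ y, ori ε q y p = ori ε p q y := fun y => ori_rot ..
    have e2 : ori ε q w z = - ori ε q z w := ori_swap' ..
    rw [e1, e1, e1, e2] at key
    by_contra hcon
    push Not at hcon
    have := mul_pos h1 hwup
    have := mul_nonneg hup.le h2
    nlinarith
  have hg'z : ∀ z, 0 < ori ε q u z → 0 < ori ε p q z → 0 < ori ε q g' z :=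
    fun z h1 h2 => ori_trans hg'up hup h2 hu1 h1
  have hself : s(q, v) ≠ s(g, g') := hne.symm
  have hwopen : ∀ z ∈ segment ℝ w g', z ∈ openSegment ℝ g g' ∨ z = g' := by
    intro z hz
    rcases mem_segment_cases hz with rfl | rfl | hz
    · exact Or.inl hw
    · exact Or.inr rfl
    · left
      obtain ⟨s, t, hs, ht, hst, rfl⟩ := hw
      obtain ⟨s', t', hs', ht', hst', rfl⟩ := hz
      refine ⟨s' * s, s' * t + t', by positivity, by positivity, ?_, ?_⟩
      · calc s' * s + (s' * t + t') = s' * (s + t) + t' := by ring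
          _ = 1 := by rw [hst, mul_one, hst']
      · simp only [smul_add, add_smul, smul_smul]; abel
  refine ⟨u, hu, hup, G.triangle_free hp hq hpq hu hup ?_ ?_ ?_⟩
  · intro x hx hxt
    obtain ⟨x1, x2, x3⟩ := (mem_openTriangle_iff hup).1 hxt
    have hxw : 0 ≤ ori ε q x w := by
      rw [hqw]
      have := hvmin x ⟨hx, x1⟩
      rw [ori_swap'] at this
      exact mul_nonneg hτ0.le (by linarith)
    have hxf : 0 ≤ ori ε g' w x := by
      obtain ⟨α, β, γ, hα, hβ, hγ, hs, rfl⟩ := hxt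
      rw [ori_comb _ _ _ _ _ _ hs]
      have := mul_nonneg hα.le hp_side
      have := mul_pos hβ hq_side
      have := mul_nonneg hγ.le hu2
      linarith
    have := humin x ⟨hx, x1, (hg'z x x2 x1).le, hxf, hxw⟩
    linarith
  · -- no edge crosses `qu`
    have main : ∀ e e', s(e', e) ∈ E → s(q, u) ≠ s(e', e) → 0 < ori ε q u e →
        ∀ y ∈ openSegment ℝ q u, y ∉ openSegment ℝ e' e := by
      intro e e' hE' hne' hpos y hy hy'
      have he := G.mem' hE'
      obtain ⟨s, t, hs, ht, hst, hyy⟩ := id hy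
      have ya : 0 < ori ε q y w := by
        rw [← ori_rot', ← hyy, ori_comb_two _ _ _ _ _ hst]
        have : ori ε w q u = ori ε q u w := ori_rot' ..
        simp only [ori_right, mul_zero, zero_add, this]
        positivity
      have yb : 0 < ori ε g' w y := by
        rw [← hyy, ori_comb_two _ _ _ _ _ hst]
        have := mul_pos hs hq_side
        have := mul_nonneg ht.le hu2
        linarith
      have hbad : ori ε q e w < 0 ∨ ori ε g' w e < 0 := by
        by_contra hcon
        push Not at hcon
        have h1 := hcone e hpos hcon.1
        have := humin e ⟨he, h1, (hg'z e hpos h1).le, hcon.2, hcon.1⟩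
        linarith
      obtain ⟨r, hr0, hr1, hz⟩ := first_zero ya yb hbad
      set z := (1 - r) • y + r • e with hzdef
      have hza : ori ε q z w = (1 - r) * ori ε q y w + r * ori ε q e w := by
        rw [← ori_rot', hzdef, ori_comb_two _ _ _ _ _ (by ring), ori_rot' ε q y w,
          ori_rot' ε q e w]
      have hzb : ori ε g' w z = (1 - r) * ori ε g' w y + r * ori ε g' w e := by
        rw [hzdef, ori_comb_two _ _ _ _ _ (by ring)]
      rw [← hza, ← hzb] at hz
      have hzu : 0 < ori ε q u z := by
        rw [hzdef, ori_comb_two _ _ _ _ _ (by ring), ori_eq_zero_of_mem_openSegment hy, mul_zero,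
          zero_add]
        positivity
      have hzE : z ∈ openSegment ℝ e' e := by
        obtain ⟨s', t', hs', ht', hst', rfl⟩ := hy'
        refine ⟨(1 - r) * s', (1 - r) * t' + r, mul_pos (by linarith) hs',
          by have := mul_pos (by linarith : 0 < 1 - r) ht'; linarith, ?_, ?_⟩
        · calc (1 - r) * s' + ((1 - r) * t' + r) = (1 - r) * (s' + t') + r := by ring
            _ = 1 := by rw [hst']; ring
        · rw [hzdef]; simp only [smul_add, add_smul, smul_smul]; abel
      have hzw : 0 ≤ ori ε q z w := by rcases hz with hz | hz <;> linarith [hz.1]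
      have hzf : 0 ≤ ori ε g' w z := by rcases hz with hz | hz <;> linarith [hz.2]
      have hzup := hcone z hzu hzw
      have hzg' := hg'z z hzu hzup
      have hzV : ∀ x ∈ V, z ≠ x := by
        rintro x hx rfl
        exact G.gp.notMem_openSegment (G.mem _ _ hE') he hx (G.ne _ _ hE') hzE
      -- crossing `gg'` is impossible
      have cross : z ∉ openSegment ℝ g g' := by
        intro hzg
        by_cases heq : s(g, g') = s(e', e)
        · have hyg : y ∈ openSegment ℝ g g' := by
            rcases Sym2.eq_iff.1 heq with ⟨rfl, rfl⟩ | ⟨rfl, rfl⟩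
            · exact hy'
            · rwa [openSegment_symm]
          have := ori_eq_zero_of_mem_openSegment (ε := ε) hyg
          rw [hline, ori_swap, this] at yb
          simp at yb
        · exact G.noncrossing _ _ _ _ hE hE' heq z hzg hzE
      rcases hz with ⟨hz, -⟩ | ⟨-, hz⟩
      · have hzs : z ∈ segment ℝ w q :=
          mem_segment_of_ori_eq_zero (ε := ε) (r := g') (by rwa [ori_rot])
            (by rw [← ori_rot, hz]) hzg'.le hzf
        rcases mem_segment_cases hzs with h | h | h
        · exact cross (h ▸ hw)
        · exact hzV q hq h
        · rw [openSegment_symm] at h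
          refine hfirst e' e hE' ?_ z h hzE
          intro heq
          have : y ∈ openSegment ℝ q v := by
            rcases Sym2.eq_iff.1 heq with ⟨rfl, rfl⟩ | ⟨rfl, rfl⟩
            · exact hy'
            · rwa [openSegment_symm]
          have := ori_eq_zero_of_mem_openSegment (ε := ε) this
          rw [hqw, ori_swap', this] at ya
          simp at ya
      · have hzs : z ∈ segment ℝ g' w :=
          mem_segment_of_ori_eq_zero (ε := ε) (r := q) hq_side hz
            (by rw [ori_rot']; exact hzw) hzg'.le
        rw [segment_symm] at hzs
        rcases hwopen z hzs with h | h
        · exact cross h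
        · exact hzV g' hg' h
    intro g₁ h₁ hE₁ hne₁ y hy hy₁
    have h0 : ori ε q u y = 0 := ori_eq_zero_of_mem_openSegment hy
    obtain ⟨s, t, hs, ht, hst, hyy⟩ := id hy₁
    rw [← hyy, ori_comb_two _ _ _ _ _ hst] at h0
    have hne' : ori ε q u g₁ ≠ 0 ∨ ori ε q u h₁ ≠ 0 :=
      (G.gp.orient_ne_or hq hu (G.mem _ _ hE₁) (G.mem' hE₁) nqu (G.ne _ _ hE₁) hne₁).imp
        (mul_ne_zero hε) (mul_ne_zero hε)
    by_cases hpos : 0 < ori ε q u h₁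
    · exact main h₁ g₁ hE₁ hne₁ hpos y hy hy₁
    · refine main g₁ h₁ (by rwa [Sym2.eq_swap]) (by rwa [Sym2.eq_swap (a := h₁)]) ?_ y hy
        (by rwa [openSegment_symm])
      by_contra hcon
      push Not at hpos hcon
      have c1 := mul_nonpos_of_nonneg_of_nonpos hs.le hcon
      have c2 := mul_nonpos_of_nonneg_of_nonpos ht.le hpos
      rcases hne' with h | h
      · exact h ((mul_eq_zero.1 (by linarith : s * ori ε q u g₁ = 0)).resolve_left hs.ne')
      · exact h ((mul_eq_zero.1 (by linarith : t * ori ε q u h₁ = 0)).resolve_left ht.ne')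
  · -- edges at `q`
    intro h hEh hh
    by_contra hcon
    push Not at hcon
    have hhV := G.mem' hEh
    have hhv : h ≠ v := by
      rintro rfl
      exact G.noncrossing q h g g' hEh hE hself w hwv hw
    have hhw : 0 < ori ε q h w := by
      rw [hqw]
      have h1 := hvmin h ⟨hhV, hh⟩
      have h2 := G.gp.ori_ne hε hq hv hhV nqv (G.ne _ _ hEh) hhv.symm
      have h3 := lt_of_le_of_ne h1 h2
      rw [ori_swap'] at h3
      exact mul_pos hτ0 (by linarith)
    have hg'h := hg'z h hcon hh
    have hf : ori ε g' w h < 0 := by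
      by_contra hc
      push Not at hc
      have := humin h ⟨hhV, hh, hg'h.le, hc, hhw.le⟩
      linarith
    obtain ⟨x, hx, hx'⟩ := openSegment_inter_nonempty (ε := ε) (p := g') (q := w) (g := h) (h := q)
      hf hq_side (by rw [ori_rot']; exact hg'h) (by rw [ori_swap]; linarith)
    rw [openSegment_symm] at hx hx'
    refine G.noncrossing q h g g' hEh hE ?_ x hx' ?_
    · intro he
      rcases Sym2.eq_iff.1 he with ⟨e1, -⟩ | ⟨e1, -⟩
      · rw [hline, e1] at hq_side; simp at hq_side
      · rw [e1] at hq_side; simp at hq_side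
    · rcases hwopen x (openSegment_subset_segment _ _ _ hx) with h | h
      · exact h
      · subst h
        exact absurd hg' fun hV => G.gp.notMem_openSegment hq hhV hV (G.ne _ _ hEh) hx'

end IsPlaneGraph

end FourConn

namespace FourConn

/-! ### Flips -/

theorem ori_nonneg_of_mem_hull {ε : ℝ} {u v p q r x : Plane} (hp : 0 ≤ ori ε u v p)
    (hq : 0 ≤ ori ε u v q) (hr : 0 ≤ ori ε u v r) (hx : x ∈ convexHull ℝ {p, q, r}) :
    0 ≤ ori ε u v x := by
  rw [convexHull_triple] at hx
  obtain ⟨α, β, γ, hα, hβ, hγ, hs, rfl⟩ := hx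
  rw [ori_comb _ _ _ _ _ _ hs]
  positivity

/-- The two ways to cut a convex quadrilateral into triangles. -/
theorem quad_cut {ε : ℝ} {A B b p x : Plane} (h1 : 0 < ori ε A B p) (h2 : 0 < ori ε A B b)
    (h3 : 0 < ori ε p B b) (h4 : 0 < ori ε p A b) :
    (x ∈ convexHull ℝ {A, B, p} ∨ x ∈ convexHull ℝ {p, B, b}) ↔
      (x ∈ convexHull ℝ {A, B, b} ∨ x ∈ convexHull ℝ {p, A, b}) := by
  have e1 : ori ε B b A = ori ε A B b := ori_rot ..
  have e2 : ori ε B b p = ori ε p B b := ori_rot ..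
  have e3 : ori ε b p A = ori ε p A b := ori_rot' ..
  have e4 : ori ε b p B = ori ε p B b := ori_rot' ..
  have e5 : ori ε p A B = ori ε A B p := ori_rot' ..
  constructor
  · intro hx
    have q1 : 0 ≤ ori ε A B x := by
      rcases hx with hx | hx
      · exact ori_nonneg_of_mem_hull (by simp) (by simp) h1.le hx
      · exact ori_nonneg_of_mem_hull h1.le (by simp) h2.le hx
    have q2 : 0 ≤ ori ε B b x := by
      rcases hx with hx | hx
      · exact ori_nonneg_of_mem_hull (by linarith) (by simp) (by linarith) hx
      · exact ori_nonneg_of_mem_hull (by linarith) (by simp) (by simp) hx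
    have q3 : 0 ≤ ori ε b p x := by
      rcases hx with hx | hx
      · exact ori_nonneg_of_mem_hull (by linarith) (by linarith) (by simp) hx
      · exact ori_nonneg_of_mem_hull (by simp) (by linarith) (by simp) hx
    have q4 : 0 ≤ ori ε p A x := by
      rcases hx with hx | hx
      · exact ori_nonneg_of_mem_hull (by simp) (by linarith) (by simp) hx
      · exact ori_nonneg_of_mem_hull (by simp) (by linarith) h4.le hx
    rcases le_total 0 (ori ε b A x) with h | h
    · exact Or.inl ((mem_convexHull_iff h2).2 ⟨q1, q2, h⟩)
    · exact Or.inr ((mem_convexHull_iff h4).2 ⟨q4, by rw [ori_swap]; linarith, q3⟩)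
  · intro hx
    have q1 : 0 ≤ ori ε A B x := by
      rcases hx with hx | hx
      · exact ori_nonneg_of_mem_hull (by simp) (by simp) h2.le hx
      · exact ori_nonneg_of_mem_hull h1.le (by simp) h2.le hx
    have q2 : 0 ≤ ori ε B b x := by
      rcases hx with hx | hx
      · exact ori_nonneg_of_mem_hull (by linarith) (by simp) (by simp) hx
      · exact ori_nonneg_of_mem_hull (by linarith) (by linarith) (by simp) hx
    have q3 : 0 ≤ ori ε b p x := by
      rcases hx with hx | hx
      · exact ori_nonneg_of_mem_hull (by linarith) (by linarith) (by simp) hx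
      · exact ori_nonneg_of_mem_hull (by simp) (by linarith) (by simp) hx
    have q4 : 0 ≤ ori ε p A x := by
      rcases hx with hx | hx
      · exact ori_nonneg_of_mem_hull (by simp) (by linarith) h4.le hx
      · exact ori_nonneg_of_mem_hull (by simp) (by simp) h4.le hx
    rcases le_total 0 (ori ε B p x) with h | h
    · exact Or.inl ((mem_convexHull_iff h1).2 ⟨q1, h, q4⟩)
    · exact Or.inr ((mem_convexHull_iff h3).2 ⟨by rw [ori_swap]; linarith, q2, q3⟩)

/-- Moving the inward vertex of the `i`-th hull edge by one. -/
def flipIndex (k i : ℤ) (f : ℤ → ℤ) (j : ℤ) : ℤ := if k ∣ j - i then f j + 1 else f j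

namespace Frame

variable {P : Finset Plane} {ε : ℝ} {k n : ℤ} {c a : ℤ → Plane} {f : ℤ → ℤ}

theorem flipIndex_of_dvd {i j : ℤ} (h : k ∣ j - i) : flipIndex k i f j = f j + 1 := if_pos h

theorem flipIndex_of_not_dvd {i j : ℤ} (h : ¬ k ∣ j - i) : flipIndex k i f j = f j := if_neg h

theorem not_dvd_succ (F : Frame P ε k n c a f) {i j : ℤ} (h : k ∣ j - i) : ¬ k ∣ j + 1 - i := by
  intro h'
  have := dvd_sub h' h
  rw [show j + 1 - i - (j - i) = 1 by ring] at this
  have := Int.le_of_dvd one_pos this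
  have := F.three_le
  omega

theorem not_dvd_of_succ (F : Frame P ε k n c a f) {i j : ℤ} (h : k ∣ j + 1 - i) : ¬ k ∣ j - i :=
  fun h' => F.not_dvd_succ h' h

/-- Indices over the same window modulo `k` differ by a period. -/
theorem eq_add_of_dvd (F : Frame P ε k n c a f) {i j : ℤ} (h : k ∣ j - i) :
    ∃ q, j = i + k * q ∧ f j = f i + n * q ∧ ∀ d, a (f j + d) = a (f i + d) := by
  obtain ⟨q, hq⟩ := h
  have hj : j = i + k * q := by omega
  refine ⟨q, hj, by rw [hj, F.f_mul], fun d => ?_⟩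
  rw [hj, F.f_mul, F.a_iff]
  exact ⟨q, by ring⟩

theorem flip (F : Frame P ε k n c a f) {i : ℤ} (hi : f i + 1 < f (i + 1))
    (hconv : 0 < ori ε (a (f i)) (c (i - 1)) (a (f i + 1))) :
    Frame P ε k n c a (flipIndex k i f) where
  gp := F.gp
  eps := F.eps
  three_le := F.three_le
  c_iff := F.c_iff
  a_iff := F.a_iff
  f_lt j := by
    by_cases h : k ∣ j - i
    · rw [flipIndex_of_dvd h, flipIndex_of_not_dvd (F.not_dvd_succ h)]
      obtain ⟨q, rfl, h1, -⟩ := F.eq_add_of_dvd h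
      rw [h1, show i + k * q + 1 = i + 1 + k * q by ring, F.f_mul]; omega
    · rw [flipIndex_of_not_dvd h]
      by_cases h' : k ∣ j + 1 - i
      · rw [flipIndex_of_dvd h']; have := F.f_lt j; omega
      · rw [flipIndex_of_not_dvd h']; exact F.f_lt j
  f_per j := by
    have e : (k ∣ j + k - i) ↔ k ∣ j - i := by
      rw [show j + k - i = j - i + k by ring]; exact dvd_add_self_right
    by_cases h : k ∣ j - i
    · rw [flipIndex_of_dvd h, flipIndex_of_dvd (e.2 h), F.f_per]; ring
    · rw [flipIndex_of_not_dvd h, flipIndex_of_not_dvd (e.not.2 h), F.f_per]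
  c_mem := F.c_mem
  a_mem := F.a_mem
  c_ne_a := F.c_ne_a
  cover := F.cover
  hull := F.hull
  fan j m h1 h2 := by
    by_cases h : k ∣ j - i
    · rw [flipIndex_of_dvd h] at h1
      rw [flipIndex_of_not_dvd (F.not_dvd_succ h)] at h2
      exact F.fan j m (by omega) h2
    · rw [flipIndex_of_not_dvd h] at h1
      by_cases h' : k ∣ j + 1 - i
      · rw [flipIndex_of_dvd h'] at h2
        rcases lt_or_ge m (f (j + 1)) with h3 | h3
        · exact F.fan j m h1 h3
        · have hm : m = f (j + 1) := by omega
          obtain ⟨q, hq, -, ha⟩ := F.eq_add_of_dvd h'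
          have hc : c j = c (i - 1) := (F.c_iff _ _).2 (by
            rw [show j - (i - 1) = j + 1 - i by ring]; exact h')
          have ha0 := ha 0
          rw [add_zero, add_zero] at ha0
          rw [hm, hc, ha0, ha 1]
          exact hconv
      · rw [flipIndex_of_not_dvd h'] at h2
        exact F.fan j m h1 h2

theorem isTile_subset (F : Frame P ε k n c a f) {t : Finset Plane} (h : IsTile c a f t) :
    t ⊆ P := by
  rcases h with ⟨i, rfl⟩ | ⟨i, m, -, -, rfl⟩ <;> intro x hx <;>
    simp only [Finset.mem_insert, Finset.mem_singleton] at hx <;>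
    rcases hx with rfl | rfl | rfl <;> first | exact F.c_mem _ | exact F.a_mem _

theorem isTile_card (F : Frame P ε k n c a f) {t : Finset Plane} (h : IsTile c a f t) :
    t.card = 3 := by
  classical
  rcases h with ⟨i, rfl⟩ | ⟨i, m, -, -, rfl⟩
  · exact Finset.card_eq_three.2 ⟨_, _, _, F.c_ne_pred i, F.c_ne_a _ _, F.c_ne_a _ _, by congr!⟩
  · exact Finset.card_eq_three.2 ⟨_, _, _, (F.c_ne_a _ _).symm, F.a_ne_succ m, F.c_ne_a _ _,
      by congr!⟩

theorem nb_flip (F : Frame P ε k n c a f) {i j : ℤ} {x : Plane}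
    (h : Nb a (flipIndex k i f) x j) :
    Nb a f x j ∨ (c j = c (i - 1) ∧ x = a (f i + 1)) := by
  obtain ⟨m, h1, h2, rfl⟩ := h
  have h1' : f j ≤ m := by
    by_cases h : k ∣ j - i
    · rw [flipIndex_of_dvd h] at h1; omega
    · rwa [flipIndex_of_not_dvd h] at h1
  by_cases h' : k ∣ j + 1 - i
  · rw [flipIndex_of_dvd h'] at h2
    rcases h2.lt_or_eq with h3 | h3
    · exact Or.inl ⟨m, h1', by omega, rfl⟩
    · right
      refine ⟨(F.c_iff _ _).2 (by rw [show j - (i - 1) = j + 1 - i by ring]; exact h'), ?_⟩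
      obtain ⟨q, -, -, ha⟩ := F.eq_add_of_dvd h'
      rw [h3, ha 1]
  · rw [flipIndex_of_not_dvd h'] at h2
    exact Or.inl ⟨m, h1', h2, rfl⟩

theorem nb_flip_self (F : Frame P ε k n c a f) {i j : ℤ}
    (h : Nb a (flipIndex k i f) (a (f i)) j) : c j = c (i - 1) := by
  rcases F.nb_flip h with h' | h'
  swap
  · exact h'.1
  rcases F.nb_cases (le_refl (f i)) (F.f_lt i).le h' with h1 | ⟨h1, -⟩ | ⟨-, h1⟩
  · exfalso
    have hd := (F.c_iff _ _).1 h1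
    obtain ⟨m, h2, h3, h4⟩ := h
    rw [flipIndex_of_dvd hd] at h2
    rw [flipIndex_of_not_dvd (F.not_dvd_succ hd)] at h3
    obtain ⟨q, rfl, hf, ha⟩ := F.eq_add_of_dvd hd
    have := ha 0
    rw [add_zero, add_zero] at this
    rw [← this] at h4
    have hw := F.width (i + k * q)
    exact F.a_ne (by omega) (by omega) h4
  · have := F.f_lt i
    omega
  · exact h1

theorem isTile_flip (F : Frame P ε k n c a f) {i : ℤ} [DecidableEq Plane] {t : Finset Plane}
    (h : IsTile c a (flipIndex k i f) t) :
    t = {c (i - 1), c i, a (f i + 1)} ∨ t = {a (f i), c (i - 1), a (f i + 1)} ∨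
      (IsTile c a f t ∧ t ≠ {c (i - 1), c i, a (f i)} ∧ t ≠ {a (f i), c i, a (f i + 1)}) := by
  rcases h with ⟨j, rfl⟩ | ⟨j, m, h1, h2, rfl⟩
  · by_cases h : k ∣ j - i
    · left
      rw [flipIndex_of_dvd h]
      obtain ⟨q, -, -, ha⟩ := F.eq_add_of_dvd h
      rw [ha 1, (F.c_iff j i).2 h, (F.c_iff (j - 1) (i - 1)).2 (by
        rwa [show j - 1 - (i - 1) = j - i by ring])]
      congr!
    · right; right
      rw [flipIndex_of_not_dvd h]
      refine ⟨Or.inl ⟨j, rfl⟩, ?_, ?_⟩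
      · intro he
        have : a (f j) ∈ ({c (i - 1), c i, a (f i)} : Finset Plane) := by rw [← he]; simp
        simp only [Finset.mem_insert, Finset.mem_singleton, (F.c_ne_a _ _).symm, false_or] at this
        obtain ⟨q, hq⟩ := (F.a_iff _ _).1 this
        have : f j = f (i + k * q) := by rw [F.f_mul]; omega
        have := F.f_mono.injective this
        exact h ⟨q, by omega⟩
      · intro he
        have e1 : c j ∈ ({a (f i), c i, a (f i + 1)} : Finset Plane) := by rw [← he]; simp
        have e2 : c (j - 1) ∈ ({a (f i), c i, a (f i + 1)} : Finset Plane) := by rw [← he]; simp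
        simp only [Finset.mem_insert, Finset.mem_singleton, F.c_ne_a, or_false, false_or] at e1 e2
        exact F.c_ne_pred j (e2.trans e1.symm)
  · by_cases h' : k ∣ j + 1 - i ∧ m = f (j + 1)
    · right; left
      obtain ⟨h', rfl⟩ := h'
      obtain ⟨q, -, -, ha⟩ := F.eq_add_of_dvd h'
      have ha0 := ha 0
      rw [add_zero, add_zero] at ha0
      rw [ha0, ha 1, (F.c_iff j (i - 1)).2 (by rwa [show j - (i - 1) = j + 1 - i by ring])]
      congr!
    · right; right
      have h1' : f j ≤ m ∧ (k ∣ j - i → f j + 1 ≤ m) := by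
        by_cases h : k ∣ j - i
        · rw [flipIndex_of_dvd h] at h1; exact ⟨by omega, fun _ => h1⟩
        · rw [flipIndex_of_not_dvd h] at h1; exact ⟨h1, fun h'' => absurd h'' h⟩
      have h2' : m < f (j + 1) := by
        by_cases h : k ∣ j + 1 - i
        · rw [flipIndex_of_dvd h] at h2
          by_contra hm
          exact h' ⟨h, by omega⟩
        · rwa [flipIndex_of_not_dvd h] at h2
      refine ⟨Or.inr ⟨j, m, h1'.1, h2', rfl⟩, ?_, ?_⟩
      · intro he
        have e1 : a m ∈ ({c (i - 1), c i, a (f i)} : Finset Plane) := by rw [← he]; simp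
        have e2 : a (m + 1) ∈ ({c (i - 1), c i, a (f i)} : Finset Plane) := by rw [← he]; simp
        simp only [Finset.mem_insert, Finset.mem_singleton, (F.c_ne_a _ _).symm, false_or] at e1 e2
        exact F.a_ne_succ m (e1.trans e2.symm)
      · intro he
        have e0 : c j ∈ ({a (f i), c i, a (f i + 1)} : Finset Plane) := by rw [← he]; simp
        have e1 : a m ∈ ({a (f i), c i, a (f i + 1)} : Finset Plane) := by rw [← he]; simp
        have e2 : a (m + 1) ∈ ({a (f i), c i, a (f i + 1)} : Finset Plane) := by rw [← he]; simp
        simp only [Finset.mem_insert, Finset.mem_singleton, (F.c_ne_a _ _).symm, F.c_ne_a,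
          or_false, false_or] at e0 e1 e2
        have hd := (F.c_iff _ _).1 e0
        have h3 := h1'.2 hd
        have hw := F.width j
        obtain ⟨q, -, -, ha⟩ := F.eq_add_of_dvd hd
        have ha0 := ha 0
        rw [add_zero, add_zero] at ha0
        rw [← ha0, ← ha 1] at e1 e2
        rcases e1 with e1 | e1
        · exact F.a_ne (by omega) (by omega) e1.symm
        · rcases e2 with e2 | e2
          · exact F.a_ne (l := f j) (m := m + 1) (by omega) (by omega) e2.symm
          · exact F.a_ne_succ m (e1.trans e2.symm)

theorem isTile_unflip (F : Frame P ε k n c a f) {i : ℤ} [DecidableEq Plane]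
    {t : Finset Plane} (h : IsTile c a f t) :
    t = {c (i - 1), c i, a (f i)} ∨ t = {a (f i), c i, a (f i + 1)} ∨
      IsTile c a (flipIndex k i f) t := by
  rcases h with ⟨j, rfl⟩ | ⟨j, m, h1, h2, rfl⟩
  · by_cases h : k ∣ j - i
    · left
      obtain ⟨q, -, -, ha⟩ := F.eq_add_of_dvd h
      have ha0 := ha 0
      rw [add_zero, add_zero] at ha0
      rw [ha0, (F.c_iff j i).2 h, (F.c_iff (j - 1) (i - 1)).2 (by
        rwa [show j - 1 - (i - 1) = j - i by ring])]
      congr!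
    · exact Or.inr (Or.inr (Or.inl ⟨j, by rw [flipIndex_of_not_dvd h]⟩))
  · by_cases h : k ∣ j - i ∧ m = f j
    · right; left
      obtain ⟨h, rfl⟩ := h
      obtain ⟨q, -, -, ha⟩ := F.eq_add_of_dvd h
      have ha0 := ha 0
      rw [add_zero, add_zero] at ha0
      rw [ha0, ha 1, (F.c_iff j i).2 h]
      congr!
    · refine Or.inr (Or.inr (Or.inr ⟨j, m, ?_, ?_, rfl⟩))
      · by_cases h' : k ∣ j - i
        · rw [flipIndex_of_dvd h']
          by_contra hm
          exact h ⟨h', by omega⟩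
        · rwa [flipIndex_of_not_dvd h']
      · by_cases h' : k ∣ j + 1 - i
        · rw [flipIndex_of_dvd h']; omega
        · rwa [flipIndex_of_not_dvd h']

end Frame

open Classical in
/-- The set of all triangles of a frame. -/
noncomputable def tiles (P : Finset Plane) (c a : ℤ → Plane) (f : ℤ → ℤ) : Finset (Finset Plane) :=
  P.powerset.filter (IsTile c a f)

theorem Frame.mem_tiles {P : Finset Plane} {ε : ℝ} {k n : ℤ} {c a : ℤ → Plane} {f : ℤ → ℤ}
    (F : Frame P ε k n c a f) {t : Finset Plane} : t ∈ tiles P c a f ↔ IsTile c a f t := by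
  simp only [tiles, Finset.mem_filter, Finset.mem_powerset, and_iff_right_iff_imp]
  exact F.isTile_subset

theorem interior_tile {P : Finset Plane} (hP : GeneralPosition P) [DecidableEq Plane]
    {p q r : Plane} (hp : p ∈ P) (hq : q ∈ P) (hr : r ∈ P) (h1 : p ≠ q) (h2 : p ≠ r) (h3 : q ≠ r) :
    interior (convexHull ℝ (({p, q, r} : Finset Plane) : Set Plane)) = openTriangle p q r := by
  rw [coe_triple, interior_convexHull_triple (hP.orient_ne hp hq hr h1 h2 h3)]

namespace Annulus

variable {P : Finset Plane} {C : List Plane} {T : Finset (Finset Plane)} {ε : ℝ} {k n : ℤ}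
  {c a : ℤ → Plane} {f : ℤ → ℤ}

/-- A point in the interior of a triangle lies in no other closed triangle. -/
theorem eq_of_mem_interior (A : Annulus P C T ε k n c a f) {t t' : Finset Plane} (ht : t ∈ T)
    (ht' : t' ∈ T) {x : Plane} (hx : x ∈ interior (convexHull ℝ (t : Set Plane)))
    (hx' : x ∈ convexHull ℝ (t' : Set Plane)) : t = t' := by
  classical
  by_contra hne
  obtain ⟨p, q, r, h1, h2, h3, rfl⟩ := Finset.card_eq_three.1 (A.tri.card_eq t' ht')
  have hs := A.tri.subset _ ht'
  have hd := A.tri.disjoint _ ht _ ht' hne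
  rw [interior_tile A.gp (hs (by simp)) (hs (by simp)) (hs (by simp)) h1 h2 h3] at hd
  rw [coe_triple, ← closure_openTriangle] at hx'
  obtain ⟨z, hz1, hz2⟩ := mem_closure_iff.1 hx' _ isOpen_interior hx
  exact Set.disjoint_left.1 hd hz1 hz2

/-- Exchanging the diagonal of the quadrilateral formed by the triangle on a hull edge and the next
triangle. -/
theorem flip (A : Annulus P C T ε k n c a f) {i : ℤ} (hi : f i + 1 < f (i + 1))
    (hconv : 0 < ori ε (a (f i)) (c (i - 1)) (a (f i + 1))) :
    Annulus P C (tiles P c a (flipIndex k i f)) ε k n c a (flipIndex k i f) := by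
  classical
  have F := A.toFrame
  have F' := F.flip hi hconv
  have hN : ({c (i - 1), c i, a (f i)} : Finset Plane) ∈ T := by
    simpa using A.hull_tile (i - 1)
  have hΔ : ({a (f i), c i, a (f i + 1)} : Finset Plane) ∈ T := A.fan_tile le_rfl (F.f_lt i)
  have o1 : 0 < ori ε (c (i - 1)) (c i) (a (f i)) := F.hull_a' i _
  have o2 : 0 < ori ε (c (i - 1)) (c i) (a (f i + 1)) := F.hull_a' i _
  have o3 := F.fan i (f i) le_rfl (F.f_lt i)
  have hN' : IsTile c a (flipIndex k i f) {c (i - 1), c i, a (f i + 1)} := by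
    refine Or.inl ⟨i, ?_⟩
    rw [Frame.flipIndex_of_dvd (by simp)]
  have hΔ' : IsTile c a (flipIndex k i f) {a (f i), c (i - 1), a (f i + 1)} := by
    refine Or.inr ⟨i - 1, f i, ?_, ?_, by congr!⟩
    · rw [Frame.flipIndex_of_not_dvd (F.not_dvd_of_succ (by simp))]
      exact F.f_mono.monotone (by omega)
    · rw [sub_add_cancel, Frame.flipIndex_of_dvd (by simp)]; omega
  have npb : a (f i) ≠ a (f i + 1) := F.a_ne_succ _
  have iN' := interior_tile F.gp (F.c_mem (i - 1)) (F.c_mem i) (F.a_mem (f i + 1)) (F.c_ne_pred i)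
    (F.c_ne_a _ _) (F.c_ne_a _ _)
  have iΔ' := interior_tile F.gp (F.a_mem (f i)) (F.c_mem (i - 1)) (F.a_mem (f i + 1))
    (F.c_ne_a _ _).symm npb (F.c_ne_a _ _)
  -- the interior of a new triangle meets no old one
  have hnew : ∀ t' ∈ T, t' ≠ {c (i - 1), c i, a (f i)} → t' ≠ {a (f i), c i, a (f i + 1)} →
      ∀ x ∈ interior (convexHull ℝ (t' : Set Plane)),
        ¬ (x ∈ convexHull ℝ {c (i - 1), c i, a (f i + 1)} ∨
          x ∈ convexHull ℝ {a (f i), c (i - 1), a (f i + 1)}) := by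
    intro t' ht' n1 n2 x hx hx'
    rcases (quad_cut o1 o2 o3 hconv).2 hx' with h | h
    · exact n1 (A.eq_of_mem_interior ht' hN hx (by rwa [coe_triple]))
    · exact n2 (A.eq_of_mem_interior ht' hΔ hx (by rwa [coe_triple]))
  have hNΔ : Disjoint (openTriangle (c (i - 1)) (c i) (a (f i + 1)))
      (openTriangle (a (f i)) (c (i - 1)) (a (f i + 1))) := by
    rw [Set.disjoint_left]
    intro x h1 h2
    have h3 := ((mem_openTriangle_iff o2).1 h1).2.2
    have h4 := ((mem_openTriangle_iff hconv).1 h2).2.1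
    rw [ori_swap] at h3
    linarith
  refine { toFrame := F', simple := A.simple, mem_T := fun t => F'.mem_tiles, tri := ?_,
           edge_iff := A.edge_iff, vert := A.vert, rot := A.rot }
  refine ⟨fun t ht => F'.isTile_subset (F'.mem_tiles.1 ht),
    fun t ht => F'.isTile_card (F'.mem_tiles.1 ht), ?_, ?_, ?_⟩
  · intro t ht x hx hxt
    rcases F.isTile_flip (F'.mem_tiles.1 ht) with rfl | rfl | ⟨h, -, -⟩
    · rw [coe_triple] at hxt
      have hp : x ≠ a (f i) := by
        rintro rfl
        have := ((mem_convexHull_iff o2).1 hxt).2.2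
        rw [ori_rev] at this
        linarith
      rcases (quad_cut o1 o2 o3 hconv).2 (Or.inl hxt) with h | h
      · have := A.tri.empty _ hN x hx (by rwa [coe_triple])
        simp only [Finset.mem_insert, Finset.mem_singleton] at this ⊢
        tauto
      · have := A.tri.empty _ hΔ x hx (by rwa [coe_triple])
        simp only [Finset.mem_insert, Finset.mem_singleton] at this ⊢
        tauto
    · rw [coe_triple] at hxt
      have hp : x ≠ c i := by
        rintro rfl
        have := ((mem_convexHull_iff hconv).1 hxt).2.1
        rw [ori_swap'] at this
        linarith
      rcases (quad_cut o1 o2 o3 hconv).2 (Or.inr hxt) with h | h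
      · have := A.tri.empty _ hN x hx (by rwa [coe_triple])
        simp only [Finset.mem_insert, Finset.mem_singleton] at this ⊢
        tauto
      · have := A.tri.empty _ hΔ x hx (by rwa [coe_triple])
        simp only [Finset.mem_insert, Finset.mem_singleton] at this ⊢
        tauto
    · exact A.tri.empty t ((A.mem_T t).2 h) x hx hxt
  · intro t ht t' ht' hne
    rcases F.isTile_flip (F'.mem_tiles.1 ht) with rfl | rfl | ⟨h, n1, n2⟩ <;>
    rcases F.isTile_flip (F'.mem_tiles.1 ht') with rfl | rfl | ⟨h', n1', n2'⟩
    · exact absurd rfl hne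
    · rw [iN', iΔ']; exact hNΔ
    · rw [Set.disjoint_right]
      intro x hx hx'
      rw [iN'] at hx'
      exact hnew t' ((A.mem_T _).2 h') n1' n2' x hx
        (Or.inl (openTriangle_subset_convexHull _ _ _ hx'))
    · rw [iN', iΔ']; exact hNΔ.symm
    · exact absurd rfl hne
    · rw [Set.disjoint_right]
      intro x hx hx'
      rw [iΔ'] at hx'
      exact hnew t' ((A.mem_T _).2 h') n1' n2' x hx
        (Or.inr (openTriangle_subset_convexHull _ _ _ hx'))
    · rw [Set.disjoint_left]
      intro x hx hx'
      rw [iN'] at hx'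
      exact hnew t ((A.mem_T _).2 h) n1 n2 x hx
        (Or.inl (openTriangle_subset_convexHull _ _ _ hx'))
    · rw [Set.disjoint_left]
      intro x hx hx'
      rw [iΔ'] at hx'
      exact hnew t ((A.mem_T _).2 h) n1 n2 x hx
        (Or.inr (openTriangle_subset_convexHull _ _ _ hx'))
    · exact A.tri.disjoint t ((A.mem_T _).2 h) t' ((A.mem_T _).2 h') hne
  · rw [← A.tri.cover]
    ext x
    constructor
    · rintro ⟨t, ht, hx⟩
      rcases F.isTile_flip (F'.mem_tiles.1 ht) with rfl | rfl | ⟨h, -, -⟩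
      · rw [coe_triple] at hx
        rcases (quad_cut o1 o2 o3 hconv).2 (Or.inl hx) with h | h
        · exact ⟨_, hN, by rwa [coe_triple]⟩
        · exact ⟨_, hΔ, by rwa [coe_triple]⟩
      · rw [coe_triple] at hx
        rcases (quad_cut o1 o2 o3 hconv).2 (Or.inr hx) with h | h
        · exact ⟨_, hN, by rwa [coe_triple]⟩
        · exact ⟨_, hΔ, by rwa [coe_triple]⟩
      · exact ⟨t, (A.mem_T _).2 h, hx⟩
    · rintro ⟨t, ht, hx⟩
      have hor : x ∈ convexHull ℝ {c (i - 1), c i, a (f i)} ∨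
          x ∈ convexHull ℝ {a (f i), c i, a (f i + 1)} →
          ∃ t ∈ tiles P c a (flipIndex k i f), x ∈ convexHull ℝ (t : Set Plane) := by
        intro h
        rcases (quad_cut o1 o2 o3 hconv).1 h with h | h
        · exact ⟨_, F'.mem_tiles.2 hN', by rwa [coe_triple]⟩
        · exact ⟨_, F'.mem_tiles.2 hΔ', by rwa [coe_triple]⟩
      rcases F.isTile_unflip (i := i) ((A.mem_T _).1 ht) with rfl | rfl | h
      · exact hor (Or.inl (by rwa [coe_triple] at hx))
      · exact hor (Or.inr (by rwa [coe_triple] at hx))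
      · exact ⟨t, F'.mem_tiles.2 h, hx⟩

end Annulus

end FourConn

namespace FourConn

variable {P : Finset Plane} {C : List Plane} {T : Finset (Finset Plane)} {ε : ℝ} {k n : ℤ}
  {c a : ℤ → Plane} {f : ℤ → ℤ} {D : Set (Sym2 Plane)} {W : Set Plane}

/-! ### Dissections of the interior of the polygon -/

/-- Pairwise non-crossing diagonals of `C` that join no two points seen by a common hull vertex. -/
structure IsDissection (C : List Plane) (a : ℤ → Plane) (f : ℤ → ℤ) (D : Set (Sym2 Plane)) :
    Prop where
  diagonal : ∀ p q, s(p, q) ∈ D → IsDiagonal C (polygonInterior C) p q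
  noncrossing : ∀ p q p' q', s(p, q) ∈ D → s(p', q') ∈ D → s(p, q) ≠ s(p', q') →
    Disjoint (openSegment ℝ p q) (openSegment ℝ p' q')
  free : NbFree a f D

/-- The edges of the polygon and the diagonals in `D`. -/
def walls (a : ℤ → Plane) (D : Set (Sym2 Plane)) : Set (Sym2 Plane) :=
  {e | ∃ m, e = s(a m, a (m + 1))} ∪ D

theorem IsDissection.reverse (hD : IsDissection C a f D) :
    IsDissection C (fun m => a (-m)) (fun i => -f (1 - i)) D where
  diagonal := hD.diagonal
  noncrossing := hD.noncrossing
  free g h hgh i hg hh := hD.free g h hgh (-i) (Frame.nb_reverse.1 hg) (Frame.nb_reverse.1 hh)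

namespace Annulus

theorem mem_of_vert (A : Annulus P C T ε k n c a f) {p : Plane} (hp : p ∈ C) : p ∈ P := by
  obtain ⟨m, rfl⟩ := (A.vert p).1 hp
  exact A.a_mem m

theorem a_mem_C (A : Annulus P C T ε k n c a f) (m : ℤ) : a m ∈ C := (A.vert _).2 ⟨m, rfl⟩

theorem isPlaneGraph [DecidableEq Plane] (A : Annulus P C T ε k n c a f)
    (hD : IsDissection C a f D) : IsPlaneGraph C.toFinset (walls a D) := by
  have hmem : ∀ g h, s(g, h) ∈ walls a D → g ∈ C := by
    rintro g h (⟨m, hm⟩ | hgh)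
    · rcases Sym2.eq_iff.1 hm with ⟨rfl, rfl⟩ | ⟨rfl, rfl⟩ <;> exact A.a_mem_C _
    · exact (hD.diagonal g h hgh).2.1.1
  have hCD : ∀ m g h, s(g, h) ∈ D → ∀ x ∈ openSegment ℝ (a m) (a (m + 1)),
      x ∉ openSegment ℝ g h := fun m g h hgh x hx hx' =>
    A.notMem_polygonInterior_of_mem_edge (A.triangulationEdge_succ m)
      (openSegment_subset_segment _ _ _ hx) ((hD.diagonal g h hgh).2.2.2 hx')
  have hos : ∀ {p q u v : Plane}, s(p, q) = s(u, v) → openSegment ℝ p q = openSegment ℝ u v := by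
    intro p q u v h
    rcases Sym2.eq_iff.1 h with ⟨rfl, rfl⟩ | ⟨rfl, rfl⟩
    · rfl
    · exact openSegment_symm _ _ _
  refine ⟨?_, ?_, fun g h hgh => by simpa using hmem g h hgh, ?_, ?_⟩
  · intro p hp q hq r hr
    exact A.gp p (A.mem_of_vert (by simpa using hp)) q (A.mem_of_vert (by simpa using hq)) r
      (A.mem_of_vert (by simpa using hr))
  · refine ((C.toFinset ×ˢ C.toFinset).finite_toSet.image (fun x => s(x.1, x.2))).subset ?_
    intro e he
    induction e using Sym2.ind with
    | _ g h =>
      exact ⟨(g, h), by simpa using ⟨hmem g h he, hmem h g (by rwa [Sym2.eq_swap])⟩, rfl⟩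
  · rintro g h (⟨m, hm⟩ | hgh)
    · rcases Sym2.eq_iff.1 hm with ⟨rfl, rfl⟩ | ⟨rfl, rfl⟩
      · exact A.a_ne_succ _
      · exact (A.a_ne_succ _).symm
    · exact (hD.diagonal g h hgh).1
  · rintro p q g h (⟨l, hl⟩ | hpq) (⟨m, hm⟩ | hgh) hne x hx hx'
    · rw [hos hl] at hx
      rw [hos hm] at hx'
      exact A.edges_disjoint (A.triangulationEdge_succ l) (A.triangulationEdge_succ m)
        (by rwa [← hl, ← hm]) hx hx'
    · exact hCD l g h hgh x (hos hl ▸ hx) hx'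
    · exact hCD m p q hpq x (hos hm ▸ hx') hx
    · exact Set.disjoint_left.1 (hD.noncrossing p q g h hpq hgh hne) hx hx'

theorem edgeSet_walls (A : Annulus P C T ε k n c a f) :
    edgeSet (walls a D) = polygonCurve C ∪ {y | ∃ p q, s(p, q) ∈ D ∧ y ∈ segment ℝ p q} := by
  ext x
  constructor
  · rintro ⟨p, q, ⟨m, hm⟩ | h, hx⟩
    · left
      rw [A.curve_iff]
      refine ⟨m, ?_⟩
      rcases Sym2.eq_iff.1 hm with ⟨rfl, rfl⟩ | ⟨rfl, rfl⟩
      · exact hx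
      · rwa [segment_symm]
    · exact Or.inr ⟨p, q, h, hx⟩
  · rintro (hx | ⟨p, q, h, hx⟩)
    · obtain ⟨m, hm⟩ := A.curve_iff.1 hx
      exact ⟨_, _, Or.inl ⟨m, rfl⟩, hm⟩
    · exact ⟨p, q, Or.inr h, hx⟩

end Annulus

theorem IsPlaneGraph.isClosed_edgeSet {V : Finset Plane} {E : Set (Sym2 Plane)}
    (G : IsPlaneGraph V E) : IsClosed (edgeSet E) := by
  have : edgeSet E = ⋃ x ∈ {x : Plane × Plane | s(x.1, x.2) ∈ E}, segment ℝ x.1 x.2 := by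
    ext y
    simp only [edgeSet, Set.mem_iUnion, Set.mem_ofPred_eq, Prod.exists, exists_prop]
  rw [this]
  refine Set.Finite.isClosed_biUnion ?_ fun x _ => ?_
  · refine (V ×ˢ V).finite_toSet.subset fun x hx => ?_
    simpa using ⟨G.mem _ _ hx, G.mem' hx⟩
  · rw [← convexHull_pair]
    exact (Set.toFinite {x.1, x.2}).isClosed_convexHull ℝ

/-- A region of a maximal dissection. -/
structure Region (P : Finset Plane) (C : List Plane) (T : Finset (Finset Plane)) (ε : ℝ) (k n : ℤ)
    (c a : ℤ → Plane) (f : ℤ → ℤ) (D : Set (Sym2 Plane)) (W : Set Plane) : Prop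
    extends Annulus P C T ε k n c a f where
  dis : IsDissection C a f D
  max : ∀ T' ε' c' a' f' D', Annulus P C T' ε' k n c' a' f' → IsDissection C a' f' D' →
    D'.ncard ≤ D.ncard
  region : IsRegion C D W

namespace Region

theorem reverse (R : Region P C T ε k n c a f D W) :
    Region P C T (-ε) k n (fun i => c (-i)) (fun m => a (-m)) (fun i => -f (1 - i)) D W where
  toAnnulus := R.toAnnulus.reverse
  dis := R.dis.reverse
  max := R.max
  region := R.region

theorem region' (R : Region P C T ε k n c a f D W) : ∃ x ∈ polygonInterior C \ edgeSet (walls a D),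
    W = connectedComponentIn (polygonInterior C \ edgeSet (walls a D)) x := by
  have : polygonInterior C \ edgeSet (walls a D) =
      polygonInterior C \ {y | ∃ p q, s(p, q) ∈ D ∧ y ∈ segment ℝ p q} := by
    rw [R.edgeSet_walls]
    ext x
    constructor
    · rintro ⟨h1, h2⟩
      exact ⟨h1, fun h => h2 (Or.inr h)⟩
    · rintro ⟨h1, h2⟩
      exact ⟨h1, fun h => h.elim h1.1 h2⟩
  rw [this]
  exact R.region

theorem subset (R : Region P C T ε k n c a f D W) :
    W ⊆ polygonInterior C \ edgeSet (walls a D) := by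
  obtain ⟨x, -, rfl⟩ := R.region'
  exact connectedComponentIn_subset _ _

theorem subset_interior (R : Region P C T ε k n c a f D W) : W ⊆ polygonInterior C :=
  fun _ hx => (R.subset hx).1

theorem notMem_walls (R : Region P C T ε k n c a f D W) {x : Plane} (hx : x ∈ W) :
    x ∉ edgeSet (walls a D) := (R.subset hx).2

theorem nonempty (R : Region P C T ε k n c a f D W) : W.Nonempty := by
  obtain ⟨x, hx, rfl⟩ := R.region'
  exact ⟨x, mem_connectedComponentIn hx⟩

theorem isPreconnected (R : Region P C T ε k n c a f D W) : IsPreconnected W := by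
  obtain ⟨x, hx, rfl⟩ := R.region'
  exact isPreconnected_connectedComponentIn

theorem isOpen (R : Region P C T ε k n c a f D W) : IsOpen W := by
  classical
  obtain ⟨x, hx, rfl⟩ := R.region'
  exact ((isOpen_polygonInterior C).sdiff (R.isPlaneGraph R.dis).isClosed_edgeSet).connectedComponentIn

theorem absorb (R : Region P C T ε k n c a f D W) {s : Set Plane} (hs : IsPreconnected s)
    (hd : ∀ x ∈ s, x ∉ edgeSet (walls a D)) {y : Plane} (hy : y ∈ s) (hyW : y ∈ W) : s ⊆ W := by
  have hsub : s ⊆ polygonInterior C \ edgeSet (walls a D) := fun z hz =>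
    ⟨subset_polygonInterior hs (fun x hx hxc => hd x hx (by rw [R.edgeSet_walls]; exact Or.inl hxc))
      hy (R.subset_interior hyW) hz, hd z hz⟩
  obtain ⟨x, hx, rfl⟩ := R.region'
  rw [connectedComponentIn_eq hyW]
  exact hs.subset_connectedComponentIn hy hsub

theorem mem_of_mem_closure (R : Region P C T ε k n c a f D W) {x : Plane} (hx : x ∈ closure W)
    (hxE : x ∉ edgeSet (walls a D)) : x ∈ W := by
  classical
  have ho := (R.isPlaneGraph R.dis).isClosed_edgeSet.isOpen_compl
  obtain ⟨r, hr, hb⟩ := Metric.isOpen_iff.1 ho x hxE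
  obtain ⟨y, hy, hyW⟩ := mem_closure_iff.1 hx _ Metric.isOpen_ball (Metric.mem_ball_self hr)
  exact R.absorb (convex_ball x r).isPreconnected (fun z hz => hb hz) hy hyW
    (Metric.mem_ball_self hr)

theorem a_mem_walls (m : ℤ) : a m ∈ edgeSet (walls a D) :=
  ⟨_, _, Or.inl ⟨m, rfl⟩, left_mem_segment _ _ _⟩

theorem vert_mem_walls (R : Region P C T ε k n c a f D W) {p : Plane} (hp : p ∈ C) :
    p ∈ edgeSet (walls a D) := by
  obtain ⟨m, rfl⟩ := (R.vert p).1 hp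
  exact a_mem_walls m

theorem wall_notMem (R : Region P C T ε k n c a f D W) {p q x : Plane} (h : s(p, q) ∈ walls a D)
    (hx : x ∈ segment ℝ p q) : x ∉ W := fun hW => R.notMem_walls hW ⟨p, q, h, hx⟩

theorem mem_closure_of_triangle {p q z : Plane} (h : openTriangle p q z ⊆ W) :
    p ∈ closure W ∧ q ∈ closure W ∧ z ∈ closure W := by
  have := closure_mono h
  rw [closure_openTriangle] at this
  exact ⟨this (subset_convexHull ℝ _ (by simp)), this (subset_convexHull ℝ _ (by simp)),
    this (subset_convexHull ℝ _ (by simp))⟩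

theorem wall_or_isDiagonal (R : Region P C T ε k n c a f D W) {p q z : Plane} (hp : p ∈ C)
    (hq : q ∈ C) (ho : orient p q z ≠ 0) (h : openTriangle p q z ⊆ W) :
    s(p, q) ∈ walls a D ∨ IsDiagonal C W p q := by
  classical
  by_cases hE : s(p, q) ∈ walls a D
  · exact Or.inl hE
  refine Or.inr ?_
  obtain ⟨h1, h2, -⟩ := mem_closure_of_triangle h
  have hpq : p ≠ q := by rintro rfl; exact ho (by simp [orient])
  refine ⟨hpq, ⟨hp, h1⟩, ⟨hq, h2⟩, fun x hx => ?_⟩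
  refine R.mem_of_mem_closure ?_ ?_
  · refine closure_mono h ?_
    rw [closure_openTriangle]
    exact (convex_convexHull ℝ _).segment_subset (subset_convexHull ℝ _ (by simp))
      (subset_convexHull ℝ _ (by simp)) (openSegment_subset_segment _ _ _ hx)
  · rintro ⟨g, h', hgh, hx'⟩
    have G := R.isPlaneGraph R.dis
    have gC : g ∈ C := by simpa using G.mem _ _ hgh
    have hC : h' ∈ C := by simpa using G.mem' hgh
    have e : ∀ y ∈ C, x ≠ y := by
      rintro y hy rfl
      exact R.gp.notMem_openSegment (R.mem_of_vert hp) (R.mem_of_vert hq) (R.mem_of_vert hy) hpq hx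
    rcases mem_segment_cases hx' with rfl | rfl | hx'
    · exact e _ gC rfl
    · exact e _ hC rfl
    · obtain ⟨w, hw1, hw2⟩ := crossing_meets_openTriangle ho (R.gp.orient_ne_or (R.mem_of_vert hp)
        (R.mem_of_vert hq) (R.mem_of_vert gC) (R.mem_of_vert hC) hpq (G.ne _ _ hgh)
        (fun he => hE (he ▸ hgh))) hx hx'
      exact R.wall_notMem hgh (openSegment_subset_segment _ _ _ hw1) (h hw2)

theorem insert_diagonal (R : Region P C T ε k n c a f D W) {g h : Plane} (hd : IsDiagonal C W g h) :
    s(g, h) ∉ D ∧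
    (∀ p q, s(p, q) ∈ insert s(g, h) D → IsDiagonal C (polygonInterior C) p q) ∧
    ∀ p q p' q', s(p, q) ∈ insert s(g, h) D → s(p', q') ∈ insert s(g, h) D →
      s(p, q) ≠ s(p', q') → Disjoint (openSegment ℝ p q) (openSegment ℝ p' q') := by
  have key : ∀ p q, s(p, q) ∈ D → Disjoint (openSegment ℝ g h) (openSegment ℝ p q) := by
    intro p q hpq
    rw [Set.disjoint_left]
    intro x hx hx'
    exact R.wall_notMem (Or.inr hpq) (openSegment_subset_segment _ _ _ hx') (hd.2.2.2 hx)
  have hos : ∀ {p q u v : Plane}, s(p, q) = s(u, v) → openSegment ℝ p q = openSegment ℝ u v := by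
    intro p q u v h
    rcases Sym2.eq_iff.1 h with ⟨rfl, rfl⟩ | ⟨rfl, rfl⟩
    · rfl
    · exact openSegment_symm _ _ _
  refine ⟨fun hgh => ?_, ?_, ?_⟩
  · have := midpoint_mem_openSegment (𝕜 := ℝ) g h
    exact Set.disjoint_left.1 (key g h hgh) this this
  · rintro p q (h' | h')
    · have hd' : IsDiagonal C (polygonInterior C) g h :=
        ⟨hd.1, ⟨hd.2.1.1, closure_mono R.subset_interior hd.2.1.2⟩,
          ⟨hd.2.2.1.1, closure_mono R.subset_interior hd.2.2.1.2⟩,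
          hd.2.2.2.trans R.subset_interior⟩
      rcases Sym2.eq_iff.1 h' with ⟨rfl, rfl⟩ | ⟨rfl, rfl⟩
      · exact hd'
      · exact ⟨hd'.1.symm, hd'.2.2.1, hd'.2.1, by rw [openSegment_symm]; exact hd'.2.2.2⟩
    · exact R.dis.diagonal p q h'
  · rintro p q p' q' (h1 | h1) (h2 | h2) hne
    · exact absurd (h1.trans h2.symm) hne
    · rw [hos h1]; exact key _ _ h2
    · rw [hos h2]; exact (key _ _ h1).symm
    · exact R.dis.noncrossing _ _ _ _ h1 h2 hne

theorem finite (R : Region P C T ε k n c a f D W) : D.Finite := by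
  classical
  exact (R.isPlaneGraph R.dis).finite.subset fun _ h => Or.inr h

/-- By maximality, the ends of a diagonal of a region are seen by a common hull vertex. -/
theorem exists_nb_of_isDiagonal (R : Region P C T ε k n c a f D W) {g h : Plane}
    (hd : IsDiagonal C W g h) : ∃ i, Nb a f g i ∧ Nb a f h i := by
  by_contra hcon
  push Not at hcon
  obtain ⟨h1, h2, h3⟩ := R.insert_diagonal hd
  have := R.max T ε c a f (insert s(g, h) D) R.toAnnulus ⟨h2, h3, by
    rintro p q (h' | h') i hp hq
    · rcases Sym2.eq_iff.1 h' with ⟨rfl, rfl⟩ | ⟨rfl, rfl⟩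
      · exact hcon i hp hq
      · exact hcon i hq hp
    · exact R.dis.free p q h' i hp hq⟩
  rw [Set.ncard_insert_of_notMem h1 R.finite] at this
  omega

theorem wall_not_isDiagonal (R : Region P C T ε k n c a f D W) {g h : Plane}
    (hw : s(g, h) ∈ walls a D) : ¬ IsDiagonal C W g h := fun hd =>
  R.wall_notMem hw (openSegment_subset_segment _ _ _ (midpoint_mem_openSegment (𝕜 := ℝ) g h))
    (hd.2.2.2 (midpoint_mem_openSegment g h))

/-- Each side of a diagonal of a region contains a triangle of the region. -/
theorem exists_triangle (R : Region P C T ε k n c a f D W) {σ : ℝ} (hσ : σ ≠ 0) {p q : Plane}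
    (hd : IsDiagonal C W p q) : ∃ z ∈ C, 0 < ori σ p q z ∧ openTriangle p q z ⊆ W := by
  classical
  have G := R.isPlaneGraph R.dis
  have hm := midpoint_mem_openSegment (𝕜 := ℝ) p q
  obtain ⟨r, hr, hb⟩ := Metric.isOpen_iff.1 R.isOpen _ (hd.2.2.2 hm)
  have hside : ∃ x ∈ W, 0 < ori σ p q x := by
    let v : Plane := !₂[-(q 1 - p 1), q 0 - p 0]
    have hv : ∀ t : ℝ, ori σ p q (midpoint ℝ p q + t • v) =
        σ * t * ((q 0 - p 0) ^ 2 + (q 1 - p 1) ^ 2) := by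
      intro t
      have e0 : (midpoint ℝ p q) 0 = (p 0 + q 0) / 2 := by
        simp [midpoint_eq_smul_add]; ring
      have e1 : (midpoint ℝ p q) 1 = (p 1 + q 1) / 2 := by
        simp [midpoint_eq_smul_add]; ring
      simp only [ori, orient, PiLp.add_apply, PiLp.smul_apply, smul_eq_mul, e0, e1]
      simp only [v, Matrix.cons_val_zero, Matrix.cons_val_one]
      ring
    have hpos : 0 < (q 0 - p 0) ^ 2 + (q 1 - p 1) ^ 2 := by
      by_contra hc
      have h0 : q 0 - p 0 = 0 := by nlinarith [sq_nonneg (q 0 - p 0), sq_nonneg (q 1 - p 1)]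
      have h1 : q 1 - p 1 = 0 := by nlinarith [sq_nonneg (q 0 - p 0), sq_nonneg (q 1 - p 1)]
      apply hd.1
      ext i
      fin_cases i
      · simp only [Fin.zero_eta]; linarith
      · simp only [Fin.mk_one]; linarith
    have hct : Filter.Tendsto (fun s : ℝ => midpoint ℝ p q + (s * σ) • v) (nhdsWithin 0 (Set.Ioi 0))
        (nhds (midpoint ℝ p q)) := by
      have : Continuous (fun s : ℝ => midpoint ℝ p q + (s * σ) • v) := by fun_prop
      have := this.tendsto 0
      simp only [zero_mul, zero_smul, add_zero] at this
      exact this.mono_left nhdsWithin_le_nhds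
    obtain ⟨s, hs1, hs2⟩ := ((hct.eventually (Metric.ball_mem_nhds _ hr)).and
      self_mem_nhdsWithin).exists
    refine ⟨_, hb hs1, ?_⟩
    rw [hv]
    have : 0 < σ * (s * σ) := by
      have := mul_pos hs2 (mul_self_pos.2 hσ)
      linarith
    positivity
  obtain ⟨x, hxW, hx⟩ := hside
  obtain ⟨v, hv, hvo⟩ := exists_vertex_side (R.subset_interior hxW) hx
  obtain ⟨u, hu, huo, htri⟩ := G.exists_free_triangle hσ (by simpa using hd.2.1.1)
    (by simpa using hd.2.2.1.1) (fun g h hgh _ y hy hy' => R.wall_notMem hgh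
      (openSegment_subset_segment _ _ _ hy') (hd.2.2.2 hy)) (by simpa using hv) hvo
  refine ⟨u, by simpa using hu, huo, ?_⟩
  have : midpoint ℝ p q ∈ closure (openTriangle p q u) := by
    rw [closure_openTriangle]
    exact (convex_convexHull ℝ _).segment_subset (subset_convexHull ℝ _ (by simp))
      (subset_convexHull ℝ _ (by simp)) (openSegment_subset_segment _ _ _ hm)
  obtain ⟨y, hyW, hy⟩ := mem_closure_iff.1 this W R.isOpen (hd.2.2.2 hm)
  exact R.absorb convex_openTriangle.isPreconnected htri hy hyW

end Region

end FourConn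

namespace FourConn

variable {P : Finset Plane} {C : List Plane} {T : Finset (Finset Plane)} {ε : ℝ} {k n : ℤ}
  {c a : ℤ → Plane} {f : ℤ → ℤ} {D : Set (Sym2 Plane)} {W : Set Plane}

theorem IsDiagonal.symm {p q : Plane} (h : IsDiagonal C W p q) : IsDiagonal C W q p :=
  ⟨h.1.symm, h.2.2.1, h.2.1, by rw [openSegment_symm]; exact h.2.2.2⟩

namespace Region

theorem exists_line (R : Region P C T ε k n c a f D W) {x : Plane} (hx : x ∈ W) :
    ∃ m, orient (a m) (a (m + 1)) x ≠ 0 := by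
  by_contra hcon
  push Not at hcon
  have h0 := hcon 0
  have h1 := hcon 1
  norm_num at h0 h1
  have h3 := R.three_le_n
  have ho : ori 1 (a 0) (a 1) (a 2) ≠ 0 := R.gp.ori_ne one_ne_zero (R.a_mem _) (R.a_mem _)
    (R.a_mem _) (R.a_ne (by omega) (by omega)) (R.a_ne (by omega) (by omega))
    (R.a_ne (by omega) (by omega))
  have e := eq_comb_of_ori_ne ho x
  have s := ori_div_sum ho x
  rw [ori_one (a 0) (a 1) x, ori_one (a 1) (a 2) x, h0, h1] at e s
  simp only [zero_div, zero_smul, zero_add, add_zero] at e s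
  rw [s, one_smul] at e
  exact R.notMem_walls hx (e ▸ a_mem_walls 1)

/-- A segment from a point of the region to an edge of `C` that avoids the vertices. -/
theorem exists_path (R : Region P C T ε k n c a f D W) {x : Plane} (hx : x ∈ W) :
    ∃ y ∈ edgeSet (walls a D), ∀ v ∈ C, v ∉ segment ℝ x y := by
  classical
  obtain ⟨m, hm⟩ := R.exists_line hx
  let g : ℝ → Plane := fun t => (1 - t) • a m + t • a (m + 1)
  have hg : ∀ t, ori 1 (a m) (a (m + 1)) (g t) = 0 := fun t => by
    simp only [g]; rw [ori_comb_two _ _ _ _ _ (by ring)]; simp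
  have hfin : (⋃ v ∈ C.toFinset, {t : ℝ | v ∈ segment ℝ x (g t)}).Finite := by
    refine C.toFinset.finite_toSet.biUnion fun v hv => Set.Subsingleton.finite ?_
    have hvx : v ≠ x := fun h => R.notMem_walls hx (h ▸ R.vert_mem_walls (by simpa using hv))
    rintro t ⟨l1, l2, -, -, h1, h2⟩ u ⟨m1, m2, -, -, h3, h4⟩
    have e1 := congrArg (ori 1 (a m) (a (m + 1))) h2
    have e2 := congrArg (ori 1 (a m) (a (m + 1))) h4
    rw [ori_comb_two _ _ _ _ _ h1, hg, ori_one] at e1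
    rw [ori_comb_two _ _ _ _ _ h3, hg, ori_one, ← ori_one] at e2
    rw [ori_one] at e2
    have e3 : l1 = m1 := mul_right_cancel₀ hm (by linarith)
    have e4 : l2 = m2 := by linarith
    subst e3 e4
    have hl : l2 ≠ 0 := by
      rintro rfl
      apply hvx
      rw [← h2, show l1 = 1 by linarith]; simp
    have e5 : g t = g u := smul_right_injective _ hl (by
      simpa using h2.trans h4.symm)
    have e6 : (t - u) • (a (m + 1) - a m) = 0 := by
      have : g t - g u = (t - u) • (a (m + 1) - a m) := by simp only [g]; module
      rw [← this, e5, sub_self]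
    rcases smul_eq_zero.1 e6 with h | h
    · linarith
    · exact absurd (sub_eq_zero.1 h).symm (R.a_ne_succ m)
  obtain ⟨t, ht, htn⟩ := (Set.Ioo_infinite (zero_lt_one (α := ℝ))).exists_notMem_finite hfin
  refine ⟨g t, ⟨_, _, Or.inl ⟨m, rfl⟩, ⟨1 - t, t, by linarith [ht.2], ht.1.le, by ring, rfl⟩⟩,
    fun v hv hvs => htn ?_⟩
  simp only [Set.mem_iUnion]
  exact ⟨v, by simpa using hv, hvs⟩

theorem exists_wall_triangle (R : Region P C T ε k n c a f D W) :
    ∃ p q u, p ∈ C ∧ q ∈ C ∧ u ∈ C ∧ s(p, q) ∈ walls a D ∧ orient p q u ≠ 0 ∧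
      openTriangle p q u ⊆ W := by
  classical
  have G := R.isPlaneGraph R.dis
  obtain ⟨x, hx⟩ := R.nonempty
  obtain ⟨y, hy, hxy⟩ := R.exists_path hx
  let l : ℝ → Plane := fun t => (1 - t) • x + t • y
  have hl : Continuous l := by fun_prop
  have hl0 : l 0 = x := by simp [l]
  have hseg : ∀ s ∈ Set.Icc (0 : ℝ) 1, l s ∈ segment ℝ x y := fun s hs =>
    ⟨1 - s, s, by linarith [hs.2], hs.1, by ring, rfl⟩
  have hK : IsCompact (Set.Icc (0 : ℝ) 1 ∩ l ⁻¹' edgeSet (walls a D)) :=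
    isCompact_Icc.inter_right (G.isClosed_edgeSet.preimage hl)
  obtain ⟨s₀, ⟨hs₀, p, q, hpq, hw⟩, hmin⟩ := hK.exists_isLeast
    ⟨1, by simp, by simpa [l] using hy⟩
  have hfree : ∀ s, 0 ≤ s → s < s₀ → l s ∉ edgeSet (walls a D) := fun s h0 h1 hs =>
    absurd (hmin ⟨⟨h0, h1.le.trans hs₀.2⟩, hs⟩) (not_le.2 h1)
  have hpC : p ∈ C := by simpa using G.mem _ _ hpq
  have hqC : q ∈ C := by simpa using G.mem' hpq
  have hs0 : 0 < s₀ := by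
    rcases hs₀.1.lt_or_eq with h | h
    · exact h
    · subst h
      rw [hl0] at hw
      exact absurd hx (R.wall_notMem hpq hw)
  have hwW : ∀ s, 0 ≤ s → s < s₀ → l s ∈ W := by
    intro s h0 h1
    have := R.absorb (s := l '' Set.Ico 0 s₀) (isPreconnected_Ico.image _ hl.continuousOn)
      (by rintro _ ⟨r, hr, rfl⟩; exact hfree r hr.1 hr.2) ⟨0, ⟨le_rfl, hs0⟩, rfl⟩ (by rwa [hl0])
    exact this ⟨s, ⟨h0, h1⟩, rfl⟩
  have hwo : l s₀ ∈ openSegment ℝ p q := by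
    rcases mem_segment_cases hw with h | h | h
    · exact absurd (h ▸ hseg s₀ hs₀) (hxy p hpC)
    · exact absurd (h ▸ hseg s₀ hs₀) (hxy q hqC)
    · exact h
  have hsub : segment ℝ x (l s₀) ⊆ segment ℝ x y :=
    (convex_segment x y).segment_subset (left_mem_segment _ _ _) (hseg s₀ hs₀)
  have hox : orient p q x ≠ 0 := by
    intro h0
    rcases (collinear_of_orient_eq_zero h0).wbtw_or_wbtw_or_wbtw with h | h | h
    · refine hxy q hqC (hsub ?_)
      rw [segment_symm, mem_segment_iff_wbtw]
      exact h.trans_left_right (mem_segment_iff_wbtw.1 hw)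
    · rw [← mem_segment_iff_wbtw, segment_symm] at h
      exact R.wall_notMem hpq h hx
    · refine hxy p hpC (hsub ?_)
      rw [mem_segment_iff_wbtw]
      exact (h.symm.trans_left_right (mem_segment_iff_wbtw.1 hw).symm).symm
  have hxo : 0 < ori (orient p q x) p q x := sq_ori hox
  obtain ⟨v, hv, hvo⟩ := exists_vertex_side (R.subset_interior hx) hxo
  obtain ⟨u, hu, huo, htri⟩ := G.exists_free_triangle hox (by simpa using hpC) (by simpa using hqC)
    (G.uncrossed hpq) (by simpa using hv) hvo
  have hou : orient p q u ≠ 0 := fun h => by simp [ori, h] at huo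
  refine ⟨p, q, u, hpC, hqC, by simpa using hu, hpq, hou, ?_⟩
  set σ := orient p q x
  obtain ⟨α, β, hα, hβ, hαβ, hwe⟩ := hwo
  have o1 : 0 < ori σ q u (l s₀) := by
    rw [← hwe, ori_comb_two _ _ _ _ _ hαβ, ori_rot, ori_left]
    have := mul_pos hα huo
    linarith
  have o2 : 0 < ori σ u p (l s₀) := by
    rw [← hwe, ori_comb_two _ _ _ _ _ hαβ, ori_rot' σ p q u, ori_right]
    have := mul_pos hβ huo
    linarith
  have hev : ∀ᶠ s in nhdsWithin s₀ (Set.Iio s₀), 0 < s ∧ s < s₀ ∧ 0 < ori σ q u (l s) ∧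
      0 < ori σ u p (l s) := by
    have c1 := (((ori_continuous σ q u).comp hl).tendsto s₀).eventually (lt_mem_nhds o1)
    have c2 := (((ori_continuous σ u p).comp hl).tendsto s₀).eventually (lt_mem_nhds o2)
    filter_upwards [self_mem_nhdsWithin, nhdsWithin_le_nhds (lt_mem_nhds hs0),
      nhdsWithin_le_nhds c1, nhdsWithin_le_nhds c2] with s h1 h2 h3 h4
    exact ⟨h2, h1, h3, h4⟩
  obtain ⟨s, hs1, hs2, hs3, hs4⟩ := hev.exists
  have hs5 : 0 < ori σ p q (l s) := by
    have e0 : ori σ p q (l s₀) = 0 := ori_eq_zero_of_mem_segment hw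
    simp only [l] at e0 ⊢
    rw [ori_comb_two _ _ _ _ _ (by ring)] at e0 ⊢
    have : s₀ * ((1 - s) * ori σ p q x + s * ori σ p q y) = (s₀ - s) * ori σ p q x := by
      linear_combination s * e0
    have h6 : 0 < (s₀ - s) * ori σ p q x := mul_pos (by linarith) hxo
    rw [← this] at h6
    exact pos_of_mul_pos_right h6 hs0.le
  exact R.absorb convex_openTriangle.isPreconnected htri ((mem_openTriangle_iff huo).2
    ⟨hs5, hs3, hs4⟩) (hwW s hs1.le hs2)

theorem eq_of_mem_hull (R : Region P C T ε k n c a f D W) {p q z v : Plane} (hp : p ∈ C)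
    (hq : q ∈ C) (hz : z ∈ C) (ho : orient p q z ≠ 0) (h : openTriangle p q z ⊆ W) (hv : v ∈ C)
    (hvt : v ∈ convexHull ℝ {p, q, z}) : v = p ∨ v = q ∨ v = z := by
  by_contra hcon
  push Not at hcon
  have h1 : p ≠ q := by rintro rfl; exact ho (by simp [orient])
  have h2 : p ≠ z := by rintro rfl; exact ho (by simp [orient])
  have h3 : q ≠ z := by rintro rfl; exact ho (by simp [orient]; ring)
  exact R.notMem_walls (h (R.gp.mem_openTriangle (R.mem_of_vert hp) (R.mem_of_vert hq)
    (R.mem_of_vert hz) h1 h2 h3 (R.mem_of_vert hv) hvt hcon.1 hcon.2.1 hcon.2.2))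
    (R.vert_mem_walls hv)

theorem exists_isDiagonal (R : Region P C T ε k n c a f D W)
    (h4 : 4 ≤ (regionVertices C W).ncard) : ∃ p q, IsDiagonal C W p q := by
  obtain ⟨p, q, u, hp, hq, hu, hpq, ho, htri⟩ := R.exists_wall_triangle
  rcases R.wall_or_isDiagonal hq hu (by rwa [orient_rot]) (by rwa [openTriangle_rot]) with h1 | h1
  swap
  · exact ⟨_, _, h1⟩
  rcases R.wall_or_isDiagonal hu hp (by rwa [orient_rot, orient_rot])
    (by rwa [openTriangle_rot, openTriangle_rot]) with h2 | h2
  swap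
  · exact ⟨_, _, h2⟩
  exfalso
  have hW : W ⊆ openTriangle p q u := by
    intro y hy
    by_contra hyn
    have hc := centroid_mem_openTriangle p q u
    obtain ⟨w, hw, -, h | h | h⟩ := exists_mem_edge ho R.isPreconnected (htri hc) hc hy hyn
    · exact R.wall_notMem hpq h hw
    · exact R.wall_notMem h1 h hw
    · exact R.wall_notMem h2 h hw
  have hsub : regionVertices C W ⊆ ({p, q, u} : Set Plane) := by
    rintro v ⟨hv, hvW⟩
    have := closure_mono hW hvW
    rw [closure_openTriangle] at this
    simpa using R.eq_of_mem_hull hp hq hu ho htri hv this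
  have h5 := Set.ncard_le_ncard hsub (Set.toFinite _)
  have h6 := Set.ncard_insert_le p ({q, u} : Set Plane)
  have h7 := Set.ncard_insert_le q ({u} : Set Plane)
  rw [Set.ncard_singleton] at h7
  omega

/-- The triangle of a region below a diagonal lies in the triangle of the hull vertex. -/
theorem exists_inner (R : Region P C T ε k n c a f D W) {p q : Plane} {i : ℤ}
    (hd : IsDiagonal C W p q) (hp : Nb a f p i) (hq : Nb a f q i) :
    ∃ b ∈ C, openTriangle p q b ⊆ W ∧ b ∈ openTriangle p q (c i) := by
  have ho := R.gp.orient_ne (R.nb_mem hp) (R.nb_mem hq) (R.c_mem i) hd.1 (R.nb_ne i hp)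
    (R.nb_ne i hq)
  have hs := sq_ori ho
  set σ := orient p q (c i)
  obtain ⟨b, hb, hbo, hbW⟩ := R.exists_triangle ho hd
  have hbP := R.mem_of_vert hb
  have hbp : b ≠ p := by rintro rfl; simp at hbo
  have hbq : b ≠ q := by rintro rfl; simp at hbo
  have hbc : b ≠ c i := by
    obtain ⟨m, rfl⟩ := (R.vert b).1 hb
    exact (R.c_ne_a _ _).symm
  refine ⟨b, hb, hbW, (mem_openTriangle_iff hs).2 ⟨hbo, ?_, ?_⟩⟩
  · rcases (R.gp.ori_ne ho (R.nb_mem hq) (R.c_mem i) hbP (R.nb_ne i hq) hbq.symm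
      hbc.symm).lt_or_gt with h | h
    · exfalso
      obtain ⟨w, hw, hw'⟩ := corner_meets_openTriangle (ε := -σ) (v := q) (p := p) (q := b)
        (x := c i) (by rw [ori_neg, ori_swap]; linarith) (by rw [ori_neg]; linarith)
        (by rw [ori_neg, ori_swap]; linarith)
      rw [openTriangle_swap] at hw'
      exact R.nb_notMem hq hw (R.subset_interior (hbW hw'))
    · exact h
  · rcases (R.gp.ori_ne ho (R.c_mem i) (R.nb_mem hp) hbP (R.nb_ne i hp).symm hbc.symm
      hbp.symm).lt_or_gt with h | h
    · exfalso
      obtain ⟨w, hw, hw'⟩ := corner_meets_openTriangle (ε := σ) (v := p) (p := q) (q := b)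
        (x := c i) hs (by rw [ori_swap] at h; linarith) hbo
      exact R.nb_notMem hp hw (R.subset_interior (hbW hw'))
    · exact h

/-- The second diagonal of a convex quadrilateral formed by two triangles of a region. -/
theorem isDiagonal_of_quad {p q y z : Plane} {σ : ℝ} (hd : IsDiagonal C W p q) (hy : y ∈ C)
    (hz : z ∈ C) (hyW : openTriangle p q y ⊆ W) (hzW : openTriangle p q z ⊆ W)
    (h1 : ori σ p q y < 0) (h2 : 0 < ori σ p q z) (h3 : 0 < ori σ y z p) (h4 : ori σ y z q < 0) :
    IsDiagonal C W y z := by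
  refine ⟨by rintro rfl; linarith, ⟨hy, (mem_closure_of_triangle hyW).2.2⟩,
    ⟨hz, (mem_closure_of_triangle hzW).2.2⟩, ?_⟩
  rintro x ⟨α, β, hα, hβ, hαβ, rfl⟩
  have e1 : 0 < ori σ q z (α • y + β • z) := by
    rw [ori_comb_two _ _ _ _ _ hαβ, ori_right, ori_rev σ y z q]
    have := mul_pos hα (neg_pos.2 h4)
    linarith
  have e2 : 0 < ori σ z p (α • y + β • z) := by
    rw [ori_comb_two _ _ _ _ _ hαβ, ori_left, ori_rot]
    have := mul_pos hα h3
    linarith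
  have e3 : 0 < ori (-σ) q y (α • y + β • z) := by
    rw [ori_comb_two _ _ _ _ _ hαβ, ori_right, ori_neg, ori_rot' σ y z q]
    have := mul_pos hβ (neg_pos.2 h4)
    linarith
  have e4 : 0 < ori (-σ) y p (α • y + β • z) := by
    rw [ori_comb_two _ _ _ _ _ hαβ, ori_left, ori_neg, ori_swap']
    have := mul_pos hβ h3
    linarith
  rcases lt_trichotomy (ori σ p q (α • y + β • z)) 0 with h | h | h
  · exact hyW ((mem_openTriangle_iff (ε := -σ) (by rw [ori_neg]; linarith)).2
      ⟨by rw [ori_neg]; linarith, e3, e4⟩)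
  · rcases mem_segment_cases (mem_segment_of_ori_eq_zero h2 h e1.le e2.le) with h' | h' | h'
    · rw [h'] at e2; simp at e2
    · rw [h'] at e1; simp at e1
    · exact hd.2.2.2 h'
  · exact hzW ((mem_openTriangle_iff h2).2 ⟨h, e1, e2⟩)

/-- A region that is reflex at `a (f i)` beyond a bad diagonal allows a flip, contradicting the
maximality of the dissection. -/
theorem no_reflex (R : Region P C T ε k n c a f D W) {i t : ℤ} {z b : Plane} (ht : f i < t)
    (ht' : t ≤ f (i + 1)) (hd : IsDiagonal C W (a (f i)) (a t)) (hz : z ∈ C)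
    (h1 : 0 < ori ε (a (f i)) (a t) z) (h2 : 0 < ori ε (a (f i)) z (c (i - 1))) (hbC : b ∈ C)
    (hbW : openTriangle (a (f i)) (a t) b ⊆ W) (hb : b ∈ openTriangle (a (f i)) (a t) (c i))
    (hr : ori ε (a (f i)) b z ≤ 0) : False := by
  have hw := R.width i
  have hUd := hd.2.2.2.trans R.subset_interior
  have ht1 : f i + 1 < t := by
    by_contra h
    obtain rfl : t = f i + 1 := by omega
    exact R.succ_notSubset (f i) hUd
  have hb1 := R.mem_triangle_of_between le_rfl (by omega : f i < f i + 1) ht1 ht' hUd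
  have sBq := R.angular le_rfl ht ht'
  rw [← openTriangle_swap', mem_openTriangle_iff sBq] at hb hb1
  have hpi : Nb a f (a (f i)) i := ⟨_, le_rfl, (R.f_lt i).le, rfl⟩
  have hpA : Nb a f (a (f i)) (i - 1) := ⟨_, (R.f_mono (by omega)).le, by simp, rfl⟩
  have hqi : Nb a f (a t) i := ⟨_, ht.le, ht', rfl⟩
  have hqA : ¬ Nb a f (a t) (i - 1) := fun h => hd.1
    (R.nb_unique hpi hqi hpA h (R.c_ne_pred i).symm)
  have sAB : 0 < ori ε (a (f i)) (c (i - 1)) (c i) := by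
    rw [ori_rot']; exact R.hull_a' i _
  have hbp : b ≠ a (f i) := by rintro rfl; simp at hb
  have hbz : b ≠ z := by
    rintro rfl
    have := hb.2.2
    rw [ori_swap] at this; linarith
  have hzp : z ≠ a (f i) := by rintro rfl; simp at h1
  have hbP := R.mem_of_vert hbC
  have hzP := R.mem_of_vert hz
  generalize hp : a (f i) = p at *
  generalize hq : a t = q at *
  generalize hb1' : a (f i + 1) = b₁ at *
  generalize hA : c (i - 1) = A at *
  generalize hB : c i = B at *
  have sBb1 := hb1.1
  have sbq := hb.2.2
  have sb1q := hb1.2.2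
  rw [ori_rot'] at sbq sb1q
  have sbz : ori ε p b z < 0 := lt_of_le_of_ne hr
    (R.gp.ori_ne R.eps (hp ▸ R.a_mem _) hbP hzP hbp.symm hzp.symm hbz)
  have sb1b : 0 ≤ ori ε p b₁ b := by
    by_contra h
    obtain ⟨w, hw1, hw2⟩ := corner_meets_openTriangle (ε := ε) (v := p) (p := b) (q := q)
      (x := b₁) (by rw [ori_swap']; linarith) sb1q sbq
    rw [openTriangle_swap'] at hw2
    refine R.wall_notMem (Or.inl ⟨f i, ?_⟩) (openSegment_subset_segment _ _ _ hw1) (hbW hw2)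
    rw [hp, hb1']
  have sb1z : ori ε p b₁ z < 0 := by
    have pl := ori_plucker ε p b₁ b q z
    have := mul_nonneg sb1b h1.le
    have := mul_pos sb1q (neg_pos.2 sbz)
    nlinarith
  have sBz : ori ε p B z < 0 := by
    have pl := ori_plucker ε p B b₁ q z
    have := mul_pos sBb1 h1
    have := mul_pos sBq (neg_pos.2 sb1z)
    nlinarith
  have sAb1 : 0 < ori ε p A b₁ := by
    have pl := ori_plucker ε p z A B b₁
    have e1 : ori ε p z b₁ = - ori ε p b₁ z := ori_swap' _ _ _ _
    have e2 : ori ε p z B = - ori ε p B z := ori_swap' _ _ _ _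
    rw [e1, e2] at pl
    have := mul_pos h2 sBb1
    have := mul_pos (neg_pos.2 sb1z) sAB
    by_contra hcon
    have := mul_nonneg (neg_pos.2 sBz).le (neg_nonneg.2 (not_lt.1 hcon))
    nlinarith
  have hi : f i + 1 < f (i + 1) := by omega
  have A' := R.flip hi (by rw [hp, hA, hb1']; exact sAb1)
  have hb1A' : Nb a (flipIndex k i f) b₁ (i - 1) := by
    refine ⟨f i + 1, ?_, ?_, hb1'.symm⟩
    · rw [Frame.flipIndex_of_not_dvd (R.not_dvd_of_succ (by simp))]
      have := R.f_mono (show i - 1 < i by omega); omega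
    · rw [sub_add_cancel, Frame.flipIndex_of_dvd (by simp)]
  have hqi' : Nb a (flipIndex k i f) q i := by
    refine ⟨t, ?_, ?_, hq.symm⟩
    · rw [Frame.flipIndex_of_dvd (by simp)]; omega
    · rw [Frame.flipIndex_of_not_dvd (R.not_dvd_succ (by simp))]; exact ht'
  have hpP : p ∈ P := hp ▸ R.a_mem _
  have hqP : q ∈ P := hq ▸ R.a_mem _
  have hb1P : b₁ ∈ P := hb1' ▸ R.a_mem _
  have hAP : A ∈ P := hA ▸ R.c_mem _
  have hqb1 : q ≠ b₁ := by rintro rfl; simp at sb1q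
  have hpA' : p ≠ A := by rintro rfl; simp at sAb1
  have hpb1 : p ≠ b₁ := by rintro rfl; simp at sAb1
  have hb1A : b₁ ≠ A := by rintro rfl; simp at sAb1
  have key : ∀ h, s(b₁, h) ∈ D → Nb a f h (i - 1) → False := by
    intro h hD hh
    have hU := (R.dis.diagonal _ _ hD).2.2.2
    have hhP := R.nb_mem hh
    have hhA : h ≠ A := hA ▸ R.nb_ne _ hh
    have hhb1 : h ≠ b₁ := (R.dis.diagonal _ _ hD).1.symm
    have hhq : h ≠ q := by rintro rfl; exact hqA hh
    have hhp : h ≠ p := by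
      rintro rfl
      apply R.succ_notSubset (f i)
      rwa [hp, hb1', openSegment_symm]
    have shA : 0 < ori ε p h A := by
      obtain ⟨w, hw1, hw2, rfl⟩ := hh
      rw [sub_add_cancel] at hw2
      have hwi : w ≠ f i := by rintro rfl; exact hhp hp
      have := R.angular hw1 (lt_of_le_of_ne hw2 hwi) (by simp)
      rw [ori_rot']
      rwa [hA, hp] at this
    rcases (R.gp.ori_ne R.eps hpP hb1P hhP hpb1 hhp.symm hhb1.symm).lt_or_gt with hs | hs
    · have hs' : 0 < ori ε p h b₁ := by rw [ori_swap']; linarith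
      have hAo : ori ε h b₁ A < 0 := by
        refine lt_of_le_of_ne (not_lt.1 fun hcon => ?_) (R.gp.ori_ne R.eps hhP hb1P hAP hhb1 hhA
          hb1A)
        refine R.c_notMem_openTriangle (i - 1) hpP hhP hb1P hhp.symm hpb1 hhb1 ?_
        rw [hA, mem_openTriangle_iff hs']
        exact ⟨shA, hcon, by rwa [ori_rot']⟩
      obtain ⟨x, hx, hx'⟩ := openSegment_inter_nonempty (ε := ε) (p := p) (q := A) (g := h)
        (h := b₁) (by rw [ori_swap']; linarith) sAb1 (by rwa [ori_rot]) hAo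
      rw [openSegment_symm] at hx'
      exact R.nb_notMem hpA (by rwa [hA]) (hU hx')
    · have e1 : 0 < ori (-ε) h b₁ p := by rwa [ori_neg, ori_rot, ori_swap', neg_neg]
      have e2 : 0 < ori (-ε) b₁ A p := by rwa [ori_neg, ori_rot, ori_swap', neg_neg]
      have e3 : 0 < ori (-ε) A h p := by rwa [ori_neg, ori_rot, ori_swap', neg_neg]
      have e4 : 0 < ori (-ε) h b₁ A := by rw [← ori_sum _ _ _ _ p]; linarith
      have hpt : p ∈ openTriangle h b₁ A := (mem_openTriangle_iff e4).2 ⟨e1, e2, e3⟩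
      have hAU : TriangulationEdge (tiles P c a (flipIndex k i f)) b₁ A :=
        hA ▸ A'.triangulationEdge_of_nb hb1A'
      have hhA' : TriangulationEdge (tiles P c a (flipIndex k i f)) A h := by
        have : Nb a (flipIndex k i f) h (i - 1) := by
          obtain ⟨w, hw1, hw2, rfl⟩ := hh
          rw [sub_add_cancel] at hw2
          refine ⟨w, ?_, ?_, rfl⟩
          · rwa [Frame.flipIndex_of_not_dvd (R.not_dvd_of_succ (by simp))]
          · rw [sub_add_cancel, Frame.flipIndex_of_dvd (by simp)]; omega
        obtain ⟨h1, t, h2, h3, h4⟩ := A'.triangulationEdge_of_nb this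
        rw [hA] at h1 h4
        exact ⟨h1.symm, t, h2, h4, h3⟩
      by_cases hqt : q ∈ openTriangle h b₁ A
      · exact A'.spoke_exit hhP hb1P hAP hhb1 hhA hb1A hqi' hqt (R.nb_ne _ hh).symm
          (by rw [← hb1']; exact R.c_ne_a _ _) (by rw [← hA]; exact (R.c_ne_pred i).symm)
          (Or.inr (by rwa [openSegment_symm])) (Or.inl hAU) (Or.inl hhA')
      · rcases R.gp.exit hhP hb1P hAP hhb1 hhA hb1A hpP hqP hd.1 hpt (left_mem_segment _ _ _)
          hd.1 hqt with (h' | h' | h') | ⟨w, hw, -, -, h' | h' | h'⟩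
        · exact hhq h'.symm
        · exact hqb1 h'
        · rw [← hA] at h'
          exact R.nb_ne _ hqi h'
        · exact R.wall_notMem (Or.inr hD) (openSegment_subset_segment _ _ _
            (by rwa [openSegment_symm])) (hd.2.2.2 hw)
        · exact A'.notMem_polygonInterior_of_mem_edge hAU (openSegment_subset_segment _ _ _ h')
            (hUd hw)
        · exact A'.notMem_polygonInterior_of_mem_edge hhA' (openSegment_subset_segment _ _ _ h')
            (hUd hw)
  obtain ⟨i1, i2, i3⟩ := R.insert_diagonal hd
  have hpq : ∀ j, Nb a (flipIndex k i f) p j → ¬ Nb a (flipIndex k i f) q j := by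
    intro j hpj hqj
    have hj := R.nb_flip_self (hp ▸ hpj)
    rcases R.nb_flip hqj with h | ⟨-, h⟩
    · exact hqA (R.nb_congr hj h)
    · exact hqb1 (h.trans hb1')
  have := R.max _ ε c a _ (insert s(p, q) D) A' ⟨i2, i3, by
    rintro g h (h' | h') j hg hh
    · rcases Sym2.eq_iff.1 h' with ⟨rfl, rfl⟩ | ⟨rfl, rfl⟩
      · exact hpq j hg hh
      · exact hpq j hh hg
    · rcases R.nb_flip hg with hg | ⟨hj, hg⟩ <;> rcases R.nb_flip hh with hh | ⟨hj', hh⟩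
      · exact R.dis.free g h h' j hg hh
      · rw [hb1'] at hh; subst hh
        exact key g (by rwa [Sym2.eq_swap]) (R.nb_congr hj' hg)
      · rw [hb1'] at hg; subst hg
        exact key h h' (R.nb_congr hj hh)
      · exact (R.dis.diagonal g h h').1 (hg.trans hh.symm)⟩
  rw [Set.ncard_insert_of_notMem i1 R.finite] at this
  omega

end Region

end FourConn

namespace FourConn

variable {P : Finset Plane} {C : List Plane} {T : Finset (Finset Plane)} {ε : ℝ} {k n : ℤ}
  {c a : ℤ → Plane} {f : ℤ → ℤ} {D : Set (Sym2 Plane)} {W : Set Plane}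

/-- A diagonal of a region whose ends are seen by the hull vertex with index `i`. -/
def SeenDiagonal (C : List Plane) (W : Set Plane) (a : ℤ → Plane) (f : ℤ → ℤ) (i s t : ℤ) : Prop :=
  f i ≤ s ∧ s < t ∧ t ≤ f (i + 1) ∧ IsDiagonal C W (a s) (a t)

theorem SeenDiagonal.reverse {i s t : ℤ} :
    SeenDiagonal C W (fun m => a (-m)) (fun i => -f (1 - i)) (-i) (-t) (-s) ↔
      SeenDiagonal C W a f i s t := by
  have e1 : 1 - (-i + 1) = i := by ring
  have e2 : 1 - -i = i + 1 := by ring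
  simp only [SeenDiagonal, e1, e2, neg_neg, neg_le_neg_iff, neg_lt_neg_iff]
  constructor
  · rintro ⟨h1, h2, h3, h4⟩
    exact ⟨h3, h2, h1, h4.symm⟩
  · rintro ⟨h1, h2, h3, h4⟩
    exact ⟨h3, h2, h1, h4.symm⟩

namespace Region

theorem exists_longest (R : Region P C T ε k n c a f D W)
    (h4 : 4 ≤ (regionVertices C W).ncard) : ∃ i s t, SeenDiagonal C W a f i s t ∧
      ∀ i' s' t', SeenDiagonal C W a f i' s' t' → t' - s' ≤ t - s := by
  have hex : ∃ d i s t, SeenDiagonal C W a f i s t ∧ t - s = d := by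
    obtain ⟨p, q, hd⟩ := R.exists_isDiagonal h4
    obtain ⟨i, ⟨l, h1, h2, rfl⟩, ⟨m, h3, h4, rfl⟩⟩ := R.exists_nb_of_isDiagonal hd
    rcases lt_trichotomy l m with h | rfl | h
    · exact ⟨_, i, l, m, ⟨h1, h, h4, hd⟩, rfl⟩
    · exact absurd rfl hd.1
    · exact ⟨_, i, m, l, ⟨h3, h, h2, hd.symm⟩, rfl⟩
  obtain ⟨d, ⟨i, s, t, h, rfl⟩, hmax⟩ := Int.exists_greatest_of_bdd
    (P := fun d => ∃ i s t, SeenDiagonal C W a f i s t ∧ t - s = d) ⟨n, by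
      rintro d ⟨i, s, t, ⟨h1, h2, h3, -⟩, rfl⟩
      have := R.width i
      omega⟩ hex
  exact ⟨i, s, t, h, fun i' s' t' h' => hmax _ ⟨i', s', t', h', rfl⟩⟩

theorem nb_left {i s t : ℤ} (h : SeenDiagonal C W a f i s t) : Nb a f (a s) i :=
  ⟨s, h.1, h.2.1.le.trans h.2.2.1, rfl⟩

theorem nb_right {i s t : ℤ} (h : SeenDiagonal C W a f i s t) : Nb a f (a t) i :=
  ⟨t, h.1.trans h.2.1.le, h.2.2.1, rfl⟩

theorem ori_triangle_ne {σ : ℝ} {p q z : Plane} (h : 0 < ori σ p q z) : orient p q z ≠ 0 :=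
  fun h' => by simp [ori, h'] at h

/-- The apex of the outer triangle on a longest seen diagonal is not seen by the same vertex. -/
theorem not_nb_apex (R : Region P C T ε k n c a f D W) {i s t : ℤ} {z : Plane}
    (hb : SeenDiagonal C W a f i s t)
    (hmax : ∀ i' s' t', SeenDiagonal C W a f i' s' t' → t' - s' ≤ t - s) (hz : z ∈ C)
    (hzo : 0 < ori ε (a s) (a t) z) (hzW : openTriangle (a s) (a t) z ⊆ W) : ¬ Nb a f z i := by
  intro hzi
  have hb' := hb
  obtain ⟨h1, h2, h3, hd⟩ := hb'
  have ho := ori_triangle_ne hzo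
  obtain ⟨u, hu1, hu2, rfl⟩ := id hzi
  have hus : u ≠ s := by rintro rfl; simp at hzo
  have hut : u ≠ t := by rintro rfl; simp at hzo
  have hwall : ∀ {x y : ℤ}, f i ≤ x → x < y → y ≤ f (i + 1) → s(a x, a y) ∈ walls a D →
      y = x + 1 := by
    rintro x y h4 h5 h6 (⟨m, hm⟩ | hm)
    · exact R.window_succ h4 h5 h6 hm
    · exact absurd ⟨y, by omega, h6, rfl⟩ (R.dis.free _ _ hm i ⟨x, h4, by omega, rfl⟩)
  rcases lt_or_gt_of_ne hut with hut | hut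
  · rcases lt_or_gt_of_ne hus with hus | hus
    · rcases R.wall_or_isDiagonal (p := a u) (q := a t) (z := a s) hz (R.a_mem_C _)
        (by rw [orient_swap, orient_rot]; simpa using ho)
        (by rwa [openTriangle_swap, openTriangle_rot]) with hw | hw
      · have := hwall hu1 (by omega) h3 hw
        omega
      · have := hmax i u t ⟨hu1, by omega, h3, hw⟩
        omega
    · have := R.mem_triangle_of_between h1 hus hut h3 (hd.2.2.2.trans R.subset_interior)
      rw [← openTriangle_swap', mem_openTriangle_iff (R.angular h1 h2 h3)] at this
      have h6 := this.2.2
      rw [ori_swap] at h6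
      linarith
  · rcases R.wall_or_isDiagonal (p := a s) (q := a u) (z := a t) (R.a_mem_C _) hz
      (by rw [orient_swap, orient_rot, orient_rot]; simpa using ho)
      (by rwa [openTriangle_swap']) with hw | hw
    · have := hwall h1 (by omega) hu2 hw
      omega
    · have := hmax i s u ⟨h1, by omega, hu2, hw⟩
      omega

/-- The left side of the outer triangle on a longest seen diagonal is not a diagonal. -/
theorem not_isDiagonal_left (R : Region P C T ε k n c a f D W) {i s t : ℤ} {z : Plane}
    (hb : SeenDiagonal C W a f i s t) (hzi : ¬ Nb a f z i) (hz : z ∈ C)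
    (hzo : 0 < ori ε (a s) (a t) z) (hzW : openTriangle (a s) (a t) z ⊆ W) :
    ¬ IsDiagonal C W (a s) z := by
  intro hd'
  have hpi := nb_left hb
  have hqi := nb_right hb
  obtain ⟨h1, h2, h3, hd⟩ := hb
  obtain ⟨j, hpj, hzj⟩ := R.exists_nb_of_isDiagonal hd'
  obtain ⟨rfl, hj⟩ : s = f i ∧ c j = c (i - 1) := by
    rcases R.nb_cases h1 (by omega) hpj with h | ⟨h, -⟩ | h
    · exact absurd (R.nb_congr h hzj) hzi
    · omega
    · exact h
  have hpA := R.nb_congr hj hpj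
  have hzA := R.nb_congr hj hzj
  have hqA : ¬ Nb a f (a t) (i - 1) := fun h => hd.1
    (R.nb_unique hpi hqi hpA h (R.c_ne_pred i).symm)
  obtain ⟨w, hw1, hw2, rfl⟩ := id hzA
  rw [sub_add_cancel] at hw2
  have hw3 : w ≠ f i := by rintro rfl; exact hd'.1 rfl
  have szA : 0 < ori ε (a (f i)) (a w) (c (i - 1)) := by
    rw [ori_rot']
    exact R.angular hw1 (lt_of_le_of_ne hw2 hw3) (by simp)
  have sBq := R.angular h1 h2 h3
  have sAB : 0 < ori ε (a (f i)) (c (i - 1)) (c i) := by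
    rw [ori_rot']; exact R.hull_a' i _
  obtain ⟨b, hbC, hbW, hbt⟩ := R.exists_inner hd hpi hqi
  obtain ⟨b', hbC', hbW', hbt'⟩ := R.exists_inner hd' hpA hzA
  have hUd := hd.2.2.2.trans R.subset_interior
  have hUd' := hd'.2.2.2.trans R.subset_interior
  have n1 : ¬ IsDiagonal C W b (a w) := by
    intro h
    obtain ⟨l, hl1, hl2⟩ := R.exists_nb_of_isDiagonal h
    exact hzi (R.nb_congr (R.nb_of_mem_triangle hpi hqi hd.1 hUd hbt hl1) hl2)
  have n2 : ¬ IsDiagonal C W b' (a t) := by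
    intro h
    obtain ⟨l, hl1, hl2⟩ := R.exists_nb_of_isDiagonal h
    exact hqA (R.nb_congr (R.nb_of_mem_triangle hpA hzA hd'.1 hUd' hbt' hl1) hl2)
  have sb : 0 < ori ε (a t) (a (f i)) b := by
    have := hbt
    rw [← openTriangle_swap', mem_openTriangle_iff sBq] at this
    exact this.2.2
  have sb' : 0 < ori ε (a (f i)) (a w) b' := ((mem_openTriangle_iff szA).1 hbt').1
  have r1 : 0 < ori ε b (a w) (a (f i)) := by
    by_contra h
    refine R.no_reflex h2 h3 hd hz hzo szA hbC hbW hbt ?_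
    rw [ori_rot']; linarith
  have r2 : ori ε b' (a t) (a (f i)) < 0 := by
    by_contra h
    have key := R.reverse.no_reflex (i := 1 - i) (t := -w) (z := a t) (b := b')
    have e1 : 1 - (1 - i) = i := by ring
    have e2 : 1 - (1 - i + 1) = i - 1 := by ring
    have e3 : -(1 - i - 1) = i := by ring
    have e4 : -(1 - i) = i - 1 := by ring
    simp only [e1, e2, e3, e4, neg_neg] at key
    refine key (by omega) (by omega) hd' (R.a_mem_C _) ?_ ?_ hbC' hbW' hbt' ?_
    · rwa [ori_neg, ori_swap', neg_neg]
    · rwa [ori_neg, ori_swap', neg_neg]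
    · rw [ori_neg, ori_rot']; linarith
  have r3 : 0 ≤ ori ε b (a w) (a t) := by
    by_contra h
    exact n1 (isDiagonal_of_quad hd hbC hz hbW hzW (by rw [ori_swap]; linarith) hzo r1 (by linarith))
  have r4 : ori ε b' (a t) (a w) ≤ 0 := by
    by_contra h
    refine n2 (isDiagonal_of_quad (σ := -ε) hd' hbC' (R.a_mem_C _) hbW' ?_ ?_ ?_ ?_ ?_)
    · rwa [openTriangle_swap']
    · rw [ori_neg]; linarith
    · rwa [ori_neg, ori_swap', neg_neg]
    · rw [ori_neg]; linarith
    · rw [ori_neg]; linarith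
  rw [ori_rev] at r3
  rw [ori_rot'] at r4
  have s1 : 0 < ori ε (a t) (a w) (a (f i)) := by rwa [ori_rot]
  have tB : ori ε (a t) (a w) (c i) < 0 := by
    obtain ⟨α, β, γ, hα, hβ, hγ, hs, rfl⟩ := hbt
    rw [ori_comb _ _ _ _ _ _ hs, ori_left] at r3
    by_contra h
    have := mul_pos hα s1
    have := mul_nonneg hγ.le (not_lt.1 h)
    linarith
  have tA : ori ε (a t) (a w) (c (i - 1)) < 0 := by
    obtain ⟨α, β, γ, hα, hβ, hγ, hs, rfl⟩ := hbt'
    rw [ori_comb _ _ _ _ _ _ hs, ori_right] at r4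
    by_contra h
    have := mul_pos hα s1
    have := mul_nonneg hγ.le (not_lt.1 h)
    linarith
  have pl := ori_plucker ε (a (f i)) (c i) (a t) (a w) (c (i - 1))
  have m1 := ori_sum ε (a (f i)) (a t) (a w) (c i)
  have m2 := ori_sum ε (a (f i)) (a t) (a w) (c (i - 1))
  rw [ori_rot' ε (a (f i)) (c i) (a w), ori_swap' ε (a (f i)) (c i) (a t)] at m1
  rw [ori_rot' ε (a (f i)) (c (i - 1)) (a w), ori_swap' ε (a (f i)) (a w) (c (i - 1))] at m2
  have sBA : ori ε (a (f i)) (c i) (c (i - 1)) < 0 := by rw [ori_swap']; linarith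
  have p1 := mul_pos hzo (neg_pos.2 sBA)
  have p2 := mul_lt_mul'' (a := ori ε (a (f i)) (c i) (a t)) (b := ori ε (a (f i)) (c i) (a w))
    (c := ori ε (a (f i)) (a w) (c (i - 1))) (d := ori ε (a (f i)) (a t) (c (i - 1)))
    (by linarith) (by linarith) sBq.le szA.le
  linarith

end Region

end FourConn

namespace FourConn

variable {P : Finset Plane} {C : List Plane} {T : Finset (Finset Plane)} {ε : ℝ} {k n : ℤ}
  {c a : ℤ → Plane} {f : ℤ → ℤ} {D : Set (Sym2 Plane)} {W : Set Plane}

/-- The part of an enumeration between two indices, as a list. -/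
def stretch {α : Type*} (a : ℤ → α) (s : ℤ) (N : ℕ) : List α :=
  (List.range N).map (fun r : ℕ => a (s + r))

theorem mem_stretch {α : Type*} {a : ℤ → α} {s : ℤ} {N : ℕ} {p : α} :
    p ∈ stretch a s N ↔ ∃ u, s ≤ u ∧ u < s + N ∧ p = a u := by
  simp only [stretch, List.mem_map, List.mem_range]
  constructor
  · rintro ⟨r, hr, rfl⟩
    exact ⟨s + r, by omega, by omega, rfl⟩
  · rintro ⟨u, h1, h2, rfl⟩
    refine ⟨(u - s).toNat, by omega, ?_⟩
    rw [Int.toNat_of_nonneg (by omega)]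
    congr 1; ring

theorem stretch_cons {α : Type*} {a : ℤ → α} (s : ℤ) (N : ℕ) : stretch a s (N + 2) =
    a s :: (stretch a (s + 1) N ++ [a (s + N + 1)]) := by
  simp only [stretch]
  rw [List.range_succ, List.range_succ_eq_map]
  simp only [List.map_append, List.map_cons, List.map_map, List.map_nil, List.cons_append]
  congr 1
  · simp
  · congr 1
    · refine List.map_congr_left fun r _ => ?_
      simp only [Function.comp]
      congr 1; push_cast; ring
    · congr 2; push_cast; ring

theorem stretch_prefix {α : Type*} {a : ℤ → α} {s : ℤ} {N M : ℕ} (h : N ≤ M) : stretch a s N <+: stretch a s M := by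
  obtain ⟨d, rfl⟩ := Nat.exists_eq_add_of_le h
  refine List.IsPrefix.map _ ?_
  rw [List.range_add]
  exact List.prefix_append _ _

theorem Frame.nodup_stretch (F : Frame P ε k n c a f) {s : ℤ} {N : ℕ} (h : N ≤ n) :
    (stretch a s N).Nodup := by
  refine List.Nodup.map_on ?_ List.nodup_range
  intro x hx y hy hxy
  rw [List.mem_range] at hx hy
  by_contra hne
  rcases lt_or_gt_of_ne hne with h' | h'
  · exact F.a_ne (by omega) (by omega) hxy
  · exact F.a_ne (by omega) (by omega) hxy.symm

namespace Region

theorem wall_spoke (R : Region P C T ε k n c a f D W) {g h x w : Plane} {i : ℤ}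
    (hgh : s(g, h) ∈ walls a D) (hx : Nb a f x i) (hw : w ∈ openSegment ℝ g h)
    (hw' : w ∈ openSegment ℝ x (c i)) : False := by
  rcases hgh with ⟨m, hm⟩ | hgh
  · have hT : TriangulationEdge T g h := by
      rcases Sym2.eq_iff.1 hm with ⟨rfl, rfl⟩ | ⟨rfl, rfl⟩
      · exact R.triangulationEdge_succ m
      · obtain ⟨h1, t, h2, h3, h4⟩ := R.triangulationEdge_succ m
        exact ⟨h1.symm, t, h2, h4, h3⟩
    refine R.edges_disjoint hT (R.triangulationEdge_of_nb hx) ?_ hw hw'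
    rw [hm]
    intro he
    rcases Sym2.eq_iff.1 he with ⟨-, h⟩ | ⟨h, -⟩
    · exact R.c_ne_a _ _ h.symm
    · exact R.c_ne_a _ _ h.symm
  · exact R.nb_notMem hx hw' ((R.dis.diagonal _ _ hgh).2.2.2 hw)

theorem wall_window (R : Region P C T ε k n c a f D W) {i s t : ℤ}
    (hb : SeenDiagonal C W a f i s t) {g h x : Plane} (hgh : s(g, h) ∈ walls a D)
    (hx : x ∈ segment ℝ g h) (hxt : x ∈ openTriangle (a s) (a t) (c i)) :
    ∃ u, s ≤ u ∧ u ≤ t ∧ h = a u := by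
  classical
  have hpi := nb_left hb
  have hqi := nb_right hb
  obtain ⟨h1, h2, h3, hd⟩ := hb
  have G := R.isPlaneGraph R.dis
  have hgC : g ∈ C := by simpa using G.mem _ _ hgh
  have hhC : h ∈ C := by simpa using G.mem' hgh
  by_cases hht : h ∈ openTriangle (a s) (a t) (c i)
  · obtain ⟨m, rfl⟩ := (R.vert h).1 hhC
    obtain ⟨u, h4, h5, h6⟩ := R.between_of_mem_triangle h1 h2 h3
      (hd.2.2.2.trans R.subset_interior) hht
    exact ⟨u, h4.le, h5.le, h6⟩
  · rcases R.gp.exit (R.a_mem s) (R.a_mem t) (R.c_mem i) hd.1 (R.c_ne_a _ _).symm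
      (R.c_ne_a _ _).symm (R.mem_of_vert hgC) (R.mem_of_vert hhC) (G.ne _ _ hgh) hxt hx
      (by rintro rfl; exact hht hxt) hht with (h' | h' | h') | ⟨w, hw, -, -, h' | h' | h'⟩
    · exact ⟨s, le_rfl, h2.le, h'⟩
    · exact ⟨t, h2.le, le_rfl, h'⟩
    · obtain ⟨m, rfl⟩ := (R.vert h).1 hhC
      exact absurd h'.symm (R.c_ne_a _ _)
    · exact absurd (hd.2.2.2 h') (R.wall_notMem hgh (openSegment_subset_segment _ _ _ hw))
    · exact (R.wall_spoke hgh hqi hw h').elim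
    · exact (R.wall_spoke hgh hpi hw (by rwa [openSegment_symm])).elim

/-- Below a seen diagonal, the region fills the part of the triangle outside the fan. -/
theorem mem_of_outside (R : Region P C T ε k n c a f D W) {i s t : ℤ}
    (hb : SeenDiagonal C W a f i s t) {x : Plane} (hx : x ∈ openTriangle (a s) (a t) (c i))
    (hout : ∀ m, s ≤ m → m < t → x ∉ convexHull ℝ {a m, c i, a (m + 1)}) : x ∈ W := by
  have hfree : ∀ x ∈ openTriangle (a s) (a t) (c i),
      (∀ m, s ≤ m → m < t → x ∉ convexHull ℝ {a m, c i, a (m + 1)}) → x ∉ edgeSet (walls a D) := by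
    rintro x hx hout ⟨g, h, hgh, hxs⟩
    obtain ⟨u, hu1, hu2, rfl⟩ := R.wall_window hb hgh hxs hx
    obtain ⟨v, hv1, hv2, rfl⟩ := R.wall_window hb (by rwa [Sym2.eq_swap]) (by rwa [segment_symm]) hx
    obtain ⟨h1, h2, h3, hd⟩ := hb
    have hw := R.width i
    have succ : ∀ {x y : ℤ}, s ≤ x → x ≤ t → s ≤ y → y ≤ t → ∀ m, a x = a m → a y = a (m + 1) →
        y = x + 1 := by
      intro x y hx1 hx2 hy1 hy2 m e1 e2
      rw [R.a_iff] at e1 e2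
      have h := dvd_sub e2 e1
      have := Int.eq_zero_of_abs_lt_dvd h (by rw [abs_lt]; constructor <;> omega)
      omega
    rcases hgh with ⟨m, hm⟩ | hgh
    · rcases Sym2.eq_iff.1 hm with ⟨e1, e2⟩ | ⟨e1, e2⟩
      · obtain rfl := succ hv1 hv2 hu1 hu2 m e1 e2
        exact hout v hv1 (by omega) ((convex_convexHull ℝ _).segment_subset
          (subset_convexHull ℝ _ (by simp)) (subset_convexHull ℝ _ (by simp)) hxs)
      · obtain rfl := succ hu1 hu2 hv1 hv2 m e2 e1
        exact hout u hu1 (by omega) ((convex_convexHull ℝ _).segment_subset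
          (subset_convexHull ℝ _ (by simp)) (subset_convexHull ℝ _ (by simp)) hxs)
    · exact R.dis.free _ _ hgh i ⟨v, by omega, by omega, rfl⟩ ⟨u, by omega, by omega, rfl⟩
  have hd := hb.2.2.2
  obtain ⟨α, β, γ, hα, hβ, hγ, hs, hxe⟩ := id hx
  have hαβ : 0 < α + β := by positivity
  set y : Plane := (α / (α + β)) • a s + (β / (α + β)) • a t with hy
  have hyo : y ∈ openSegment ℝ (a s) (a t) :=
    ⟨_, _, by positivity, by positivity, by field_simp, rfl⟩
  have hyc : y ∈ convexHull ℝ {a s, a t, c i} := (convex_convexHull ℝ _).segment_subset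
    (subset_convexHull ℝ _ (by simp)) (subset_convexHull ℝ _ (by simp))
    (openSegment_subset_segment _ _ _ hyo)
  have hyW := hd.2.2.2 hyo
  have hxy : x = (1 - γ) • y + γ • c i := by
    rw [hxe, hy, show 1 - γ = α + β by linarith, smul_add, smul_smul, smul_smul,
      mul_div_cancel₀ _ hαβ.ne', mul_div_cancel₀ _ hαβ.ne']
  refine R.absorb (isPreconnected_segment x y) ?_ (right_mem_segment _ _ _) hyW
    (left_mem_segment _ _ _)
  rintro w ⟨μ, ν, hμ, hν, hμν, rfl⟩
  rcases hμ.eq_or_lt with rfl | hμ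
  · rw [show ν = 1 by linarith]
    simpa using R.notMem_walls hyW
  refine hfree _ (comb_mem_openTriangle hx hyc hμ hν hμν) fun m hm1 hm2 hcon => hout m hm1 hm2 ?_
  have hδ : 0 < 1 - μ * γ := by nlinarith
  have e : x = ((γ - μ * γ) / (1 - μ * γ)) • c i +
      ((1 - γ) / (1 - μ * γ)) • (μ • x + ν • y) := by
    have e1 : μ • x + ν • y = (1 - μ * γ) • y + (μ * γ) • c i := by
      rw [hxy, show ν = 1 - μ by linarith]; module
    rw [e1, smul_add, smul_smul, smul_smul, div_mul_cancel₀ _ hδ.ne', hxy]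
    have : (γ - μ * γ) / (1 - μ * γ) + (1 - γ) / (1 - μ * γ) * (μ * γ) = γ := by
      rw [div_mul_eq_mul_div, ← add_div, div_eq_iff hδ.ne']; ring
    rw [add_left_comm, ← add_smul, this]
  rw [e]
  refine (convex_convexHull ℝ _) (subset_convexHull ℝ _ (by simp)) hcon ?_ ?_ ?_
  · have : 0 ≤ γ - μ * γ := by nlinarith
    positivity
  · have : 0 < 1 - γ := by linarith
    positivity
  · rw [← add_div, div_eq_one_iff_eq hδ.ne']; ring

theorem mem_closure_of_between (R : Region P C T ε k n c a f D W) {i s t u : ℤ}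
    (hb : SeenDiagonal C W a f i s t) (h1 : s < u) (h2 : u < t) : a u ∈ closure W := by
  classical
  have hbt := R.mem_triangle_of_between hb.1 h1 h2 hb.2.2.1
    (hb.2.2.2.2.2.2.trans R.subset_interior)
  let l : ℝ → Plane := fun θ => (1 + θ) • a u + (-θ) • c i
  have hl : Continuous l := by fun_prop
  have hl0 : l 0 = a u := by simp [l]
  have ho := isOpen_openTriangle (R.gp.orient_ne (R.a_mem s) (R.a_mem t) (R.c_mem i) hb.2.2.2.1
    (R.c_ne_a _ _).symm (R.c_ne_a _ _).symm)
  have hev : ∀ᶠ θ in nhdsWithin (0 : ℝ) (Set.Ioi 0), l θ ∈ W := by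
    have h3 : ∀ᶠ θ in nhds (0 : ℝ), l θ ∈ openTriangle (a s) (a t) (c i) :=
      (hl.tendsto 0).eventually (ho.mem_nhds (by rwa [hl0]))
    filter_upwards [self_mem_nhdsWithin, nhdsWithin_le_nhds h3] with θ hθ hlθ
    refine R.mem_of_outside hb hlθ fun m hm1 hm2 hcon => ?_
    rw [Set.mem_Ioi] at hθ
    have hf1 : f i ≤ m := hb.1.trans hm1
    have hf2 : m < f (i + 1) := hm2.trans_le hb.2.2.1
    have hau : a u ∈ convexHull ℝ {a m, c i, a (m + 1)} := by
      have e : a u = (θ / (1 + θ)) • c i + (1 / (1 + θ)) • l θ := by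
        have hθ' : (1 + θ) ≠ 0 := by positivity
        simp only [l]
        rw [smul_add, smul_smul, smul_smul, one_div_mul_cancel hθ']
        have : θ / (1 + θ) + 1 / (1 + θ) * -θ = 0 := by field_simp; ring
        rw [add_left_comm, ← add_smul, this]; simp
      rw [e]
      exact (convex_convexHull ℝ _) (subset_convexHull ℝ _ (by simp)) hcon (by positivity)
        (by positivity) (by field_simp; ring)
    have hem := R.tri.empty _ (R.fan_tile hf1 hf2) _ (R.a_mem u) (by rwa [coe_triple])
    have hfan := R.fan i m hf1 hf2
    have h6 := ((mem_convexHull_iff hfan).1 hcon).2.2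
    simp only [l] at h6
    rw [ori_comb_two _ _ _ _ _ (by ring)] at h6
    rw [← ori_rot' ε (a m) (c i) (a (m + 1))] at hfan
    have h7 := mul_pos hθ hfan
    simp only [Finset.mem_insert, Finset.mem_singleton] at hem
    rcases hem with h | h | h
    · rw [h, ori_right] at h6; linarith
    · exact R.c_ne_a _ _ h.symm
    · rw [h, ori_left] at h6; linarith
  have ht : Filter.Tendsto l (nhdsWithin (0 : ℝ) (Set.Ioi 0)) (nhds (a u)) := by
    have := hl.tendsto 0
    rw [hl0] at this
    exact this.mono_left nhdsWithin_le_nhds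
  exact mem_closure_of_tendsto ht hev

theorem vertex_cases (R : Region P C T ε k n c a f D W) {i s t : ℤ} {z : Plane}
    (hb : SeenDiagonal C W a f i s t) (hz : z ∈ C) (hzo : 0 < ori ε (a s) (a t) z)
    (hzW : openTriangle (a s) (a t) z ⊆ W) (w1 : s(a s, z) ∈ walls a D)
    (w2 : s(a t, z) ∈ walls a D) {v : Plane} (hv : v ∈ regionVertices C W) :
    v = z ∨ ∃ u, s ≤ u ∧ u ≤ t ∧ v = a u := by
  have hpi := nb_left hb
  have hqi := nb_right hb
  obtain ⟨h1, h2, h3, hd⟩ := hb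
  have hUd := hd.2.2.2.trans R.subset_interior
  have ho := ori_triangle_ne hzo
  have hB : ori ε (a s) (a t) (c i) < 0 := by
    have := R.angular h1 h2 h3
    rw [ori_swap']; linarith
  have hB' : 0 < ori (-ε) (a s) (a t) (c i) := by rw [ori_neg]; linarith
  have hoB := ori_triangle_ne hB'
  let Q : Set Plane := {x | (ori ε (a s) (a t) x < 0 ∨ (0 < ori ε (a t) z x ∧ 0 < ori ε z (a s) x)) ∧
    (0 < ori ε (a s) (a t) x ∨ (ori ε (a t) (c i) x < 0 ∧ ori ε (c i) (a s) x < 0))}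
  have hQo : IsOpen Q := by
    have c0 := ori_continuous ε (a s) (a t)
    refine IsOpen.inter (IsOpen.union (isOpen_lt c0 continuous_const) (IsOpen.inter
      (isOpen_lt continuous_const (ori_continuous _ _ _))
      (isOpen_lt continuous_const (ori_continuous _ _ _)))) (IsOpen.union
      (isOpen_lt continuous_const c0) (IsOpen.inter
      (isOpen_lt (ori_continuous _ _ _) continuous_const)
      (isOpen_lt (ori_continuous _ _ _) continuous_const)))
  have hQ1 : openTriangle (a s) (a t) z ⊆ Q := fun x hx => by
    obtain ⟨e1, e2, e3⟩ := (mem_openTriangle_iff hzo).1 hx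
    exact ⟨Or.inr ⟨e2, e3⟩, Or.inl e1⟩
  have hQ2 : openTriangle (a s) (a t) (c i) ⊆ Q := fun x hx => by
    obtain ⟨e1, e2, e3⟩ := (mem_openTriangle_iff hB').1 hx
    rw [ori_neg] at e1 e2 e3
    exact ⟨Or.inl (by linarith), Or.inr ⟨by linarith, by linarith⟩⟩
  have hQ0 : openSegment ℝ (a s) (a t) ⊆ Q := by
    rintro x ⟨α, β, hα, hβ, hαβ, rfl⟩
    have p1 := mul_pos hα hzo
    have p2 := mul_pos hβ hzo
    have p3 := mul_pos hα (neg_pos.2 hB)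
    have p4 := mul_pos hβ (neg_pos.2 hB)
    refine ⟨Or.inr ⟨?_, ?_⟩, Or.inr ⟨?_, ?_⟩⟩
    · rw [ori_comb_two _ _ _ _ _ hαβ, ori_left, ori_rot]; linarith
    · rw [ori_comb_two _ _ _ _ _ hαβ, ori_right, ori_rot' ε (a s) (a t) z]; linarith
    · rw [ori_comb_two _ _ _ _ _ hαβ, ori_left, ori_rot]; linarith
    · rw [ori_comb_two _ _ _ _ _ hαβ, ori_right, ori_rot' ε (a s) (a t) (c i)]; linarith
  have hQc : closure Q ⊆ convexHull ℝ {a s, a t, z} ∪ convexHull ℝ {a s, a t, c i} := by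
    refine closure_minimal ?_ ((isClosed_convexHull_triple _ _ _).union
      (isClosed_convexHull_triple _ _ _))
    rintro x ⟨e1, e2⟩
    rcases lt_trichotomy (ori ε (a s) (a t) x) 0 with h | h | h
    · obtain ⟨e3, e4⟩ := e2.resolve_left (not_lt.2 h.le)
      exact Or.inr ((mem_convexHull_iff hB').2 ⟨by rw [ori_neg]; linarith, by
        rw [ori_neg]; linarith, by rw [ori_neg]; linarith⟩)
    · obtain ⟨e3, e4⟩ := e1.resolve_left (not_lt.2 h.ge)
      exact Or.inl ((mem_convexHull_iff hzo).2 ⟨h.ge, e3.le, e4.le⟩)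
    · obtain ⟨e3, e4⟩ := e1.resolve_left (not_lt.2 h.le)
      exact Or.inl ((mem_convexHull_iff hzo).2 ⟨h.le, e3.le, e4.le⟩)
  have hseg : ∀ x ∈ W, x ∈ segment ℝ (a s) (a t) → x ∈ Q := by
    intro x hx hxs
    rcases mem_segment_cases hxs with rfl | rfl | h
    · exact absurd (a_mem_walls s) (R.notMem_walls hx)
    · exact absurd (a_mem_walls t) (R.notMem_walls hx)
    · exact hQ0 h
  have hW : W ⊆ Q := by
    have hc := centroid_mem_openTriangle (a s) (a t) z
    refine R.isPreconnected.subset_of_closure_inter_subset hQo ⟨_, hzW hc, hQ1 hc⟩ ?_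
    rintro x ⟨hxc, hx⟩
    rcases hQc hxc with h | h
    · by_cases ht : x ∈ openTriangle (a s) (a t) z
      · exact hQ1 ht
      rcases mem_edges_of_mem_convexHull ho h ht with h' | h' | h'
      · exact hseg x hx h'
      · exact absurd hx (R.wall_notMem w2 h')
      · exact absurd hx (R.wall_notMem w1 (by rwa [segment_symm]))
    · by_cases ht : x ∈ openTriangle (a s) (a t) (c i)
      · exact hQ2 ht
      rcases mem_edges_of_mem_convexHull hoB h ht with h' | h' | h'
      · exact hseg x hx h'
      · exact absurd (R.subset_interior hx)
          (R.notMem_polygonInterior_of_mem_edge (R.triangulationEdge_of_nb hqi) h')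
      · exact absurd (R.subset_interior hx) (R.notMem_polygonInterior_of_mem_edge
          (R.triangulationEdge_of_nb hpi) (by rwa [segment_symm]))
  rcases hQc (closure_mono hW hv.2) with h | h
  · rcases R.eq_of_mem_hull (R.a_mem_C s) (R.a_mem_C t) hz ho hzW hv.1 h with h | h | h
    · exact Or.inr ⟨s, le_rfl, h2.le, h⟩
    · exact Or.inr ⟨t, h2.le, le_rfl, h⟩
    · exact Or.inl h
  · right
    by_cases e1 : v = a s
    · exact ⟨s, le_rfl, h2.le, e1⟩
    by_cases e2 : v = a t
    · exact ⟨t, h2.le, le_rfl, e2⟩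
    obtain ⟨m, rfl⟩ := (R.vert v).1 hv.1
    obtain ⟨u, e3, e4, e5⟩ := R.between_of_mem_triangle h1 h2 h3 hUd (R.gp.mem_openTriangle
      (R.a_mem s) (R.a_mem t) (R.c_mem i) hd.1 (R.c_ne_a _ _).symm (R.c_ne_a _ _).symm (R.a_mem m)
      h e1 e2 (R.c_ne_a _ _).symm)
    exact ⟨u, e3.le, e4.le, e5⟩

/-- A region of a maximal dissection with at least four vertices is a fan. -/
theorem hasFanStructure (R : Region P C T ε k n c a f D W) {N : ℕ} {c₀ : ZMod N → Plane}
    (hc : ∀ i, ∃ j, c i = c₀ j) (h4 : 4 ≤ (regionVertices C W).ncard) :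
    HasFanStructure c₀ T C W := by
  obtain ⟨i, s, t, hb, hmax⟩ := R.exists_longest h4
  obtain ⟨z, hz, hzo, hzW⟩ := R.exists_triangle R.eps hb.2.2.2
  have hzi := R.not_nb_apex hb hmax hz hzo hzW
  have ho := ori_triangle_ne hzo
  have w1 : s(a s, z) ∈ walls a D := by
    refine (R.wall_or_isDiagonal (z := a t) (R.a_mem_C s) hz (by rw [orient_swap, orient_rot, orient_rot]; simpa using ho)
      (by rwa [openTriangle_swap'])).resolve_right (R.not_isDiagonal_left hb hzi hz hzo hzW)
  have w2 : s(a t, z) ∈ walls a D := by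
    refine (R.wall_or_isDiagonal (z := a s) (R.a_mem_C t) hz (by rwa [orient_rot])
      (by rwa [openTriangle_rot])).resolve_right fun h => ?_
    have := R.reverse.not_isDiagonal_left (SeenDiagonal.reverse.2 hb)
      (fun h => hzi (by simpa using Frame.nb_reverse.1 h)) hz
    simp only [neg_neg] at this
    exact this (by rwa [ori_neg, ori_swap, neg_neg]) (by rwa [openTriangle_swap]) h
  have hb' := hb
  obtain ⟨h1, h2, h3, hd⟩ := hb'
  have hwd := R.width i
  have hUd := hd.2.2.2.trans R.subset_interior
  obtain ⟨j, hj⟩ := hc i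
  obtain ⟨M, hM⟩ : ∃ M : ℕ, t = s + M + 1 := ⟨(t - s - 1).toNat, by omega⟩
  have hst : a s :: (stretch a (s + 1) M ++ [a t]) = stretch a s (M + 2) := by
    rw [stretch_cons, hM]
  have hmem : ∀ p, p ∈ a s :: (stretch a (s + 1) M ++ [a t]) ↔ ∃ u, s ≤ u ∧ u ≤ t ∧ p = a u := by
    intro p
    rw [hst, mem_stretch]
    constructor
    · rintro ⟨u, e1, e2, e3⟩; exact ⟨u, e1, by push_cast at e2; omega, e3⟩
    · rintro ⟨u, e1, e2, e3⟩; exact ⟨u, e1, by push_cast; omega, e3⟩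
  have hmid : ∀ p ∈ stretch a (s + 1) M, ∃ u, s < u ∧ u < t ∧ p = a u := by
    intro p hp
    obtain ⟨u, e1, e2, e3⟩ := mem_stretch.1 hp
    exact ⟨u, by omega, by omega, e3⟩
  have hcl := mem_closure_of_triangle hzW
  refine ⟨z, a s, stretch a (s + 1) M, a t, j, ?_, ?_, ?_, ?_, hd, ?_, ?_⟩
  · rw [List.nodup_cons]
    refine ⟨fun h => ?_, ?_⟩
    · obtain ⟨u, e1, e2, rfl⟩ := (hmem _).1 h
      exact hzi ⟨u, by omega, by omega, rfl⟩
    · rw [hst]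
      exact R.nodup_stretch (by push_cast; omega)
  · intro p
    rw [List.mem_cons, hmem]
    constructor
    · exact R.vertex_cases hb hz hzo hzW w1 w2
    · rintro (rfl | ⟨u, e1, e2, rfl⟩)
      · exact ⟨hz, hcl.2.2⟩
      · refine ⟨R.a_mem_C u, ?_⟩
        rcases e1.eq_or_lt with rfl | e1
        · exact hcl.1
        rcases e2.eq_or_lt with rfl | e2
        · exact hcl.2.1
        exact R.mem_closure_of_between hb e1 e2
  · obtain ⟨C', hC', rfl⟩ := R.rot s
    refine ⟨_, hC', ?_⟩
    rw [hst]
    exact stretch_prefix (by omega)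
  · intro p hp
    obtain ⟨u, e1, e2, rfl⟩ := (hmem _).1 hp
    rw [← hj]
    exact R.triangulationEdge_of_nb ⟨u, by omega, by omega, rfl⟩
  · intro p hp
    obtain ⟨u, e1, e2, rfl⟩ := hmid p hp
    rw [← hj]
    exact R.mem_triangle_of_between h1 e1 e2 h3 hUd
  · intro p hp hdp
    obtain ⟨u, e1, e2, rfl⟩ := (hmem _).1 hp
    rcases e1.eq_or_lt with rfl | e1
    · exact R.wall_not_isDiagonal w1 hdp.symm
    rcases e2.eq_or_lt with rfl | e2
    · exact R.wall_not_isDiagonal w2 hdp.symm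
    obtain ⟨l, hl1, hl2⟩ := R.exists_nb_of_isDiagonal hdp
    have hbt := R.mem_triangle_of_between h1 e1 e2 h3 hUd
    exact hzi (R.nb_congr (R.nb_of_mem_triangle (nb_left hb) (nb_right hb) hd.1 hUd hbt hl2) hl1)

end Region

end FourConn

namespace FourConn

/-! ### Frames whose spokes do not cross -/

/-- A frame in which the spokes do not cross and the triangles contain no points. -/
structure Spoked (P : Finset Plane) (ε : ℝ) (k n : ℤ) (c a : ℤ → Plane) (f : ℤ → ℤ) : Prop
    extends Frame P ε k n c a f where
  spokes : ∀ x y i j, Nb a f x i → Nb a f y j → s(x, c i) ≠ s(y, c j) →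
    ∀ w ∈ openSegment ℝ x (c i), w ∉ openSegment ℝ y (c j)
  spoke_hull : ∀ x i j, Nb a f x j → ∀ w ∈ openSegment ℝ x (c j),
    w ∉ openTriangle (c i) (a (f i)) (c (i - 1))
  empty_hull : ∀ i, ∀ x ∈ P, x ∉ openTriangle (c i) (a (f i)) (c (i - 1))
  empty_fan : ∀ i m l, f i ≤ m → m < f (i + 1) → a l ∉ openTriangle (a m) (c i) (a (m + 1))

/-- The triangle `u v w` is a tile; its sides `uv` and `vw` are spokes. -/
def Corner (c a : ℤ → Plane) (f : ℤ → ℤ) (u v w : Plane) : Prop :=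
  (∃ i m, f i ≤ m ∧ m < f (i + 1) ∧ u = a m ∧ v = c i ∧ w = a (m + 1)) ∨
    ∃ i, u = c i ∧ v = a (f i) ∧ w = c (i - 1)

variable {P : Finset Plane} {C : List Plane} {T : Finset (Finset Plane)} {ε : ℝ} {k n : ℤ}
  {c a : ℤ → Plane} {f : ℤ → ℤ} {u v w : Plane}

theorem isTile_iff_corner [DecidableEq Plane] {t : Finset Plane} :
    IsTile c a f t ↔ ∃ u v w, Corner c a f u v w ∧ t = {u, v, w} := by
  constructor
  · rintro (⟨i, rfl⟩ | ⟨i, m, h1, h2, rfl⟩)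
    · refine ⟨_, _, _, Or.inr ⟨i, rfl, rfl, rfl⟩, ?_⟩
      ext x
      simp only [Finset.mem_insert, Finset.mem_singleton]
      tauto
    · exact ⟨_, _, _, Or.inl ⟨i, m, h1, h2, rfl, rfl, rfl⟩, by congr!⟩
  · rintro ⟨u, v, w, ⟨i, m, h1, h2, rfl, rfl, rfl⟩ | ⟨i, rfl, rfl, rfl⟩, rfl⟩
    · exact Or.inr ⟨i, m, h1, h2, by congr!⟩
    · refine Or.inl ⟨i, ?_⟩
      ext x
      simp only [Finset.mem_insert, Finset.mem_singleton]
      tauto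

theorem nonpos_of_zero {σ : ℝ} {p q y z h : Plane} (hz : z ∈ segment ℝ y h)
    (h0 : ori σ p q z = 0) (hy : 0 < ori σ p q y) : ori σ p q h ≤ 0 := by
  obtain ⟨α, β, hα, hβ, hs, rfl⟩ := hz
  rw [ori_comb_two _ _ _ _ _ hs] at h0
  by_contra hcon
  push Not at hcon
  rcases hα.eq_or_lt with rfl | hα
  · obtain rfl : β = 1 := by linarith
    linarith
  · have := mul_pos hα hy
    have := mul_nonneg hβ hcon.le
    linarith

theorem nonpos_of_mem_openSegment {σ : ℝ} {p q y g h : Plane} (hy : y ∈ openSegment ℝ g h)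
    (hg : ori σ p q g ≤ 0) (hh : ori σ p q h ≤ 0) : ori σ p q y ≤ 0 := by
  obtain ⟨α, β, hα, hβ, hs, rfl⟩ := hy
  rw [ori_comb_two _ _ _ _ _ hs]
  have := mul_nonneg hα.le (neg_nonneg.2 hg)
  have := mul_nonneg hβ.le (neg_nonneg.2 hh)
  linarith

namespace Frame

theorem corner_pos (F : Frame P ε k n c a f) (h : Corner c a f u v w) : 0 < ori ε u v w := by
  obtain ⟨i, m, h1, h2, rfl, rfl, rfl⟩ | ⟨i, rfl, rfl, rfl⟩ := h
  · exact F.fan i m h1 h2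
  · rw [ori_rot]
    exact F.hull_a' i _

theorem corner_mem (F : Frame P ε k n c a f) (h : Corner c a f u v w) : u ∈ P ∧ v ∈ P ∧ w ∈ P := by
  obtain ⟨i, m, h1, h2, rfl, rfl, rfl⟩ | ⟨i, rfl, rfl, rfl⟩ := h
  · exact ⟨F.a_mem _, F.c_mem _, F.a_mem _⟩
  · exact ⟨F.c_mem _, F.a_mem _, F.c_mem _⟩

theorem corner_ne (F : Frame P ε k n c a f) (h : Corner c a f u v w) : u ≠ v ∧ u ≠ w ∧ v ≠ w := by
  obtain ⟨i, m, h1, h2, rfl, rfl, rfl⟩ | ⟨i, rfl, rfl, rfl⟩ := h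
  · exact ⟨(F.c_ne_a _ _).symm, F.a_ne_succ _, F.c_ne_a _ _⟩
  · exact ⟨F.c_ne_a _ _, (F.c_ne_pred i).symm, (F.c_ne_a _ _).symm⟩

theorem corner_orient (F : Frame P ε k n c a f) (h : Corner c a f u v w) : orient u v w ≠ 0 :=
  Region.ori_triangle_ne (F.corner_pos h)

theorem hull_nonneg (F : Frame P ε k n c a f) (j : ℤ) {x : Plane} (hx : x ∈ P) :
    0 ≤ ori ε (c j) (c (j + 1)) x := by
  by_cases h1 : x = c j
  · simp [h1]
  by_cases h2 : x = c (j + 1)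
  · simp [h2]
  exact (F.hull j x hx h1 h2).le

theorem corner_left (F : Frame P ε k n c a f) (h : Corner c a f u v w) (j : ℤ) {y : Plane}
    (hy : y ∈ openTriangle u v w) : 0 < ori ε (c j) (c (j + 1)) y := by
  obtain ⟨hu, hv, hw⟩ := F.corner_mem h
  have h1 := F.hull_nonneg j hu
  have h2 := F.hull_nonneg j hv
  have h3 := F.hull_nonneg j hw
  obtain ⟨α, β, γ, hα, hβ, hγ, hs, rfl⟩ := hy
  rw [ori_comb _ _ _ _ _ _ hs]
  have := mul_nonneg hα.le h1
  have := mul_nonneg hβ.le h2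
  have := mul_nonneg hγ.le h3
  obtain ⟨i, m, -, -, rfl, rfl, rfl⟩ | ⟨i, rfl, rfl, rfl⟩ := h
  · have := mul_pos hα (F.hull_a j m)
    linarith
  · have := mul_pos hβ (F.hull_a j (f i))
    linarith

theorem curve_left (F : Frame P ε k n c a f) (j m : ℤ) {y : Plane}
    (hy : y ∈ segment ℝ (a m) (a (m + 1))) : 0 < ori ε (c j) (c (j + 1)) y := by
  obtain ⟨α, β, hα, hβ, hs, rfl⟩ := hy
  rw [ori_comb_two _ _ _ _ _ hs]
  have h1 := F.hull_a j m
  have h2 := F.hull_a j (m + 1)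
  rcases hα.eq_or_lt with rfl | hα
  · obtain rfl : β = 1 := by linarith
    linarith
  · have := mul_pos hα h1
    have := mul_nonneg hβ h2.le
    linarith

theorem corner_spokes (h : Corner c a f u v w) (F : Frame P ε k n c a f) :
    (∃ x j, Nb a f x j ∧ s(u, v) = s(x, c j)) ∧ ∃ x j, Nb a f x j ∧ s(v, w) = s(x, c j) := by
  obtain ⟨i, m, h1, h2, rfl, rfl, rfl⟩ | ⟨i, rfl, rfl, rfl⟩ := h
  · exact ⟨⟨_, _, ⟨m, h1, h2.le, rfl⟩, rfl⟩,
      ⟨a (m + 1), i, ⟨m + 1, by omega, by omega, rfl⟩, Sym2.eq_swap⟩⟩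
  · exact ⟨⟨a (f i), i, ⟨_, le_rfl, (F.f_lt i).le, rfl⟩, Sym2.eq_swap⟩,
      ⟨_, i - 1, ⟨f i, (F.f_mono (by omega)).le, by simp, rfl⟩, rfl⟩⟩

end Frame

theorem openSegment_congr {p q u v : Plane} (h : s(p, q) = s(u, v)) :
    openSegment ℝ p q = openSegment ℝ u v := by
  rcases Sym2.eq_iff.1 h with ⟨rfl, rfl⟩ | ⟨rfl, rfl⟩
  · rfl
  · exact openSegment_symm _ _ _

namespace Spoked

theorem corner_empty (F : Spoked P ε k n c a f) (h : Corner c a f u v w) {x : Plane} (hx : x ∈ P) :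
    x ∉ openTriangle u v w := by
  obtain ⟨i, m, h1, h2, rfl, rfl, rfl⟩ | ⟨i, rfl, rfl, rfl⟩ := h
  · rcases F.cover x hx with ⟨j, rfl⟩ | ⟨l, rfl⟩
    · exact F.c_notMem_openTriangle j (F.a_mem _) (F.c_mem _) (F.a_mem _) (F.c_ne_a _ _).symm
        (F.a_ne_succ _) (F.c_ne_a _ _)
    · exact F.empty_fan i m l h1 h2
  · exact F.empty_hull i x hx

theorem spoke_avoid (F : Spoked P ε k n c a f) (h : Corner c a f u v w) {x y : Plane} {j : ℤ}
    (hx : Nb a f x j) (hy : y ∈ openSegment ℝ x (c j)) : y ∉ openTriangle u v w := by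
  intro hyt
  have hE := fun {z : Plane} (hz : z ∈ P) => F.corner_empty h hz
  have hs := Frame.corner_spokes h F.toFrame
  obtain ⟨i, m, h1, h2, rfl, rfl, rfl⟩ | ⟨i, rfl, rfl, rfl⟩ := h
  swap
  · exact F.spoke_hull x i j hx y hy hyt
  have hfan := F.fan i m h1 h2
  have ho := Region.ori_triangle_ne hfan
  obtain ⟨e1, e2, e3⟩ := (mem_openTriangle_iff hfan).1 hyt
  obtain ⟨l, hl1, hl2, rfl⟩ := id hx
  have hyP : ∀ p ∈ P, y ≠ p := fun p hp he => hE hp (he ▸ hyt)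
  have hcross : ∀ p q z, ((p = a m ∧ q = c i) ∨ (p = c i ∧ q = a (m + 1))) →
      z ∈ openSegment ℝ (a l) (c j) → z ∈ openSegment ℝ p q → False := by
    intro p q z hpq hz hz'
    have key : ∀ {x' j'}, Nb a f x' j' → s(p, q) = s(x', c j') → s(p, q) ≠ s(a l, c j) → False :=
      fun hn he hne => F.spokes _ _ _ _ hx hn (fun h => hne (he.trans h.symm)) z hz
        (openSegment_congr he ▸ hz')
    rcases hpq with ⟨rfl, rfl⟩ | ⟨rfl, rfl⟩
    · obtain ⟨⟨x', j', hn, he⟩, -⟩ := hs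
      refine key hn he fun h => ?_
      rw [← openSegment_congr h] at hy
      exact notMem_openTriangle_of_edge ho (openSegment_subset_segment _ _ _ hy) hyt
    · obtain ⟨-, x', j', hn, he⟩ := hs
      refine key hn he fun h => ?_
      rw [← openSegment_congr h] at hy
      rw [← openTriangle_rot] at hyt
      exact notMem_openTriangle_of_edge (by rwa [orient_rot]) (openSegment_subset_segment _ _ _ hy)
        hyt
  have L1 : ori ε (a (m + 1)) (a m) (a l) ≤ 0 := by
    rcases F.gp.exit (F.a_mem m) (F.c_mem i) (F.a_mem (m + 1)) (F.c_ne_a _ _).symm (F.a_ne_succ m)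
      (F.c_ne_a _ _) (F.c_mem j) (F.a_mem l) (F.c_ne_a _ _) hyt
      (by rw [segment_symm]; exact openSegment_subset_segment _ _ _ hy) (hyP _ (F.a_mem l))
      (hE (F.a_mem l)) with (h' | h' | h') | ⟨z, hz, hz', -, h' | h' | h'⟩
    · rw [h']; simp
    · exact absurd h'.symm (F.c_ne_a _ _)
    · rw [h']; simp
    · rw [openSegment_symm] at hz
      exact (hcross _ _ z (Or.inl ⟨rfl, rfl⟩) hz h').elim
    · rw [openSegment_symm] at hz
      exact (hcross _ _ z (Or.inr ⟨rfl, rfl⟩) hz h').elim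
    · exact nonpos_of_zero hz' (ori_eq_zero_of_mem_openSegment h') e3
  have hcj : c j = c i := by
    by_contra hne
    have L2 : ori ε (a (m + 1)) (a m) (c j) ≤ 0 := by
      rcases F.gp.exit (F.a_mem m) (F.c_mem i) (F.a_mem (m + 1)) (F.c_ne_a _ _).symm
        (F.a_ne_succ m) (F.c_ne_a _ _) (F.a_mem l) (F.c_mem j) (F.c_ne_a _ _).symm hyt
        (openSegment_subset_segment _ _ _ hy) (hyP _ (F.c_mem j))
        (hE (F.c_mem j)) with (h' | h' | h') | ⟨z, hz, hz', -, h' | h' | h'⟩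
      · exact absurd h' (F.c_ne_a _ _)
      · exact absurd h' hne
      · exact absurd h' (F.c_ne_a _ _)
      · exact (hcross _ _ z (Or.inl ⟨rfl, rfl⟩) hz h').elim
      · exact (hcross _ _ z (Or.inr ⟨rfl, rfl⟩) hz h').elim
      · exact nonpos_of_zero hz' (ori_eq_zero_of_mem_openSegment h') e3
    have := nonpos_of_mem_openSegment hy L1 L2
    linarith
  obtain ⟨r, hr1, hr2, hr⟩ := F.nb_congr hcj hx
  rw [hcj, hr] at hy
  obtain ⟨α, β, hα, hβ, hs, rfl⟩ := hy
  rw [ori_comb_two _ _ _ _ _ hs, ori_right, mul_zero, add_zero] at e1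
  rw [ori_comb_two _ _ _ _ _ hs, ori_left, mul_zero, add_zero] at e2
  have e1' := pos_of_mul_pos_right e1 hα.le
  have e2' := pos_of_mul_pos_right e2 hα.le
  rcases lt_trichotomy r m with hrm | rfl | hrm
  · have := F.angular hr1 hrm h2.le
    rw [ori_rev] at this; linarith
  · simp at e1'
  · rcases (show m + 1 ≤ r by omega).eq_or_lt with rfl | hrm
    · simp at e2'
    · have := F.angular (by omega : f i ≤ m + 1) hrm hr2
      rw [ori_swap] at this; linarith

theorem curve_spoke (F : Spoked P ε k n c a f) {x z : Plane} {j l : ℤ} (hx : Nb a f x j)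
    (hz : z ∈ openSegment ℝ (a l) (a (l + 1))) : z ∉ openSegment ℝ x (c j) := by
  intro hz'
  obtain ⟨i, h1, h2⟩ := F.exists_block l
  have hfan := F.fan i l h1 h2
  obtain ⟨m, -, -, hm⟩ := id hx
  obtain ⟨w, hw1, hw2⟩ := crossing_meets_openTriangle (p := a l) (q := a (l + 1)) (r := c i)
    (g := x) (h := c j) (by
      have := Region.ori_triangle_ne hfan
      rw [orient_swap, orient_rot, orient_rot]
      simpa using this)
    (F.gp.orient_ne_or (F.a_mem _) (F.a_mem _) (hm ▸ F.a_mem _) (F.c_mem _) (F.a_ne_succ _)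
      (hm ▸ (F.c_ne_a _ _).symm) (by
        intro he
        rcases Sym2.eq_iff.1 he with ⟨-, h⟩ | ⟨h, -⟩
        · exact F.c_ne_a _ _ h.symm
        · exact F.c_ne_a _ _ h.symm)) hz hz'
  rw [← openTriangle_swap'] at hw2
  exact F.spoke_avoid (Or.inl ⟨i, l, h1, h2, rfl, rfl, rfl⟩) hx hw1 hw2

theorem curve_avoid (F : Spoked P ε k n c a f) (h : Corner c a f u v w) {y : Plane} {l : ℤ}
    (hy : y ∈ openSegment ℝ (a l) (a (l + 1))) : y ∉ openTriangle u v w := by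
  intro hyt
  have hE := fun {z : Plane} (hz : z ∈ P) => F.corner_empty h hz
  have hs := Frame.corner_spokes h F.toFrame
  obtain ⟨hu, hv, hw⟩ := F.corner_mem h
  obtain ⟨n1, n2, n3⟩ := F.corner_ne h
  have hyP : ∀ p ∈ P, y ≠ p := fun p hp he => hE hp (he ▸ hyt)
  have hcross := fun x j z (hx : Nb a f x j) (hz : z ∈ openSegment ℝ (a l) (a (l + 1))) =>
    F.curve_spoke hx hz
  have hend : ∀ g h, (g = a l ∧ h = a (l + 1)) ∨ (g = a (l + 1) ∧ h = a l) →
      (h = u ∨ h = v ∨ h = w) ∨ ∃ z ∈ segment ℝ y h, z ∈ openSegment ℝ w u ∧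
        z ∈ openSegment ℝ (a l) (a (l + 1)) := by
    intro g h hgh
    have hgP : g ∈ P := by rcases hgh with ⟨rfl, rfl⟩ | ⟨rfl, rfl⟩ <;> exact F.a_mem _
    have hhP : h ∈ P := by rcases hgh with ⟨rfl, rfl⟩ | ⟨rfl, rfl⟩ <;> exact F.a_mem _
    have hne : g ≠ h := by
      rcases hgh with ⟨rfl, rfl⟩ | ⟨rfl, rfl⟩
      · exact F.a_ne_succ _
      · exact (F.a_ne_succ _).symm
    have hgs : openSegment ℝ g h = openSegment ℝ (a l) (a (l + 1)) := by
      rcases hgh with ⟨rfl, rfl⟩ | ⟨rfl, rfl⟩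
      · rfl
      · exact openSegment_symm _ _ _
    rcases F.gp.exit hu hv hw n1 n2 n3 hgP hhP hne hyt
      (openSegment_subset_segment _ _ _ (hgs ▸ hy)) (hyP _ hhP) (hE hhP) with
      h' | ⟨z, hz, hz', -, h' | h' | h'⟩
    · exact Or.inl h'
    · obtain ⟨⟨x, j, hx, he⟩, -⟩ := hs
      exact (hcross x j z hx (hgs ▸ hz) (openSegment_congr he ▸ h')).elim
    · obtain ⟨-, x, j, hx, he⟩ := hs
      exact (hcross x j z hx (hgs ▸ hz) (openSegment_congr he ▸ h')).elim
    · exact Or.inr ⟨z, hz', h', hgs ▸ hz⟩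
  have hpos := F.corner_pos h
  have e3 := ((mem_openTriangle_iff hpos).1 hyt).2.2
  obtain ⟨i, m, h1, h2, rfl, rfl, rfl⟩ | ⟨i, rfl, rfl, rfl⟩ := h
  · have hL : ∀ g h, (g = a l ∧ h = a (l + 1)) ∨ (g = a (l + 1) ∧ h = a l) →
        ori ε (a (m + 1)) (a m) h ≤ 0 := by
      intro g h hgh
      rcases hend g h hgh with (h' | h' | h') | ⟨z, hz, hz', -⟩
      · rw [h']; simp
      · rcases hgh with ⟨-, rfl⟩ | ⟨-, rfl⟩ <;> exact absurd h'.symm (F.c_ne_a _ _)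
      · rw [h']; simp
      · exact nonpos_of_zero hz (ori_eq_zero_of_mem_openSegment hz') e3
    have := nonpos_of_mem_openSegment hy (hL _ _ (Or.inr ⟨rfl, rfl⟩)) (hL _ _ (Or.inl ⟨rfl, rfl⟩))
    linarith
  · have hL : ∀ g h, (g = a l ∧ h = a (l + 1)) ∨ (g = a (l + 1) ∧ h = a l) → h = a (f i) := by
      intro g h hgh
      rcases hend g h hgh with (h' | h' | h') | ⟨z, hz, hz', hz2⟩
      · rcases hgh with ⟨-, rfl⟩ | ⟨-, rfl⟩ <;> exact absurd h'.symm (F.c_ne_a _ _)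
      · exact h'
      · rcases hgh with ⟨-, rfl⟩ | ⟨-, rfl⟩ <;> exact absurd h'.symm (F.c_ne_a _ _)
      · have h1 := F.curve_left (i - 1) l (openSegment_subset_segment _ _ _ hz2)
        rw [sub_add_cancel, ori_eq_zero_of_mem_openSegment hz'] at h1
        exact absurd h1 (lt_irrefl _)
    exact F.a_ne_succ l ((hL _ _ (Or.inr ⟨rfl, rfl⟩)).trans (hL _ _ (Or.inl ⟨rfl, rfl⟩)).symm)

theorem base_avoid (F : Spoked P ε k n c a f) {u' v' w' : Plane} (h : Corner c a f u v w)
    (h' : Corner c a f u' v' w') {y : Plane} (hy : y ∈ openSegment ℝ w' u') :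
    y ∉ openTriangle u v w := by
  obtain ⟨i, m, h1, h2, rfl, rfl, rfl⟩ | ⟨i, rfl, rfl, rfl⟩ := h'
  · rw [openSegment_symm] at hy
    exact F.curve_avoid h hy
  · intro hyt
    have h1 := F.corner_left h (i - 1) hyt
    rw [sub_add_cancel, ori_eq_zero_of_mem_openSegment hy] at h1
    exact absurd h1 (lt_irrefl _)

theorem corner_subset (F : Spoked P ε k n c a f) {u' v' w' : Plane} (h : Corner c a f u v w)
    (h' : Corner c a f u' v' w') {x : Plane} (hx : x ∈ openTriangle u v w)
    (hx' : x ∈ openTriangle u' v' w') : openTriangle u v w ⊆ openTriangle u' v' w' := by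
  intro y hy
  by_contra hy'
  obtain ⟨hu, hv, hw⟩ := F.corner_mem h'
  obtain ⟨z, hz, -, hz'⟩ := exists_mem_edge (F.corner_orient h') convex_openTriangle.isPreconnected
    hx hx' hy hy'
  obtain ⟨⟨x1, j1, hn1, he1⟩, x2, j2, hn2, he2⟩ := Frame.corner_spokes h' F.toFrame
  rcases hz' with hz' | hz' | hz' <;> rcases mem_segment_cases hz' with rfl | rfl | hz'
  · exact F.corner_empty h hu hz
  · exact F.corner_empty h hv hz
  · exact F.spoke_avoid h hn1 (openSegment_congr he1 ▸ hz') hz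
  · exact F.corner_empty h hv hz
  · exact F.corner_empty h hw hz
  · exact F.spoke_avoid h hn2 (openSegment_congr he2 ▸ hz') hz
  · exact F.corner_empty h hw hz
  · exact F.corner_empty h hu hz
  · exact F.base_avoid h h' hz' hz

theorem corner_vertex (F : Spoked P ε k n c a f) (h : Corner c a f u v w) {x : Plane} (hx : x ∈ P)
    (hxt : x ∈ convexHull ℝ {u, v, w}) : x = u ∨ x = v ∨ x = w := by
  by_contra hcon
  push Not at hcon
  obtain ⟨hu, hv, hw⟩ := F.corner_mem h
  obtain ⟨n1, n2, n3⟩ := F.corner_ne h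
  exact F.corner_empty h hx (F.gp.mem_openTriangle hu hv hw n1 n2 n3 hx hxt hcon.1 hcon.2.1
    hcon.2.2)

theorem corner_eq (F : Spoked P ε k n c a f) [DecidableEq Plane] {u' v' w' : Plane}
    (h : Corner c a f u v w) (h' : Corner c a f u' v' w') {x : Plane}
    (hx : x ∈ openTriangle u v w) (hx' : x ∈ openTriangle u' v' w') :
    ({u, v, w} : Finset Plane) = {u', v', w'} := by
  have hsub := closure_mono (F.corner_subset h h' hx hx')
  rw [closure_openTriangle, closure_openTriangle] at hsub
  obtain ⟨hu, hv, hw⟩ := F.corner_mem h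
  refine Finset.eq_of_subset_of_card_le ?_ ?_
  · intro y hy
    have hyP : y ∈ P := by
      simp only [Finset.mem_insert, Finset.mem_singleton] at hy
      rcases hy with rfl | rfl | rfl <;> assumption
    have := F.corner_vertex h' hyP (hsub (subset_convexHull ℝ _ (by simpa using hy)))
    simpa using this
  · rw [F.isTile_card (isTile_iff_corner.2 ⟨_, _, _, h', rfl⟩),
      F.isTile_card (isTile_iff_corner.2 ⟨_, _, _, h, rfl⟩)]

theorem tiles_disjoint (F : Spoked P ε k n c a f) : ∀ t ∈ tiles P c a f, ∀ t' ∈ tiles P c a f,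
    t ≠ t' → Disjoint (interior (convexHull ℝ (t : Set Plane)))
      (interior (convexHull ℝ (t' : Set Plane))) := by
  classical
  intro t ht t' ht' hne
  obtain ⟨u, v, w, h, rfl⟩ := isTile_iff_corner.1 (F.mem_tiles.1 ht)
  obtain ⟨u', v', w', h', rfl⟩ := isTile_iff_corner.1 (F.mem_tiles.1 ht')
  rw [coe_triple, coe_triple, interior_convexHull_triple (F.corner_orient h),
    interior_convexHull_triple (F.corner_orient h')]
  rw [Set.disjoint_left]
  intro x hx hx'
  exact hne (F.corner_eq h h' hx hx')

theorem tiles_empty (F : Spoked P ε k n c a f) : ∀ t ∈ tiles P c a f, ∀ p ∈ P,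
    p ∈ convexHull ℝ (t : Set Plane) → p ∈ t := by
  classical
  intro t ht p hp hpt
  obtain ⟨u, v, w, h, rfl⟩ := isTile_iff_corner.1 (F.mem_tiles.1 ht)
  rw [coe_triple] at hpt
  simpa using F.corner_vertex h hp hpt

end Spoked

end FourConn

namespace FourConn

variable {P : Finset Plane} {C : List Plane} {ε : ℝ} {k n : ℤ}
  {c a : ℤ → Plane} {f : ℤ → ℤ} {u v w : Plane}

/-! ### The region covered by the tiles -/

/-- The union of the tiles. -/
def tileRegion (c a : ℤ → Plane) (f : ℤ → ℤ) : Set Plane :=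
  {x | ∃ u v w, Corner c a f u v w ∧ x ∈ convexHull ℝ {u, v, w}}

/-- The intersection of the closed left half-planes of the hull edges. -/
def hullRegion (ε : ℝ) (c : ℤ → Plane) : Set Plane := {x | ∀ j, 0 ≤ ori ε (c j) (c (j + 1)) x}

/-- The points strictly inside all hull edges and outside all tiles. -/
def innerRegion (ε : ℝ) (c a : ℤ → Plane) (f : ℤ → ℤ) : Set Plane :=
  {x | ∀ j, 0 < ori ε (c j) (c (j + 1)) x} \ tileRegion c a f

namespace Frame

theorem c_mod (F : Frame P ε k n c a f) (j : ℤ) : c (j % k) = c j :=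
  (F.c_iff _ _).2 ⟨-(j / k), by have := Int.mul_ediv_add_emod j k; linarith⟩

theorem c_mod_succ (F : Frame P ε k n c a f) (j : ℤ) : c (j % k + 1) = c (j + 1) :=
  (F.c_iff _ _).2 ⟨-(j / k), by have := Int.mul_ediv_add_emod j k; linarith⟩

theorem hull_next (F : Frame P ε k n c a f) (j : ℤ) :
    0 < ori ε (c j) (c (j + 1)) (c (j + 2)) := by
  refine F.hull j _ (F.c_mem _) (fun h => ?_) fun h => ?_
  · rw [F.c_iff] at h
    exact F.not_dvd_two (by simpa using h)
  · refine F.c_ne_succ (j + 1) ?_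
    rw [← h, add_assoc]; rfl

theorem mem_hull_edge (F : Frame P ε k n c a f) {j : ℤ} {y : Plane} (hy : y ∈ hullRegion ε c)
    (h0 : ori ε (c j) (c (j + 1)) y = 0) : y ∈ segment ℝ (c j) (c (j + 1)) := by
  have hd := F.hull_next j
  have e := eq_comb_of_ori_ne hd.ne' y
  have s := ori_div_sum hd.ne' y
  rw [h0, zero_div] at e s
  rw [zero_smul, add_zero] at e
  rw [add_zero] at s
  have h1 := hy (j + 1)
  rw [add_assoc, show (1 : ℤ) + 1 = 2 from rfl] at h1
  have h2 := hy (j - 1)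
  have h3 := F.hull_next (j - 1)
  rw [sub_add_cancel, show j - 1 + 2 = j + 1 by ring] at h3
  rw [sub_add_cancel, e, ori_comb_two _ _ _ _ _ s, ori_right, mul_zero, zero_add] at h2
  exact ⟨_, _, div_nonneg h1 hd.le, nonneg_of_mul_nonneg_left h2 h3, s, e.symm⟩

theorem convexHull_subset (F : Frame P ε k n c a f) :
    convexHull ℝ (P : Set Plane) ⊆ hullRegion ε c := by
  refine convexHull_min (fun x hx j => F.hull_nonneg j hx) ?_
  intro x hx y hy α β hα hβ hs j
  rw [ori_comb_two _ _ _ _ _ hs]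
  have := mul_nonneg hα (hx j)
  have := mul_nonneg hβ (hy j)
  linarith

theorem sum_ori (F : Frame P ε k n c a f) :
    ∃ A, ∀ x, ∑ j ∈ Finset.range k.toNat, ori ε (c j) (c (j + 1)) x = A := by
  have key : ∀ (N : ℕ) (x : Plane), ∑ j ∈ Finset.range N, ori ε (c j) (c (j + 1)) x =
      ∑ j ∈ Finset.range N, ε * (c j 0 * c (j + 1) 1 - c j 1 * c (j + 1) 0) +
        ε * ((c N 0 - c 0 0) * x 1 - (c N 1 - c 0 1) * x 0) := by
    intro N x
    induction N with
    | zero => simp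
    | succ N ih =>
      rw [Finset.sum_range_succ, ih, Finset.sum_range_succ]
      simp only [ori, orient]
      push_cast
      ring
  refine ⟨∑ j ∈ Finset.range k.toNat, ε * (c j 0 * c (j + 1) 1 - c j 1 * c (j + 1) 0),
    fun x => ?_⟩
  have : c (k.toNat : ℤ) = c 0 := (F.c_iff _ _).2 (by
    rw [Int.toNat_of_nonneg (by have := F.three_le; omega)]; simp)
  rw [key, this]
  simp

theorem isBounded_hullRegion (F : Frame P ε k n c a f) : Bornology.IsBounded (hullRegion ε c) := by
  obtain ⟨A, hA⟩ := F.sum_ori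
  have h3 := F.three_le
  have hd := F.hull_next 0
  rw [zero_add, zero_add] at hd
  set d := ori ε (c 0) (c 1) (c 2) with hde
  have hle : ∀ x ∈ hullRegion ε c, ∀ j : ℕ, (j : ℤ) < k → ori ε (c j) (c (j + 1)) x ≤ A := by
    intro x hx j hj
    rw [← hA x]
    exact Finset.single_le_sum (f := fun j : ℕ => ori ε (c j) (c (j + 1)) x)
      (fun i _ => hx i) (Finset.mem_range.2 (by omega))
  have hcomp : IsCompact ((fun z : ℝ × ℝ => (z.2 / d) • c 0 + (1 - (z.1 + z.2) / d) • c 1 +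
      (z.1 / d) • c 2) '' (Set.Icc 0 A ×ˢ Set.Icc 0 A)) :=
    (isCompact_Icc.prod isCompact_Icc).image (by fun_prop)
  refine hcomp.isBounded.subset fun x hx => ?_
  have g0 := hle x hx 0 (by omega)
  have g1 := hle x hx 1 (by omega)
  have p0 := hx 0
  have p1 := hx 1
  norm_num at g0 g1 p0 p1
  refine ⟨(ori ε (c 0) (c 1) x, ori ε (c 1) (c 2) x), ⟨⟨p0, g0⟩, ⟨p1, g1⟩⟩, ?_⟩
  have e := eq_comb_of_ori_ne hd.ne' x
  have s := ori_div_sum hd.ne' x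
  rw [← hde] at e s
  simp only
  conv_rhs => rw [e]
  congr 3
  rw [add_div]
  linarith

end Frame

theorem mem_tileRegion_fan {i m : ℤ} (h1 : f i ≤ m) (h2 : m < f (i + 1)) {x : Plane}
    (hx : x ∈ convexHull ℝ {a m, c i, a (m + 1)}) : x ∈ tileRegion c a f :=
  ⟨_, _, _, Or.inl ⟨i, m, h1, h2, rfl, rfl, rfl⟩, hx⟩

theorem mem_tileRegion_hull (i : ℤ) {x : Plane}
    (hx : x ∈ convexHull ℝ {c i, a (f i), c (i - 1)}) : x ∈ tileRegion c a f :=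
  ⟨_, _, _, Or.inr ⟨i, rfl, rfl, rfl⟩, hx⟩

theorem segment_subset_triple' (p q r : Plane) : segment ℝ p r ⊆ convexHull ℝ {p, q, r} :=
  (convex_convexHull ℝ _).segment_subset (subset_convexHull ℝ _ (by simp))
    (subset_convexHull ℝ _ (by simp))

theorem eventually_ori_pos {σ : ℝ} {p q y : Plane} (h : 0 < ori σ p q y) :
    ∀ᶠ x in nhds y, 0 < ori σ p q x :=
  ((ori_continuous σ p q).tendsto y).eventually (lt_mem_nhds h)

namespace Spoked

theorem cover_spoke (F : Spoked P ε k n c a f) {j m : ℤ} (h1 : f j ≤ m) (h2 : m ≤ f (j + 1))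
    {y : Plane} (hy : y ∈ openSegment ℝ (a m) (c j)) :
    ∀ᶠ x in nhds y, x ∈ tileRegion c a f := by
  have hpos : ∃ r, 0 < ori ε (a m) (c j) r ∧ convexHull ℝ {a m, c j, r} ⊆ tileRegion c a f := by
    rcases h2.lt_or_eq with h2 | rfl
    · exact ⟨a (m + 1), F.fan j m h1 h2, fun x hx => mem_tileRegion_fan h1 h2 hx⟩
    · refine ⟨c (j + 1), by rw [← ori_rot]; exact F.hull_a j _, fun x hx => mem_tileRegion_hull (j + 1) ?_⟩
      rw [add_sub_cancel_right]
      convert hx using 2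
      ext z; simp only [Set.mem_insert_iff, Set.mem_singleton_iff]; tauto
  have hneg : ∃ r, ori ε (a m) (c j) r < 0 ∧ convexHull ℝ {a m, c j, r} ⊆ tileRegion c a f := by
    rcases h1.lt_or_eq with h1 | rfl
    · have h := F.fan j (m - 1) (by omega) (by omega)
      rw [sub_add_cancel] at h
      refine ⟨a (m - 1), by rw [ori_rev] at h; linarith, fun x hx =>
        mem_tileRegion_fan (i := j) (m := m - 1) (by omega) (by omega) ?_⟩
      rw [sub_add_cancel]
      convert hx using 2
      ext z; simp only [Set.mem_insert_iff, Set.mem_singleton_iff]; tauto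
    · refine ⟨c (j - 1), ?_, fun x hx => mem_tileRegion_hull j ?_⟩
      · have := F.hull_a' j (f j)
        rw [ori_rev]; linarith
      · convert hx using 2
        ext z; simp only [Set.mem_insert_iff, Set.mem_singleton_iff]; tauto
  obtain ⟨α, β, hα, hβ, hs, hye⟩ := hy
  have key : ∀ σ r, 0 < ori σ (a m) (c j) r → 0 < ori σ (c j) r y ∧ 0 < ori σ r (a m) y := by
    intro σ r hr
    rw [← hye, ori_comb_two _ _ _ _ _ hs, ori_comb_two _ _ _ _ _ hs, ori_left, ori_right, ori_rot,
      ori_rot' σ (a m) (c j) r]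
    have := mul_pos hα hr
    have := mul_pos hβ hr
    constructor <;> linarith
  obtain ⟨r, hr, hrK⟩ := hpos
  obtain ⟨r', hr', hrK'⟩ := hneg
  have hr'' : 0 < ori (-ε) (a m) (c j) r' := by rw [ori_neg]; linarith
  filter_upwards [eventually_ori_pos (key _ _ hr).1, eventually_ori_pos (key _ _ hr).2,
    eventually_ori_pos (key _ _ hr'').1, eventually_ori_pos (key _ _ hr'').2] with x x1 x2 x3 x4
  rcases le_total 0 (ori ε (a m) (c j) x) with h | h
  · exact hrK ((mem_convexHull_iff hr).2 ⟨h, x1.le, x2.le⟩)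
  · exact hrK' ((mem_convexHull_iff hr'').2 ⟨by rw [ori_neg]; linarith, x3.le, x4.le⟩)

theorem cover_hull_edge (F : Spoked P ε k n c a f) {i : ℤ} {y : Plane}
    (hy : y ∈ openSegment ℝ (c (i - 1)) (c i)) :
    ∀ᶠ x in nhds y, x ∈ hullRegion ε c → x ∈ tileRegion c a f := by
  have h := F.hull_a' i (f i)
  obtain ⟨α, β, hα, hβ, hs, rfl⟩ := hy
  have p1 := mul_pos hα h
  have p2 := mul_pos hβ h
  have h1 : 0 < ori ε (c i) (a (f i)) (α • c (i - 1) + β • c i) := by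
    rw [ori_comb_two _ _ _ _ _ hs, ori_left, ori_rot]; linarith
  have h2 : 0 < ori ε (a (f i)) (c (i - 1)) (α • c (i - 1) + β • c i) := by
    rw [ori_comb_two _ _ _ _ _ hs, ori_right, ori_rot' ε (c (i - 1)) (c i)]; linarith
  filter_upwards [eventually_ori_pos h1, eventually_ori_pos h2] with x x1 x2 hx
  refine mem_tileRegion_hull i ((mem_convexHull_iff (by rwa [ori_rot])).2 ⟨x1.le, x2.le, ?_⟩)
  simpa using hx (i - 1)

theorem cover_hull_vertex (F : Spoked P ε k n c a f) (i : ℤ) :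
    ∀ᶠ x in nhds (c i), x ∈ hullRegion ε c → x ∈ tileRegion c a f := by
  have h1 : ∀ᶠ x in nhds (c i), ∀ m ∈ Set.Ico (f i) (f (i + 1)),
      0 < ori ε (a (m + 1)) (a m) x := by
    refine (Filter.eventually_all_finite (Set.finite_Ico _ _)).2 fun m hm => ?_
    refine eventually_ori_pos ?_
    rw [ori_rot']; exact F.fan i m hm.1 hm.2
  have h2 : 0 < ori ε (a (f i)) (c (i - 1)) (c i) := by
    rw [ori_rot']; exact F.hull_a' i _
  have h3 : 0 < ori ε (c (i + 1)) (a (f (i + 1))) (c i) := by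
    rw [ori_rot]; exact F.hull_a i _
  filter_upwards [h1, eventually_ori_pos h2, eventually_ori_pos h3] with x x1 x2 x3 hx
  rcases le_or_gt (ori ε (a (f i)) (c i) x) 0 with e | e
  · refine mem_tileRegion_hull i ((mem_convexHull_iff (ε := ε)
      (by rw [ori_rot]; exact F.hull_a' i _)).2 ⟨?_, x2.le, ?_⟩)
    · rw [ori_swap]; linarith
    · simpa using hx (i - 1)
  rcases le_or_gt 0 (ori ε (a (f (i + 1))) (c i) x) with e' | e'
  · refine mem_tileRegion_hull (i + 1) ?_
    rw [add_sub_cancel_right]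
    exact (mem_convexHull_iff (ε := ε) (by rw [ori_rot]; exact F.hull_a i _)).2 ⟨x3.le, e', hx i⟩
  obtain ⟨m, ⟨m1, m2, m3⟩, hmax⟩ := Int.exists_greatest_of_bdd
    (P := fun m => f i ≤ m ∧ m < f (i + 1) ∧ 0 < ori ε (a m) (c i) x)
    ⟨f (i + 1), fun z hz => hz.2.1.le⟩ ⟨f i, le_rfl, F.f_lt i, e⟩
  refine mem_tileRegion_fan m1 m2 ((mem_convexHull_iff (F.fan i m m1 m2)).2
    ⟨m3.le, ?_, (x1 m ⟨m1, m2⟩).le⟩)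
  rw [ori_swap]
  by_contra hcon
  have h4 : 0 < ori ε (a (m + 1)) (c i) x := by linarith
  rcases (show m + 1 ≤ f (i + 1) by omega).lt_or_eq with h5 | h5
  · have := hmax (m + 1) ⟨by omega, h5, h4⟩
    omega
  · rw [h5] at h4; linarith

/-- Off the polygon, the union of the tiles is relatively open in the hull. -/
theorem cover_nhds (F : Spoked P ε k n c a f) {y : Plane} (hy : y ∈ tileRegion c a f)
    (hyc : ∀ m, y ∉ segment ℝ (a m) (a (m + 1))) :
    ∀ᶠ x in nhds y, x ∈ hullRegion ε c → x ∈ tileRegion c a f := by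
  obtain ⟨u, v, w, h, hyt⟩ := hy
  have hspoke : ∀ {p q : Plane}, (∃ x j, Nb a f x j ∧ s(p, q) = s(x, c j)) → y ∈ segment ℝ p q →
      ∀ᶠ x in nhds y, x ∈ hullRegion ε c → x ∈ tileRegion c a f := by
    rintro p q ⟨x, j, ⟨m, h1, h2, rfl⟩, he⟩ hys
    have hys' : y ∈ segment ℝ (a m) (c j) := by
      rcases Sym2.eq_iff.1 he with ⟨rfl, rfl⟩ | ⟨rfl, rfl⟩
      · exact hys
      · rwa [segment_symm]
    rcases mem_segment_cases hys' with rfl | rfl | h'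
    · exact absurd (left_mem_segment _ _ _) (hyc m)
    · exact F.cover_hull_vertex j
    · exact (F.cover_spoke h1 h2 h').mono fun _ hx _ => hx
  by_cases hyo : y ∈ openTriangle u v w
  · filter_upwards [(isOpen_openTriangle (F.corner_orient h)).mem_nhds hyo] with x hx _
    exact ⟨u, v, w, h, openTriangle_subset_convexHull _ _ _ hx⟩
  have hs := Frame.corner_spokes h F.toFrame
  rcases mem_edges_of_mem_convexHull (F.corner_orient h) hyt hyo with h' | h' | h'
  · exact hspoke hs.1 h'
  · exact hspoke hs.2 h'
  · obtain ⟨i, m, -, -, rfl, rfl, rfl⟩ | ⟨i, rfl, rfl, rfl⟩ := h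
    · rw [segment_symm] at h'
      exact absurd h' (hyc m)
    · rcases mem_segment_cases h' with rfl | rfl | h'
      · exact F.cover_hull_vertex _
      · exact F.cover_hull_vertex _
      · exact F.cover_hull_edge h'

theorem mem_tileRegion_of_mem_curve (F : Spoked P ε k n c a f) {m : ℤ} {y : Plane}
    (hy : y ∈ segment ℝ (a m) (a (m + 1))) : y ∈ tileRegion c a f := by
  obtain ⟨i, h1, h2⟩ := F.exists_block m
  exact mem_tileRegion_fan h1 h2 (segment_subset_triple' _ _ _ hy)

theorem isClosed_tileRegion (F : Spoked P ε k n c a f) : IsClosed (tileRegion c a f) := by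
  classical
  have : tileRegion c a f = ⋃ t ∈ tiles P c a f, convexHull ℝ (t : Set Plane) := by
    ext x
    simp only [tileRegion, Set.mem_iUnion, exists_prop]
    constructor
    · rintro ⟨u, v, w, h, hx⟩
      exact ⟨{u, v, w}, F.mem_tiles.2 (isTile_iff_corner.2 ⟨_, _, _, h, rfl⟩), by
        rwa [coe_triple]⟩
    · rintro ⟨t, ht, hx⟩
      obtain ⟨u, v, w, h, rfl⟩ := isTile_iff_corner.1 (F.mem_tiles.1 ht)
      exact ⟨u, v, w, h, by rwa [coe_triple] at hx⟩
  rw [this]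
  exact (tiles P c a f).finite_toSet.isClosed_biUnion fun t _ =>
    t.finite_toSet.isClosed_convexHull ℝ

theorem isOpen_innerRegion (F : Spoked P ε k n c a f) : IsOpen (innerRegion ε c a f) := by
  have h3 := F.three_le
  have : {x | ∀ j, 0 < ori ε (c j) (c (j + 1)) x} =
      ⋂ j ∈ Set.Ico 0 k, {x | 0 < ori ε (c j) (c (j + 1)) x} := by
    ext x
    simp only [Set.mem_iInter]
    constructor
    · exact fun h j _ => h j
    · intro h j
      have := h (j % k) ⟨Int.emod_nonneg _ (by omega), Int.emod_lt_of_pos _ (by omega)⟩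
      rwa [Set.mem_ofPred_eq, F.c_mod, F.c_mod_succ] at this
  rw [innerRegion, this]
  refine IsOpen.sdiff ?_ F.isClosed_tileRegion
  exact (Set.finite_Ico 0 k).isOpen_biInter fun j _ =>
    isOpen_lt continuous_const (ori_continuous _ _ _)

theorem curve_corner (F : Spoked P ε k n c a f) (h : Corner c a f u v w) {z : Plane} {l : ℤ}
    (hz : z ∈ convexHull ℝ {u, v, w}) (hzl : z ∈ segment ℝ (a l) (a (l + 1))) :
    (∃ m, z = a m) ∨ z ∈ segment ℝ w u := by
  rcases mem_segment_cases hzl with rfl | rfl | hzo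
  · exact Or.inl ⟨_, rfl⟩
  · exact Or.inl ⟨_, rfl⟩
  have hspoke : ∀ {p q : Plane}, (∃ x j, Nb a f x j ∧ s(p, q) = s(x, c j)) →
      z ∈ segment ℝ p q → ∃ m, z = a m := by
    rintro p q ⟨x, j, hn, he⟩ hzs
    have hzs' : z ∈ segment ℝ x (c j) := by
      rcases Sym2.eq_iff.1 he with ⟨rfl, rfl⟩ | ⟨rfl, rfl⟩
      · exact hzs
      · rwa [segment_symm]
    rcases mem_segment_cases hzs' with rfl | rfl | h'
    · obtain ⟨m, -, -, h⟩ := hn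
      exact ⟨m, h⟩
    · exact absurd hzo (F.gp.notMem_openSegment (F.a_mem _) (F.a_mem _) (F.c_mem _)
        (F.a_ne_succ _))
    · exact absurd h' (F.curve_spoke hn hzo)
  have hs := Frame.corner_spokes h F.toFrame
  rcases mem_edges_of_mem_convexHull (F.corner_orient h) hz (F.curve_avoid h hzo) with h' | h' | h'
  · exact Or.inl (hspoke hs.1 h')
  · exact Or.inl (hspoke hs.2 h')
  · exact Or.inr h'

/-- The polygon is the closed polygon through the inner points of the frame. -/
theorem notMem_polygonInterior_of_outside (F : Spoked P ε k n c a f)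
    (hC : ∀ x, x ∈ polygonCurve C ↔ ∃ m, x ∈ segment ℝ (a m) (a (m + 1))) {j : ℤ} {x : Plane}
    (hx : ori ε (c j) (c (j + 1)) x ≤ 0) : x ∉ polygonInterior C := by
  have ha := F.hull_a j 0
  let l : ℝ → Plane := fun t => x + t • (c j - a 0)
  have hl : Continuous l := by fun_prop
  have hv : c j - a 0 ≠ 0 := sub_ne_zero.2 (F.c_ne_a _ _)
  refine notMem_polygonInterior (s := l '' Set.Ici 0) (isPreconnected_Ici.image _ hl.continuousOn)
    ?_ ?_ ⟨0, Set.mem_Ici.2 le_rfl, by simp [l]⟩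
  · rintro _ ⟨t, ht, rfl⟩ hmem
    obtain ⟨m, hm⟩ := (hC _).1 hmem
    have h1 := F.curve_left j m hm
    have h2 : l t = (1 : ℝ) • x + t • c j + (-t) • a 0 := by simp only [l]; module
    rw [h2, ori_comb _ _ _ _ _ _ (by ring), ori_left] at h1
    have := mul_nonneg ht ha.le
    linarith
  · exact not_isBounded_of_ray hv fun t ht => ⟨t, ht.le, rfl⟩

theorem notMem_polygonInterior_of_tile (F : Spoked P ε k n c a f)
    (hC : ∀ x, x ∈ polygonCurve C ↔ ∃ m, x ∈ segment ℝ (a m) (a (m + 1))) {x : Plane}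
    (hx : x ∈ tileRegion c a f) : x ∉ polygonInterior C := by
  intro hxU
  obtain ⟨u, v, w, h, hxt⟩ := hx
  have hxc := polygonInterior_disjoint_curve hxU
  have hpos := F.corner_pos h
  have key : ∀ j, c j ∈ convexHull ℝ {u, v, w} →
      (∀ z ∈ segment ℝ x (c j), z ∉ polygonCurve C) → False := by
    intro j hj hz
    refine F.notMem_polygonInterior_of_outside hC (j := j) (x := c j) (by simp)
      (subset_polygonInterior (isPreconnected_segment x (c j)) hz (left_mem_segment _ _ _) hxU
        (right_mem_segment _ _ _))
  have hc := fun {z l} => F.curve_corner (z := z) (l := l) h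
  have hv := fun {z} (hz : z ∈ P) => F.corner_vertex h hz
  have hxt' := (mem_convexHull_iff hpos).1 hxt
  have hconv : ∀ j, c j ∈ convexHull ℝ {u, v, w} → ∀ z ∈ segment ℝ x (c j),
      z ∈ convexHull ℝ {u, v, w} := fun j hj z hz =>
    (convex_convexHull ℝ _).segment_subset hxt hj hz
  obtain ⟨i, m, h1, h2, rfl, rfl, rfl⟩ | ⟨i, rfl, rfl, rfl⟩ := h
  · have hci : c i ∈ convexHull ℝ {a m, c i, a (m + 1)} := subset_convexHull ℝ _ (by simp)
    refine key i hci fun z hz hzC => ?_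
    obtain ⟨l, hl⟩ := (hC z).1 hzC
    have hzt := hconv i hci z hz
    have hzs : ori ε (a (m + 1)) (a m) z = 0 := by
      rcases hc hzt hl with ⟨r, rfl⟩ | h'
      · rcases hv (F.a_mem r) hzt with h' | h' | h'
        · rw [h']; simp
        · exact absurd h'.symm (F.c_ne_a _ _)
        · rw [h']; simp
      · exact ori_eq_zero_of_mem_segment h'
    have hx0 : 0 < ori ε (a (m + 1)) (a m) x := by
      refine lt_of_le_of_ne hxt'.2.2 fun h0 => hxc ((hC x).2 ⟨m, ?_⟩)
      rw [segment_symm]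
      exact mem_segment_of_ori_eq_zero (r := c i) (by rwa [ori_rot']) h0.symm hxt'.1 hxt'.2.1
    obtain ⟨α, β, hα, hβ, hs, rfl⟩ := hz
    rw [ori_comb_two _ _ _ _ _ hs, ori_rot' ε (a m) (c i)] at hzs
    have := mul_nonneg hα hx0.le
    have := mul_nonneg hβ hpos.le
    rcases hα.eq_or_lt with rfl | hα
    · obtain rfl : β = 1 := by linarith
      linarith
    · have := mul_pos hα hx0
      linarith
  · have hci : c i ∈ convexHull ℝ {c i, a (f i), c (i - 1)} := subset_convexHull ℝ _ (by simp)
    refine key i hci fun z hz hzC => ?_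
    obtain ⟨l, hl⟩ := (hC z).1 hzC
    have hzt := hconv i hci z hz
    have hza : z = a (f i) := by
      rcases hc hzt hl with ⟨r, rfl⟩ | h'
      · rcases hv (F.a_mem r) hzt with h' | h' | h'
        · exact absurd h'.symm (F.c_ne_a _ _)
        · exact h'
        · exact absurd h'.symm (F.c_ne_a _ _)
      · have := F.curve_left (i - 1) l hl
        rw [sub_add_cancel, ori_eq_zero_of_mem_segment h'] at this
        exact absurd this (lt_irrefl _)
    have hsum := ori_sum ε (c i) (a (f i)) (c (i - 1)) x
    have hd : ori ε (c (i - 1)) (c i) (a (f i)) = ori ε (c i) (a (f i)) (c (i - 1)) :=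
      (ori_rot _ _ _ _).symm
    obtain ⟨α, β, hα, hβ, hs, hze⟩ := hz
    have e := congrArg (ori ε (c (i - 1)) (c i)) (hze.trans hza)
    rw [ori_comb_two _ _ _ _ _ hs, ori_right, hd, mul_zero, add_zero] at e
    have hβ0 : β = 0 := by
      by_contra hne
      have hβ' : 0 < β := lt_of_le_of_ne hβ (Ne.symm hne)
      have h5 := mul_le_mul_of_nonneg_left (show ori ε (c (i - 1)) (c i) x ≤
        ori ε (c i) (a (f i)) (c (i - 1)) by linarith [hxt'.1, hxt'.2.1]) hα
      have h6 := mul_pos hβ' hpos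
      rw [e] at h5
      have h7 : α * ori ε (c i) (a (f i)) (c (i - 1)) =
        (1 - β) * ori ε (c i) (a (f i)) (c (i - 1)) := by rw [← hs]; ring
      linarith
    rw [hβ0, zero_smul, add_zero, show α = 1 by linarith, one_smul] at hze
    exact hxc (hze ▸ hzC)

/-- The interior of the polygon is the part of the hull outside the tiles. -/
theorem polygonInterior_eq (F : Spoked P ε k n c a f)
    (hC : ∀ x, x ∈ polygonCurve C ↔ ∃ m, x ∈ segment ℝ (a m) (a (m + 1))) :
    polygonInterior C = innerRegion ε c a f := by
  refine Set.Subset.antisymm (fun x hx => ⟨fun j => ?_, fun h =>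
    F.notMem_polygonInterior_of_tile hC h hx⟩) fun x hx => ?_
  · by_contra hcon
    exact F.notMem_polygonInterior_of_outside hC (not_lt.1 hcon) hx
  have hxc : x ∉ polygonCurve C := fun h => by
    obtain ⟨m, hm⟩ := (hC x).1 h
    exact hx.2 (F.mem_tileRegion_of_mem_curve hm)
  refine ⟨hxc, ?_⟩
  have hsub : innerRegion ε c a f ⊆ hullRegion ε c := fun y hy j => (hy.1 j).le
  refine F.isBounded_hullRegion.subset (Set.Subset.trans ?_ hsub)
  refine isPreconnected_connectedComponentIn.subset_of_closure_inter_subset F.isOpen_innerRegion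
    ⟨x, mem_connectedComponentIn hxc, hx⟩ ?_
  rintro y ⟨hyc, hyZ⟩
  have hyC : y ∉ polygonCurve C := connectedComponentIn_subset _ _ hyZ
  have hyH : y ∈ hullRegion ε c := by
    have hcl : IsClosed (hullRegion ε c) := by
      have : hullRegion ε c = ⋂ j, {x | 0 ≤ ori ε (c j) (c (j + 1)) x} := by
        ext; simp [hullRegion]
      rw [this]
      exact isClosed_iInter fun j => isClosed_le continuous_const (ori_continuous _ _ _)
    exact closure_minimal hsub hcl hyc
  have hyK : y ∉ tileRegion c a f := by
    intro hyK
    have := F.cover_nhds hyK fun m hm => hyC ((hC y).2 ⟨m, hm⟩)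
    obtain ⟨z, hz1, hz2⟩ := (mem_closure_iff_frequently.1 hyc).and_eventually this |>.exists
    exact hz1.2 (hz2 (hsub hz1))
  refine ⟨fun j => lt_of_le_of_ne (hyH j) fun h0 => hyK ?_, hyK⟩
  have := F.mem_hull_edge hyH h0.symm
  refine mem_tileRegion_hull (j + 1) ?_
  rw [add_sub_cancel_right]
  rw [segment_symm] at this
  exact segment_subset_triple' _ _ _ this

theorem annularRegion_eq (F : Spoked P ε k n c a f)
    (hC : ∀ x, x ∈ polygonCurve C ↔ ∃ m, x ∈ segment ℝ (a m) (a (m + 1))) :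
    annularRegion P C = tileRegion c a f := by
  rw [annularRegion, F.polygonInterior_eq hC]
  ext x
  constructor
  · rintro ⟨h1, h2⟩
    by_contra hK
    refine h2 ⟨fun j => ?_, hK⟩
    have hH := F.convexHull_subset h1
    refine lt_of_le_of_ne (hH j) fun h0 => hK ?_
    have := F.mem_hull_edge hH h0.symm
    refine mem_tileRegion_hull (j + 1) ?_
    rw [add_sub_cancel_right]
    rw [segment_symm] at this
    exact segment_subset_triple' _ _ _ this
  · rintro ⟨u, v, w, h, hx⟩
    refine ⟨?_, fun h' => h'.2 ⟨u, v, w, h, hx⟩⟩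
    refine convexHull_mono ?_ hx
    obtain ⟨hu, hv, hw⟩ := F.corner_mem h
    rintro y (rfl | rfl | rfl) <;> assumption

end Spoked

end FourConn

namespace FourConn

variable {P : Finset Plane} {C : List Plane} {ε : ℝ} {k n : ℤ}
  {c a : ℤ → Plane} {f : ℤ → ℤ}

theorem stretch_rotate {α : Type*} {a : ℤ → α} {N : ℕ} (hN : 0 < N) (h : ∀ m, a (m + N) = a m)
    (s : ℤ) (r : ℕ) : (stretch a s N).rotate r = stretch a (s + r) N := by
  have h1 : ∀ s, (stretch a s N).rotate 1 = stretch a (s + 1) N := by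
    intro s
    obtain ⟨M, rfl⟩ := Nat.exists_eq_succ_of_ne_zero hN.ne'
    have e1 : stretch a s (M + 1) = a s :: stretch a (s + 1) M := by
      simp only [stretch]
      rw [List.range_succ_eq_map]
      simp only [List.map_cons, List.map_map]
      congr 1
      · simp
      · refine List.map_congr_left fun r _ => ?_
        simp only [Function.comp]
        congr 1; push_cast; ring
    have e2 : stretch a (s + 1) (M + 1) = stretch a (s + 1) M ++ [a s] := by
      simp only [stretch]
      rw [List.range_succ]
      simp only [List.map_append, List.map_cons, List.map_nil]
      rw [← h s]
      congr 3; push_cast; ring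
    rw [Nat.succ_eq_add_one, e1, e2]
    simp
  induction r with
  | zero => simp
  | succ r ih =>
    rw [← List.rotate_rotate, ih, h1]
    congr 1; push_cast; ring

theorem cyclicPairs_stretch {α : Type*} {a : ℤ → α} {N : ℕ} (hN : 0 < N)
    (h : ∀ m, a (m + N) = a m) (p q : α) :
    (p, q) ∈ cyclicPairs (stretch a 0 N) ↔ ∃ m, p = a m ∧ q = a (m + 1) := by
  have hz : cyclicPairs (stretch a 0 N) = stretch (fun m => (a m, a (m + 1))) 0 N := by
    rw [cyclicPairs, stretch_rotate hN h]
    simp only [stretch]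
    rw [List.zip_map']
    refine List.map_congr_left fun r _ => ?_
    simp only [Prod.mk.injEq, true_and]
    congr 1; push_cast; ring
  rw [hz, mem_stretch]
  constructor
  · rintro ⟨u, -, -, h⟩
    exact ⟨u, (Prod.mk.injEq _ _ _ _ ▸ h)⟩
  · rintro ⟨m, rfl, rfl⟩
    have hq : ∀ (q : ℤ) (m : ℤ), a (m + N * q) = a m := by
      intro q
      induction q using Int.induction_on with
      | zero => simp
      | succ q ih => intro m; rw [mul_add, mul_one, ← add_assoc, h, ih]
      | pred q ih =>
        intro m
        rw [← h, show m + N * (-(q : ℤ) - 1) + N = m + N * (-q) by ring, ih]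
    have e := Int.mul_ediv_add_emod m N
    refine ⟨m % N, Int.emod_nonneg _ (by omega), ?_, ?_⟩
    · rw [zero_add]; exact Int.emod_lt_of_pos _ (by omega)
    · have e1 : a (m % N) = a m := by
        rw [← hq (m / N) (m % N)]; congr 1; linarith
      have e2 : a (m % N + 1) = a (m + 1) := by
        rw [← hq (m / N) (m % N + 1)]; congr 1; linarith
      rw [e1, e2]

/-- A frame without crossing spokes triangulates the annular region. -/
theorem Spoked.annulus (F : Spoked P ε k n c a f) (hC : C = stretch a 0 n.toNat) :
    Annulus P C (tiles P c a f) ε k n c a f := by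
  classical
  have h3 := F.three_le_n
  have hn : (n.toNat : ℤ) = n := Int.toNat_of_nonneg (by omega)
  have hper : ∀ m, a (m + n.toNat) = a m := fun m => (F.a_iff _ _).2 (by rw [hn]; simp)
  have hpairs : ∀ p q, (p, q) ∈ cyclicPairs C ↔ ∃ m, p = a m ∧ q = a (m + 1) := by
    rw [hC]; exact cyclicPairs_stretch (by omega) hper
  have hedge : ∀ p q, PolygonEdge C p q ↔
      ∃ m, (p = a m ∧ q = a (m + 1)) ∨ (p = a (m + 1) ∧ q = a m) := by
    intro p q
    rw [PolygonEdge, hpairs, hpairs]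
    constructor
    · rintro (⟨m, h1, h2⟩ | ⟨m, h1, h2⟩)
      · exact ⟨m, Or.inl ⟨h1, h2⟩⟩
      · exact ⟨m, Or.inr ⟨h2, h1⟩⟩
    · rintro ⟨m, ⟨h1, h2⟩ | ⟨h1, h2⟩⟩
      · exact Or.inl ⟨m, h1, h2⟩
      · exact Or.inr ⟨m, h2, h1⟩
  have hvert : ∀ p, p ∈ C ↔ ∃ m, p = a m := by
    intro p
    rw [hC, mem_stretch]
    constructor
    · rintro ⟨u, -, -, h⟩; exact ⟨u, h⟩
    · rintro ⟨m, rfl⟩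
      refine ⟨m % n, Int.emod_nonneg _ (by omega), ?_, (F.a_iff _ _).2 ?_⟩
      · rw [zero_add, hn]; exact Int.emod_lt_of_pos _ (by omega)
      · exact Int.dvd_self_sub_emod
  have hcurve : ∀ x, x ∈ polygonCurve C ↔ ∃ m, x ∈ segment ℝ (a m) (a (m + 1)) := by
    intro x
    constructor
    · rintro ⟨⟨p, q⟩, he, hx⟩
      obtain ⟨m, rfl, rfl⟩ := (hpairs _ _).1 he
      exact ⟨m, hx⟩
    · rintro ⟨m, hx⟩
      exact ⟨(a m, a (m + 1)), (hpairs _ _).2 ⟨m, rfl, rfl⟩, hx⟩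
  have hsub : ∀ t ∈ tiles P c a f, t ⊆ P := fun t ht => F.isTile_subset (F.mem_tiles.1 ht)
  have hcard : ∀ t ∈ tiles P c a f, t.card = 3 := fun t ht => F.isTile_card (F.mem_tiles.1 ht)
  have hCe : ∀ m, TriangulationEdge (tiles P c a f) (a m) (a (m + 1)) := by
    intro m
    obtain ⟨i, h1, h2⟩ := F.exists_block m
    exact ⟨F.a_ne_succ m, {a m, c i, a (m + 1)}, F.mem_tiles.2 (isTile_iff_corner.2
      ⟨_, _, _, Or.inl ⟨i, m, h1, h2, rfl, rfl, rfl⟩, rfl⟩), by simp, by simp⟩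
  refine { toFrame := F.toFrame, simple := ?_, mem_T := fun t => F.mem_tiles, tri := ?_,
           edge_iff := hedge, vert := hvert, rot := ?_ }
  · refine ⟨by rw [hC]; simp only [stretch, List.length_map, List.length_range]; omega,
      by rw [hC]; exact F.nodup_stretch (by omega), ?_⟩
    rintro ⟨p, q⟩ he ⟨p', q'⟩ he' hne x ⟨hx, hx'⟩
    obtain ⟨l, rfl, rfl⟩ := (hpairs _ _).1 he
    obtain ⟨m, rfl, rfl⟩ := (hpairs _ _).1 he'
    simp only at hx hx'
    have hv : ∀ l m r, a r ∈ segment ℝ (a l) (a (l + 1)) → a r ∈ segment ℝ (a m) (a (m + 1)) →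
        a r ∈ ({a l, a (l + 1)} : Set Plane) ∩ {a m, a (m + 1)} := by
      intro l m r h1 h2
      have h1' := F.gp.eq_or_eq_of_mem_segment (F.a_mem l) (F.a_mem (l + 1)) (F.a_mem r) h1
      have h2' := F.gp.eq_or_eq_of_mem_segment (F.a_mem m) (F.a_mem (m + 1)) (F.a_mem r) h2
      exact ⟨by simpa using h1', by simpa using h2'⟩
    rcases mem_segment_cases hx with h | h | h
    · subst h; exact hv l m l hx hx'
    · subst h; exact hv l m (l + 1) hx hx'
    rcases mem_segment_cases hx' with h' | h' | h'
    · subst h'; exact hv l m m hx hx'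
    · subst h'; exact hv l m (m + 1) hx hx'
    exfalso
    refine disjoint_edges F.gp hsub hcard F.tiles_disjoint (hCe l) (hCe m) ?_ h h'
    intro hs
    rcases Sym2.eq_iff.1 hs with ⟨h1, h2⟩ | ⟨h1, h2⟩
    · exact hne (by rw [h1, h2])
    · rw [F.a_iff] at h1 h2
      have := dvd_sub h2 h1
      rw [show l + 1 - m - (l - (m + 1)) = 2 by ring] at this
      have := Int.le_of_dvd (by norm_num) this
      omega
  · refine ⟨hsub, hcard, F.tiles_empty, F.tiles_disjoint, ?_⟩
    rw [F.annularRegion_eq hcurve]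
    ext x
    constructor
    · rintro ⟨t, ht, hx⟩
      obtain ⟨u, v, w, h, rfl⟩ := isTile_iff_corner.1 (F.mem_tiles.1 ht)
      exact ⟨u, v, w, h, by rwa [coe_triple] at hx⟩
    · rintro ⟨u, v, w, h, hx⟩
      exact ⟨{u, v, w}, F.mem_tiles.2 (isTile_iff_corner.2 ⟨_, _, _, h, rfl⟩), by
        rwa [coe_triple]⟩
  · intro s
    refine ⟨_, Or.inl ?_, rfl⟩
    have e := stretch_rotate (a := a) (N := n.toNat) (by omega) hper 0 (s % n).toNat
    have e' : stretch a (0 + ((s % n).toNat : ℕ)) n.toNat =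
        (List.range n.toNat).map (fun r : ℕ => a (s + r)) := by
      simp only [stretch]
      refine List.map_congr_left fun r _ => (F.a_iff _ _).2 ?_
      rw [Int.toNat_of_nonneg (Int.emod_nonneg _ (by omega))]
      rw [show 0 + s % n + (r : ℤ) - (s + r) = -(s - s % n) by ring, dvd_neg]
      exact Int.dvd_self_sub_emod
    rw [e', ← hC] at e
    exact (List.IsRotated.symm ⟨_, e⟩)

end FourConn

namespace FourConn

/-! ### Periodic listings of good sets -/

/-- A periodic enumeration `τ` of the triangles of `S` around the hull. The triangle on the hull
edge `c (i - 1) c i` has the index `f i`, and the degenerate triangles at `c i` follow it in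
clockwise order. -/
structure Listing {k : ℕ} (c : ZMod k → Plane) (S : Multiset (InwardTriangle k)) (N : ℕ)
    (τ : ℤ → InwardTriangle k) (f : ℤ → ℤ) : Prop where
  eq_iff : ∀ l m, τ l = τ m ↔ (N : ℤ) ∣ l - m
  mem : ∀ m, τ m ∈ S
  surj : ∀ t ∈ S, ∃ m, τ m = t
  f_lt : ∀ i, f i < f (i + 1)
  f_per : ∀ i, f (i + k) = f i + N
  nondeg : ∀ i, (τ (f i)).degenerate = false
  index : ∀ i m, f i ≤ m → m < f (i + 1) → (τ m).i = (i : ZMod k)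
  deg : ∀ i m, f i < m → m < f (i + 1) → (τ m).degenerate = true
  right : ∀ i l m, f i < l → l < m → m < f (i + 1) →
    RightOf (c (i : ZMod k)) (τ l).apex (τ m).apex

theorem intCast_succ_cases {k : ℕ} (hk : 0 < k) (j : ℤ) [NeZero k] :
    (((j + 1 : ℤ) : ZMod k).val = (j : ZMod k).val + 1 ∧ (j + 1) / k = j / k) ∨
      ((j : ZMod k).val + 1 = k ∧ ((j + 1 : ℤ) : ZMod k).val = 0 ∧ (j + 1) / k = j / k + 1) := by
  have e := Int.mul_ediv_add_emod j k
  have h1 := Int.emod_lt_of_pos j (by omega : (0 : ℤ) < k)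
  have v := ZMod.val_intCast (n := k) j
  have v' := ZMod.val_intCast (n := k) (j + 1)
  by_cases h : j % k + 1 < k
  · left
    obtain ⟨hq, hr⟩ := (Int.ediv_emod_unique (a := j + 1) (b := k) (r := j % k + 1) (q := j / k)
      (by omega)).2 ⟨by linarith, by omega, h⟩
    exact ⟨by omega, hq⟩
  · right
    obtain ⟨hq, hr⟩ := (Int.ediv_emod_unique (a := j + 1) (b := k) (r := 0) (q := j / k + 1)
      (by omega)).2 ⟨by rw [mul_add]; omega, le_rfl, by omega⟩
    exact ⟨by omega, by omega, hq⟩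

theorem IsTriangleList.exists_listing {k : ℕ} (hk : 0 < k) {c : ZMod k → Plane}
    {S : Multiset (InwardTriangle k)} {L : List (InwardTriangle k)} (hL : IsTriangleList c S L)
    (hS : ∀ i : ZMod k, ∃ t ∈ S, t.degenerate = false ∧ t.i = i) :
    ∃ τ f, Listing c S L.length τ f ∧ L = stretch τ 0 L.length := by
  have : NeZero k := ⟨hk.ne'⟩
  set N := L.length with hN
  have hR : ∀ r s : ℕ, (hr : r < N) → (hs : s < N) → r < s →
      InwardTriangle.Before c L[r] L[s] := fun r s hr hs h =>
    List.pairwise_iff_getElem.1 hL.sorted r s hr hs h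
  have hp : ∀ i : ZMod k, ∃ r, ∃ h : r < N, L[r].degenerate = false ∧ L[r].i = i := by
    intro i
    obtain ⟨t, ht, h1, h2⟩ := hS i
    obtain ⟨r, hr, rfl⟩ := List.getElem_of_mem ((hL.mem_iff t).2 ht)
    exact ⟨r, hr, h1, h2⟩
  choose p hpN hpd hpi using hp
  have first : ∀ r (h : r < N), p L[r].i ≤ r := by
    intro r h
    by_contra hcon
    push Not at hcon
    rcases hR _ _ h (hpN _) hcon with h1 | ⟨-, ⟨-, h1⟩ | ⟨-, h1, -⟩⟩
    · rw [hpi] at h1; exact lt_irrefl _ h1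
    · rw [hpd] at h1; exact Bool.noConfusion h1
    · rw [hpd] at h1; exact Bool.noConfusion h1
  have before : ∀ r (h : r < N) (j : ZMod k), L[r].i.val < j.val → r < p j := by
    intro r h j hj
    by_contra hcon
    push Not at hcon
    rcases hcon.eq_or_lt with rfl | hcon
    · rw [hpi] at hj; exact lt_irrefl _ hj
    rcases hR _ _ (hpN _) h hcon with h1 | ⟨h1, -⟩
    · rw [hpi] at h1; exact lt_asymm h1 hj
    · rw [hpi] at h1; rw [h1] at hj; exact lt_irrefl _ hj
  have hp0 : p 0 = 0 := by
    have h0 : 0 < N := (Nat.zero_le _).trans_lt (hpN 0)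
    have h1 := first 0 h0
    by_cases h2 : L[0].i = 0
    · rw [h2] at h1; omega
    · have h3 := before (p 0) (hpN 0) L[0].i (by
        rw [hpi, ZMod.val_zero]
        exact Nat.pos_of_ne_zero (by rwa [Ne, ZMod.val_eq_zero]))
      omega
  have hNpos : 0 < N := (Nat.zero_le _).trans_lt (hpN 0)
  have hlt : ∀ m : ℤ, (m % N).toNat < N := fun m => by
    have := Int.emod_nonneg m (by omega : (N : ℤ) ≠ 0)
    have := Int.emod_lt_of_pos m (by omega : (0 : ℤ) < N)
    omega
  obtain ⟨τ, hτ⟩ : ∃ τ : ℤ → InwardTriangle k, ∀ m, τ m = L[(m % N).toNat]'(hlt m) :=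
    ⟨_, fun m => rfl⟩
  have hτr : ∀ (r : ℕ) (h : r < N) (q : ℤ), τ (r + N * q) = L[r] := by
    intro r h q
    rw [hτ]
    congr 1
    rw [Int.add_mul_emod_self_left, Int.emod_eq_of_lt (by omega) (by omega)]
    simp
  let f : ℤ → ℤ := fun j => p (j : ZMod k) + N * (j / k)
  have hwin : ∀ i m, f i ≤ m → m < f (i + 1) → ∃ r : ℕ, ∃ h : r < N,
      m = r + N * (i / k) ∧ L[r].i = (i : ZMod k) := by
    intro i m h1 h2
    simp only [f] at h1 h2
    have hpi' := hpN (i : ZMod k)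
    have hpi'' := hpN ((i + 1 : ℤ) : ZMod k)
    have key : ∀ r (h : r < N), p (i : ZMod k) ≤ r →
        (∀ j : ZMod k, (i : ZMod k).val < j.val → r < p j) → L[r].i = (i : ZMod k) := by
      intro r h h3 h4
      apply ZMod.val_injective
      by_contra hne
      rcases lt_or_gt_of_ne hne with h5 | h5
      · exact absurd (before r h _ h5) (by omega)
      · exact absurd (h4 _ h5) (not_lt.2 (first r h))
    rcases intCast_succ_cases hk i with ⟨e1, e2⟩ | ⟨e1, e2, e3⟩
    · rw [e2] at h2
      refine ⟨(m - N * (i / k)).toNat, by omega, by omega, key _ _ (by omega) fun j hj => ?_⟩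
      have : p ((i + 1 : ℤ) : ZMod k) ≤ p j := by
        rcases (show ((i + 1 : ℤ) : ZMod k).val ≤ j.val by omega).eq_or_lt with h | h
        · rw [ZMod.val_injective _ h]
        · exact (before _ (hpN _) j (by rwa [hpi])).le
      omega
    · rw [(ZMod.val_eq_zero _).1 e2, hp0, e3, mul_add] at h2
      refine ⟨(m - N * (i / k)).toNat, by omega, by omega, key _ _ (by omega) fun j hj => ?_⟩
      have := ZMod.val_lt j
      omega
  have hfτ : ∀ i, τ (f i) = L[p (i : ZMod k)]'(hpN _) := fun i => hτr _ (hpN _) _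
  refine ⟨τ, f, ⟨?_, ?_, ?_, ?_, ?_, ?_, ?_, ?_, ?_⟩, ?_⟩
  · intro l m
    rw [hτ, hτ, hL.nodup.getElem_inj_iff]
    have h1 := Int.emod_nonneg l (by omega : (N : ℤ) ≠ 0)
    have h2 := Int.emod_nonneg m (by omega : (N : ℤ) ≠ 0)
    rw [← Int.emod_eq_emod_iff_emod_sub_eq_zero.trans Int.dvd_iff_emod_eq_zero.symm]
    omega
  · intro m
    rw [hτ, ← hL.mem_iff]
    exact List.getElem_mem _
  · intro t ht
    obtain ⟨r, hr, rfl⟩ := List.getElem_of_mem ((hL.mem_iff t).2 ht)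
    exact ⟨r + N * 0, hτr r hr 0⟩
  · intro i
    simp only [f]
    have hpi' := hpN (i : ZMod k)
    rcases intCast_succ_cases hk i with ⟨e1, e2⟩ | ⟨e1, e2, e3⟩
    · rw [e2]
      have := before _ (hpN (i : ZMod k)) ((i + 1 : ℤ) : ZMod k) (by rw [hpi]; omega)
      omega
    · rw [e3, mul_add]
      omega
  · intro i
    simp only [f]
    rw [Int.add_ediv_of_dvd_right (by simp), Int.ediv_self (by omega), mul_add]
    push_cast
    simp only [CharP.cast_eq_zero, add_zero]
    ring
  · intro i
    rw [hfτ, hpd]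
  · intro i m h1 h2
    obtain ⟨r, hr, rfl, h⟩ := hwin i m h1 h2
    rw [hτr r hr, h]
  · intro i m h1 h2
    obtain ⟨r, hr, rfl, h⟩ := hwin i m h1.le h2
    rw [hτr r hr]
    simp only [f] at h1
    rcases hR _ _ (hpN (i : ZMod k)) hr (by omega) with h3 | ⟨-, ⟨-, h3⟩ | ⟨h3, -⟩⟩
    · rw [hpi, h] at h3; exact absurd h3 (lt_irrefl _)
    · exact h3
    · rw [hpd] at h3; exact Bool.noConfusion h3
  · intro i l m h1 h2 h3
    obtain ⟨r, hr, rfl, h⟩ := hwin i l h1.le (by omega)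
    obtain ⟨s, hs, rfl, h'⟩ := hwin i m (by omega) h3
    simp only [f] at h1
    have hrd : L[r].degenerate = true := by
      rcases hR _ _ (hpN (i : ZMod k)) hr (by omega) with h3 | ⟨-, ⟨-, h3⟩ | ⟨h3, -⟩⟩
      · rw [hpi, h] at h3; exact absurd h3 (lt_irrefl _)
      · exact h3
      · rw [hpd] at h3; exact Bool.noConfusion h3
    rw [hτr r hr, hτr s hs]
    rcases hR _ _ hr hs (by omega) with h4 | ⟨-, ⟨h4, -⟩ | ⟨-, -, h4⟩⟩
    · rw [h, h'] at h4; exact absurd h4 (lt_irrefl _)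
    · rw [hrd] at h4; exact Bool.noConfusion h4
    · rwa [h] at h4
  · apply List.ext_getElem
    · simp [stretch, hN]
    · intro r h1 h2
      simp only [stretch, List.getElem_map, List.getElem_range]
      have := hτr r h1 0
      rw [← this]
      congr 1; ring

end FourConn

namespace FourConn

theorem openTriangle_rev (p q r : Plane) : openTriangle r q p = openTriangle p q r := by
  rw [openTriangle_swap, openTriangle_rot]

theorem IsHullCycle.mem {k : ℕ} {P : Finset Plane} {c : ZMod k → Plane} (hc : IsHullCycle P c)
    (i : ZMod k) : c i ∈ P := by
  have : c i ∈ Set.extremePoints ℝ (convexHull ℝ (P : Set Plane)) := hc.range_eq ▸ ⟨i, rfl⟩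
  exact_mod_cast extremePoints_convexHull_subset this

theorem mem_innerPoints {k : ℕ} {P : Finset Plane} {c : ZMod k → Plane} {x : Plane} :
    x ∈ innerPoints P c ↔ x ∈ P ∧ ∀ i, x ≠ c i := by
  simp only [innerPoints, Finset.mem_filter, Set.mem_range, not_exists, ne_comm (a := x), ne_eq]

theorem IsHullCycle.left_of_inner {k : ℕ} {P : Finset Plane} {c : ZMod k → Plane}
    (hc : IsHullCycle P c) {x : Plane} (hx : x ∈ innerPoints P c) (i : ZMod k) :
    0 < orient (c i) (c (i + 1)) x :=
  hc.ccw i x (mem_innerPoints.1 hx).1 ((mem_innerPoints.1 hx).2 _) ((mem_innerPoints.1 hx).2 _)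

theorem IsHullCycle.left_of_inner' {k : ℕ} {P : Finset Plane} {c : ZMod k → Plane}
    (hc : IsHullCycle P c) {x : Plane} (hx : x ∈ innerPoints P c) (i : ZMod k) :
    0 < orient (c (i - 1)) (c i) x := by
  simpa using hc.left_of_inner hx (i - 1)

theorem IsGoodSet.exists_apex {k : ℕ} {P : Finset Plane} {c : ZMod k → Plane}
    {S : Multiset (InwardTriangle k)} (hS : IsGoodSet P c S) (hdist : HasDistinctInwardVertices S)
    {x : Plane} (hx : x ∈ innerPoints P c) : ∃ t ∈ S, t.apex = x := by
  classical
  have h : (S.map InwardTriangle.apex).toFinset = innerPoints P c := by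
    refine Finset.eq_of_subset_of_card_le ?_ ?_
    · intro y hy
      obtain ⟨t, ht, rfl⟩ := Multiset.mem_map.1 (Multiset.mem_toFinset.1 hy)
      exact (hS.valid t ht).1
    · rw [Multiset.toFinset_card_of_nodup hdist, Multiset.card_map, hS.card_eq]
  rw [← h, Multiset.mem_toFinset] at hx
  exact Multiset.mem_map.1 hx

theorem HasDistinctInwardVertices.inj {k : ℕ} {S : Multiset (InwardTriangle k)}
    (hdist : HasDistinctInwardVertices S) {t t' : InwardTriangle k} (ht : t ∈ S) (ht' : t' ∈ S)
    (h : t.apex = t'.apex) : t = t' :=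
  Multiset.inj_on_of_nodup_map hdist t ht t' ht' h

namespace Listing

variable {k : ℕ} {P : Finset Plane} {c : ZMod k → Plane} {S : Multiset (InwardTriangle k)} {N : ℕ}
  {τ : ℤ → InwardTriangle k} {f : ℤ → ℤ}

theorem region (Li : Listing c S N τ f) (i : ℤ) :
    (τ (f i)).openRegion c = openTriangle (c (i : ZMod k)) (τ (f i)).apex (c ((i - 1 : ℤ) : ZMod k)) := by
  have h1 := Li.nondeg i
  have h2 := Li.index i (f i) le_rfl (Li.f_lt i)
  rw [InwardTriangle.openRegion, InwardTriangle.left, InwardTriangle.right, h1, h2,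
    openTriangle_rev]
  simp

/-- A spoke is a side of a nondegenerate triangle or it is a degenerate triangle. -/
theorem owner (Li : Listing c S N τ f) (hc : IsHullCycle P c) (hS : IsGoodSet P c S) {x : Plane}
    {j : ℤ} (h : Nb (fun m => (τ m).apex) f x j) :
    (∃ i r, orient x (c (j : ZMod k)) r ≠ 0 ∧
        openTriangle x (c (j : ZMod k)) r = (τ (f i)).openRegion c) ∨
      ∃ m, x = (τ m).apex ∧ (τ m).degenerate = true ∧ (τ m).i = (j : ZMod k) ∧
        (τ m).openRegion c = openSegment ℝ x (c (j : ZMod k)) := by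
  obtain ⟨m, h1, h2, rfl⟩ := h
  have ho : ∀ i l : ℤ, 0 < orient (c ((i - 1 : ℤ) : ZMod k)) (c (i : ZMod k)) (τ l).apex := by
    intro i l
    push_cast
    exact hc.left_of_inner' (hS.valid _ (Li.mem l)).1 _
  simp only
  rcases h1.eq_or_lt with rfl | h1
  · refine Or.inl ⟨j, c ((j - 1 : ℤ) : ZMod k), ?_, ?_⟩
    · have := (ho j (f j)).ne'
      intro h; apply this; simp only [orient] at h ⊢; linarith
    · rw [Li.region, openTriangle_swap]
  rcases h2.eq_or_lt with rfl | h2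
  · refine Or.inl ⟨j + 1, c ((j + 1 : ℤ) : ZMod k), ?_, ?_⟩
    · have := (ho (j + 1) (f (j + 1))).ne'
      rw [add_sub_cancel_right] at this
      intro h; apply this; simp only [orient] at h ⊢; linarith
    · rw [Li.region, add_sub_cancel_right, openTriangle_rot]
  · refine Or.inr ⟨m, rfl, Li.deg j m h1 h2, Li.index j m h1.le h2, ?_⟩
    rw [InwardTriangle.openRegion, InwardTriangle.left, InwardTriangle.right, Li.deg j m h1 h2,
      Li.index j m h1.le h2, if_pos rfl, openTriangle_self_right]

theorem spoke_hull (Li : Listing c S N τ f) (hc : IsHullCycle P c) (hS : IsGoodSet P c S)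
    {x : Plane} (i : ℤ) {j : ℤ} (h : Nb (fun m => (τ m).apex) f x j) {w : Plane}
    (hw : w ∈ openSegment ℝ x (c (j : ZMod k))) : w ∉ (τ (f i)).openRegion c := by
  intro hwt
  rcases Li.owner hc hS h with ⟨i', r, hr, he⟩ | ⟨m, rfl, hd, -, he⟩
  · by_cases heq : τ (f i') = τ (f i)
    · rw [← heq, ← he] at hwt
      exact notMem_openTriangle_of_edge hr (openSegment_subset_segment _ _ _ hw) hwt
    · have hopen : IsOpen ((τ (f i)).openRegion c) := by
        rw [Li.region]
        apply isOpen_openTriangle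
        have := (hc.left_of_inner' (hS.valid _ (Li.mem (f i))).1 (i : ZMod k)).ne'
        rw [← orient_rot]
        rw [orient_rot, ← orient_rot, ← orient_rot]
        exact_mod_cast this
      have hcl : w ∈ closure ((τ (f i')).openRegion c) := by
        rw [← he]
        refine convexHull_subset_closure _ _ _ ?_
        refine convexHull_mono ?_ ((convexHull_pair (𝕜 := ℝ) x (c (j : ZMod k))).symm ▸
          openSegment_subset_segment _ _ _ hw)
        intro y hy
        rcases hy with rfl | rfl <;> simp
      obtain ⟨y, hy, hy'⟩ := mem_closure_iff.1 hcl _ hopen hwt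
      exact Set.disjoint_left.1 (hS.pairwise_disjoint _ (Li.mem _) _ (Li.mem _) heq) hy' hy
  · refine Set.disjoint_left.1 (hS.pairwise_disjoint _ (Li.mem m) _ (Li.mem (f i)) ?_)
      (he ▸ hw) hwt
    intro h
    rw [h, Li.nondeg] at hd
    exact Bool.noConfusion hd

theorem frame (Li : Listing c S N τ f) (hP : GeneralPosition P) (hc : IsHullCycle P c)
    (hS : IsGoodSet P c S) (hdist : HasDistinctInwardVertices S) :
    Frame P 1 k N (fun j => c (j : ZMod k)) (fun m => (τ m).apex) f := by
  have h3 := hc.three_le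
  have : NeZero k := ⟨by omega⟩
  have hin := fun m => (hS.valid _ (Li.mem m)).1
  have hinP := fun m => (mem_innerPoints.1 (hin m)).1
  refine { gp := hP, eps := one_ne_zero, three_le := by exact_mod_cast h3, c_iff := ?_,
           a_iff := ?_, f_lt := Li.f_lt, f_per := Li.f_per, c_mem := fun i => hc.mem _,
           a_mem := hinP, c_ne_a := fun i m => ((mem_innerPoints.1 (hin m)).2 _).symm,
           cover := ?_, hull := ?_, fan := ?_ }
  · intro i j
    rw [hc.injective.eq_iff, eq_comm, ZMod.intCast_eq_intCast_iff_dvd_sub]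
  · intro l m
    rw [← Li.eq_iff]
    exact ⟨fun h => hdist.inj (Li.mem l) (Li.mem m) h, fun h => by rw [h]⟩
  · intro x hx
    by_cases h : ∀ i, x ≠ c i
    · obtain ⟨t, ht, rfl⟩ := hS.exists_apex hdist (mem_innerPoints.2 ⟨hx, h⟩)
      obtain ⟨m, rfl⟩ := Li.surj t ht
      exact Or.inr ⟨m, rfl⟩
    · push Not at h
      obtain ⟨i, rfl⟩ := h
      obtain ⟨j, rfl⟩ := ZMod.intCast_surjective i
      exact Or.inl ⟨j, rfl⟩
  · intro i x hx h1 h2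
    rw [ori_one]
    push_cast at h2 ⊢
    exact hc.ccw _ x hx h1 h2
  · intro i m h1 h2
    have hl : ∀ l, 0 < ori 1 (c (i : ZMod k)) (c ((i + 1 : ℤ) : ZMod k)) (τ l).apex := fun l => by
      rw [ori_one]
      push_cast
      exact hc.left_of_inner (hin l) _
    have hr : ∀ l, 0 < ori 1 (c (i : ZMod k)) (τ l).apex (c ((i - 1 : ℤ) : ZMod k)) := fun l => by
      rw [ori_rot', ori_rot', ori_one, ← orient_rot]
      push_cast
      rw [orient_rot]
      exact hc.left_of_inner' (hin l) _
    by_contra hcon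
    have hne : (τ m).apex ≠ (τ (m + 1)).apex := by
      intro h
      have h5 := (Li.eq_iff _ _).1 (hdist.inj (Li.mem _) (Li.mem _) h)
      have h6 := Int.le_of_dvd (by norm_num) ((dvd_neg.2 h5).trans (by simp : _ ∣ (1 : ℤ)))
      have h8 := strictMono_int_of_lt_succ Li.f_lt (show i + 1 < i + k by omega)
      rw [Li.f_per] at h8
      omega
    have hpos : 0 < ori 1 (c (i : ZMod k)) (τ m).apex (τ (m + 1)).apex := by
      have := hP.ori_ne one_ne_zero (hc.mem (i : ZMod k)) (hinP m) (hinP (m + 1))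
        ((mem_innerPoints.1 (hin m)).2 _).symm ((mem_innerPoints.1 (hin (m + 1))).2 _).symm hne
      rw [ori_swap] at hcon
      have h9 := lt_or_gt_of_ne this
      rcases h9 with h9 | h9
      · exact absurd (neg_pos.2 h9) hcon
      · exact h9
    rcases h1.eq_or_lt with rfl | h1
    · obtain ⟨w, hw, hwt⟩ := corner_meets_openTriangle hpos (hr _) (hr _)
      rw [openSegment_symm] at hw
      exact Li.spoke_hull hc hS (x := (τ (f i + 1)).apex) (j := i) i ⟨f i + 1, by omega, by omega, rfl⟩ hw
        (Li.region i ▸ hwt)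
    rcases (show m + 1 ≤ f (i + 1) by omega).eq_or_lt with h2 | h2
    · obtain ⟨w, hw, hwt⟩ := corner_meets_openTriangle (hl m) hpos (hl _)
      rw [openSegment_symm] at hw
      rw [h2, ← openTriangle_rot] at hwt
      refine Li.spoke_hull hc hS (x := (τ m).apex) (j := i) (i + 1) ⟨m, by omega, by omega, rfl⟩ hw ?_
      rw [Li.region, add_sub_cancel_right]
      exact hwt
    · have := Li.right i m (m + 1) h1 (by omega) h2
      rw [ori_one] at hpos
      exact lt_asymm this hpos

theorem spoked (Li : Listing c S N τ f) (hP : GeneralPosition P) (hc : IsHullCycle P c)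
    (hS : IsGoodSet P c S) (hdist : HasDistinctInwardVertices S)
    (hcons : ∀ m, (τ m).apex ≠ (τ (m + 1)).apex → DistinctVertexCondition P c S (τ m) (τ (m + 1))) :
    Spoked P 1 k N (fun j => c (j : ZMod k)) (fun m => (τ m).apex) f := by
  have F := Li.frame hP hc hS hdist
  have hin := fun m => (hS.valid _ (Li.mem m)).1
  have hsp : ∀ x i j, Nb (fun m => (τ m).apex) f x j → ∀ w ∈ openSegment ℝ x (c (j : ZMod k)),
      w ∉ (τ (f i)).openRegion c := fun x i j hx w hw => Li.spoke_hull hc hS i hx hw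
  refine { toFrame := F, spokes := ?_, spoke_hull := ?_, empty_hull := ?_, empty_fan := ?_ }
  · intro x y i j hx hy hne w hw hw'
    have hmem : ∀ {x i}, Nb (fun m => (τ m).apex) f x i → x ∈ P ∧ x ≠ c (i : ZMod k) := by
      rintro x i ⟨m, -, -, rfl⟩
      exact mem_innerPoints.1 (hin m) |>.imp id fun h => h _
    have key : ∀ {x y i j}, Nb (fun m => (τ m).apex) f x i → Nb (fun m => (τ m).apex) f y j →
        s(x, c (i : ZMod k)) ≠ s(y, c (j : ZMod k)) → w ∈ openSegment ℝ x (c (i : ZMod k)) →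
        w ∈ openSegment ℝ y (c (j : ZMod k)) → ∀ i' r, orient x (c (i : ZMod k)) r ≠ 0 →
        openTriangle x (c (i : ZMod k)) r ≠ (τ (f i')).openRegion c := by
      intro x y i j hx hy hne hw hw' i' r hr he
      obtain ⟨z, hz, hz'⟩ := crossing_meets_openTriangle hr (hP.orient_ne_or (hmem hx).1 (hc.mem _)
        (hmem hy).1 (hc.mem _) (hmem hx).2 (hmem hy).2 hne) hw hw'
      exact hsp y i' j hy z hz (he ▸ hz')
    rcases Li.owner hc hS hx with ⟨i', r, hr, he⟩ | ⟨m, rfl, hd, hi, he⟩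
    · exact key hx hy hne hw hw' i' r hr he
    rcases Li.owner hc hS hy with ⟨i', r, hr, he'⟩ | ⟨m', rfl, hd', hi', he'⟩
    · exact key hy hx hne.symm hw' hw i' r hr he'
    · refine Set.disjoint_left.1 (hS.pairwise_disjoint _ (Li.mem m) _ (Li.mem m') ?_)
        (he ▸ hw) (he' ▸ hw')
      intro h
      apply hne
      rw [← hi, ← hi', h]
  · intro x i j hx w hw
    rw [← Li.region]
    exact hsp x i j hx w hw
  · intro i x hx
    rw [← Li.region]
    exact (hS.valid _ (Li.mem _)).2 (Li.nondeg i) x hx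
  · intro i m l h1 h2
    have := (hcons m (F.a_ne_succ m)).2 _ (hin l)
    rwa [InwardTriangle.right, Li.index i m h1 h2] at this

end Listing

end FourConn

namespace FourConn

variable {P : Finset Plane} {C : List Plane} {T : Finset (Finset Plane)} {ε : ℝ} {k n : ℤ}
  {c a : ℤ → Plane} {f : ℤ → ℤ} {D : Set (Sym2 Plane)} {N : ℕ} {c₀ : ZMod N → Plane}

theorem IsHullCycle.adjacent_of_side (hc : IsHullCycle P c₀) {i j : ZMod N} (hij : i ≠ j)
    (h : ∀ x ∈ P, x ≠ c₀ i → x ≠ c₀ j → 0 < ori ε (c₀ i) (c₀ j) x) : j = i + 1 ∨ i = j + 1 := by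
  have : Fact (1 < N) := ⟨by have := hc.three_le; omega⟩
  by_contra hcon
  push Not at hcon
  have h0 := hc.injective
  have h1 := h (c₀ (i + 1)) (hc.mem _) (h0.ne (by simp)) (h0.ne hcon.1.symm)
  have h2 := h (c₀ (i - 1)) (hc.mem _) (h0.ne (by simp))
    (h0.ne fun h => hcon.2 (by rw [← h]; ring))
  have h3 : 0 < orient _ _ _ := hc.ccw i (c₀ j) (hc.mem _) (h0.ne hij.symm) (h0.ne hcon.1)
  have h4 : 0 < orient _ _ _ := hc.ccw (i - 1) (c₀ j) (hc.mem _)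
    (h0.ne fun h => hcon.2 (by rw [h]; ring)) (h0.ne (by simpa using hij.symm))
  rw [sub_add_cancel, ← orient_rot] at h4
  rw [← orient_rot, orient_swap, orient_rot, orient_rot] at h3
  have e : orient (c₀ i) (c₀ j) (c₀ (i + 1)) < 0 := by
    simp only [orient] at h3 ⊢; linarith
  rw [ori] at h1 h2
  have hε : ε < 0 := by by_contra hε; push Not at hε; nlinarith
  nlinarith

theorem Annulus.exists_maximal (A : Annulus P C T ε k n c a f) :
    ∃ T ε c a f D, Annulus P C T ε k n c a f ∧ IsDissection C a f D ∧
      ∀ T' ε' c' a' f' D', Annulus P C T' ε' k n c' a' f' → IsDissection C a' f' D' →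
        D'.ncard ≤ D.ncard := by
  classical
  let s : Set ℕ := {m | ∃ T ε c a f D, Annulus P C T ε k n c a f ∧ IsDissection C a f D ∧
    D.ncard = m}
  have hs : s.Nonempty := ⟨_, T, ε, c, a, f, ∅, A, ⟨by simp, by simp, by simp [NbFree]⟩, rfl⟩
  have hb : BddAbove s := by
    refine ⟨((fun x : Plane × Plane => s(x.1, x.2)) '' (C.toFinset ×ˢ C.toFinset)).ncard, ?_⟩
    rintro _ ⟨_, _, _, _, _, D, -, hD, rfl⟩
    refine Set.ncard_le_ncard ?_ (Set.toFinite _)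
    intro e he
    induction e using Sym2.ind with
    | _ g h => exact ⟨(g, h), by simpa using ⟨(hD.diagonal g h he).2.1.1,
        (hD.diagonal g h he).2.2.1.1⟩, rfl⟩
  obtain ⟨T, ε, c, a, f, D, hA, hD, h⟩ := Nat.sSup_mem hs hb
  exact ⟨T, ε, c, a, f, D, hA, hD, fun T' ε' c' a' f' D' hA' hD' =>
    h ▸ le_csSup hb ⟨T', ε', c', a', f', D', hA', hD', rfl⟩⟩

theorem Annulus.isConsistentTriple (A : Annulus P C T ε k n c a f) (hc : IsHullCycle P c₀)
    (hC : ∀ p, p ∈ C ↔ p ∈ innerPoints P c₀) (hD : IsDissection C a f D)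
    (hmax : ∀ T' ε' c' a' f' D', Annulus P C T' ε' k n c' a' f' → IsDissection C a' f' D' →
      D'.ncard ≤ D.ncard) : IsConsistentTriple P c₀ T C D := by
  classical
  have hin : ∀ m, a m ∈ innerPoints P c₀ := fun m => (hC _).1 (A.a_mem_C m)
  have out : ∀ i, ∃ j, c i = c₀ j := by
    intro i
    by_contra h
    push Not at h
    obtain ⟨m, hm⟩ := (A.vert _).1 ((hC _).2 (mem_innerPoints.2 ⟨A.c_mem i, h⟩))
    exact A.c_ne_a i m hm
  have into : ∀ j, ∃ i, c₀ j = c i := by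
    intro j
    rcases A.cover _ (hc.mem j) with h | ⟨m, h⟩
    · exact h
    · exact absurd h.symm ((mem_innerPoints.1 (hin m)).2 j)
  refine ⟨A.simple, hC, A.tri, ?_, ?_, ?_, ?_⟩
  · have key : ∀ i j l, c₀ i = c l → c₀ j = c (l + 1) → j = i + 1 ∨ i = j + 1 := by
      intro i j l hi hj
      refine hc.adjacent_of_side (ε := ε) ?_ ?_
      · rintro rfl
        exact A.c_ne_succ l (hi.symm.trans hj)
      · rw [hi, hj]
        exact A.hull l
    intro i j h
    obtain ⟨p, hp⟩ := into i
    obtain ⟨q, hq⟩ := into j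
    rw [hp, hq] at h
    rcases A.hull_adj h with h' | h'
    · exact key i j p hp (hq.trans h')
    · exact (key j i q hq (hp.trans h')).symm
  · have key : ∀ t ∈ T, ∀ x ∈ innerPoints P c₀, x ∈ t → (∃ i j, i ≠ j ∧ c₀ i ∈ t ∧ c₀ j ∈ t) →
        ∃ i, t = {c (i - 1), c i, a (f i)} ∧ x = a (f i) := by
      rintro t ht x hx hxt ⟨i, j, hij, hi, hj⟩
      rcases (A.mem_T t).1 ht with ⟨l, rfl⟩ | ⟨l, m, -, -, rfl⟩
      · refine ⟨l, rfl, ?_⟩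
        simp only [Finset.mem_insert, Finset.mem_singleton] at hxt
        obtain ⟨j1, h1⟩ := out (l - 1)
        obtain ⟨j2, h2⟩ := out l
        rcases hxt with rfl | rfl | h
        · exact absurd h1 ((mem_innerPoints.1 hx).2 _)
        · exact absurd h2 ((mem_innerPoints.1 hx).2 _)
        · exact h
      · simp only [Finset.mem_insert, Finset.mem_singleton,
          ((mem_innerPoints.1 (hin _)).2 _).symm, false_or, or_false] at hi hj
        exact absurd (hc.injective (hi.trans hj.symm)) hij
    intro t ht t' ht' x hx hxt hxt' h h'
    obtain ⟨i, rfl, rfl⟩ := key t ht x hx hxt h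
    obtain ⟨i', rfl, he⟩ := key t' ht' _ hx hxt' h'
    obtain ⟨q, hq⟩ := (A.a_iff _ _).1 he
    have : f i = f (i' + k * q) := by rw [A.f_mul]; linarith
    have hi := A.f_mono.injective this
    have e1 : c i = c i' := (A.c_iff _ _).2 ⟨q, by rw [hi]; ring⟩
    have e2 : c (i - 1) = c (i' - 1) := (A.c_iff _ _).2 ⟨q, by rw [hi]; ring⟩
    rw [e1, e2, he]
  · have hiff : ∀ D, IsAdmissible P T C D ↔ IsDissection C a f D := fun D =>
      A.isAdmissible_iff.trans ⟨fun h => ⟨h.1, h.2.1, h.2.2⟩, fun h => ⟨h.1, h.2, h.3⟩⟩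
    refine ⟨(hiff D).2 hD, fun D' hD' hle => ?_⟩
    have hD' := (hiff D').1 hD'
    exact (Set.eq_of_subset_of_ncard_le hle (hmax _ _ _ _ _ _ A hD')
      ((A.isPlaneGraph hD').finite.subset Set.subset_union_right)).ge
  · intro W hW h4
    exact Region.hasFanStructure ⟨A, hD, hmax, hW⟩ out h4

end FourConn

theorem mainTheorem10 {k : ℕ} (P : Finset Plane) (hP : FourConn.GeneralPosition P)
    (c : ZMod k → Plane) (hc : FourConn.IsHullCycle P c)
    (S : Multiset (FourConn.InwardTriangle k)) (hS : FourConn.IsGoodSet P c S)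
    (hdist : FourConn.HasDistinctInwardVertices S) :
    ∃ (T : Finset (Finset Plane)) (C : List Plane) (D : Set (Sym2 Plane)),
      FourConn.IsInnerCycle c S C ∧ FourConn.IsConsistentTriple P c T C D := by
  obtain ⟨L, hL, hcons⟩ := hS.consecutive
  have hk : 0 < k := by have := hc.three_le; omega
  obtain ⟨τ, f, Li, hLτ⟩ := hL.exists_listing hk hS.hull_edge
  have F := Li.frame hP hc hS hdist
  have hn := F.three_le_n
  have hper : ∀ m, τ (m + L.length) = τ m := fun m => (Li.eq_iff _ _).2 (by simp)
  have hsp := Li.spoked hP hc hS hdist fun m => (hcons _ _ (by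
    rw [hLτ, FourConn.cyclicPairs_stretch (by omega)]
    · exact ⟨m, rfl, rfl⟩
    · simpa [FourConn.stretch] using hper)).2
  have A := hsp.annulus (C := L.map FourConn.InwardTriangle.apex) (by
    rw [hLτ]
    simp [FourConn.stretch])
  obtain ⟨T, ε, c', a', f', D, hA, hD, hmax⟩ := A.exists_maximal
  refine ⟨T, L.map FourConn.InwardTriangle.apex, D, ⟨L, hL, rfl⟩,
    hA.isConsistentTriple hc ?_ hD hmax⟩
  intro p
  rw [List.mem_map]
  constructor
  · rintro ⟨t, ht, rfl⟩
    exact (hS.valid t ((hL.mem_iff t).1 ht)).1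
  · intro hp
    obtain ⟨t, ht, h⟩ := hS.exists_apex hdist hp
    exact ⟨t, (hL.mem_iff t).2 ht, h⟩
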